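/- **Multicompound options.** Let $(X_t)_{t\ge 0}$, $X_0=0$, be a real Lévy process on a probability space with measure $Q$, with characteristic exponent $\psi$, $E[e^{i\xi X_t}]=e^{-t\psi(\xi)}$ for $\xi\in\mathbb R$. Assume that $X$ is an RLPE of order $\upsilon\in(0,2]$ and exponential type $[\lambda_-,\lambda_+]$ with $\lambda_-<-1$, $\lambda_+>0$: $\psi(\xi)=-i\mu\xi+\phi(\xi)$ on $\operatorname{Im}\xi\in[\lambda_-,\lambda_+]$, where $\mu\in\mathbb R$, $\phi$ is holomorphic on $\operatorname{Im}\xi\in(\lambda_-,\lambda_+)$ and continuous up to the boundary of the strip, $\phi(\xi)=C|\xi|^{\upsilon}+O(|\xi|^{\upsilon_1})$ as $|\xi|\to\infty$ in the strip, and $|\phi'(\xi)|\le C'(1+|\xi|^{\upsilon_2})$ in the open strip, with $C>0$ and $\upsilon_1,\upsilon_2<\upsilon$. The stock is $S_t=e^{X_t}$, the interest rate is $r\ge 0$, and the martingale condition $r+\psi(-i)=0$ holds. Let $N\ge 1$, $0\le t=T_0<T_1<\dots<T_N$, $K_1,\dots,K_N>0$, and $w_1,\dots,w_N\in\{1,-1\}$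 ($w_j=1$ for a call, $-1$ for a put). Let $F^{(N)}(s):=s$ and, for $0\le j<N$, $$F^{(j)}(s)=E\Big[e^{-r(T_{j+1}-T_j)}\max\big\{w_{j+1}\big(F^{(j+1)}(s\,e^{X_{T_{j+1}}-X_{T_j}})-K_{j+1}\big),0\big\}\Big],\qquad s>0 .$$ Thus $F^{(j)}(s)$ is the price at $T_j$, for stock price $s$, of the $(N-j)$-fold compound option with expiries $T_{j+1},\dots,T_N$, strikes $K_{j+1},\dots,K_N$ and attributes $w_{j+1},\dots,w_N$; the current value of the $N$-fold compound option is $F^{(0)}(S_t)$. Put $v_j=w_jw_{j+1}\cdots w_N$ and $\epsilon_j=\prod_{n=1}^j w_nv_n$. Then the following hold. 1. For $0\le j<N$ the payoffs above are integrable, $e^{-r(T_{j+1}-T_j)}\max\{w_{j+1}(F^{(j+1)}(S_{T_{j+1}})-K_{j+1}),0\}$ is integrable, and its conditional expectation given $X_{T_j}$ is $F^{(j)}(S_{T_j})$ almost surely. 2. (Existence for compound calls.) If $1\le j\le N-1$ and $w_{j+1}=\dots=w_N=1$, there is exactly one $s>0$ with $F^{(j)}(s)=K_j$. 3. Let $S_1^*,\dots,S_{N-1}^*>0$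 satisfy $F^{(j)}(S_j^*)=K_j$ for $1\le j\le N-1$, and put $S_N^*=K_N$. Then: (a) (Uniqueness.) For $1\le j\le N-1$, $S_j^*$ is the only solution $s>0$ of $F^{(j)}(s)=K_j$. (b) For $s>0$ let $S_{T_j}=s\,e^{X_{T_j}-X_t}$ and let $\mathbf 1_j$ be the indicator of $\{v_nS_{T_n}\ge v_nS_n^*,\ n=1,\dots,j\}$. Then $S_{T_N}$ is integrable and $$F^{(0)}(s)=E\Big[e^{-r(T_N-t)}\prod_{n=1}^N w_n\,S_{T_N}\mathbf 1_N-\sum_{j=1}^N e^{-r(T_j-t)}\prod_{n=1}^j w_n\,K_j\mathbf 1_j\Big].$$ (c) (Valuation formula.) Let $\omega_1,\dots,\omega_N>0$ satisfy $\sum_{n=k}^j v_n\omega_n\in\,]-\lambda_+,-\lambda_--1[$ for all $1\le k\le j\le N$ (such $\omega$ exist). Let $L_n$ be the line $\operatorname{Im}\xi_n=-v_n\omega_n$, traversed from left to right, and $\Psi_j(\xi_1,\dots,\xi_j)=\sum_{k=1}^j(T_k-T_{k-1})\,\psi\big(\sum_{n=k}^j\xi_n\big)$. For every $s>0$ the following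 integrals converge absolutely and $$F^{(0)}(s)=\epsilon_N\frac{s\,e^{-r(T_N-t)}}{(2\pi i)^N}\int_{L_1}\!\!\cdots\!\int_{L_N}\frac{e^{\,i\sum_{n=1}^N\xi_n\ln\frac{s}{S_n^*}-\Psi_N(\xi_1,\dots,\xi_{N-1},\xi_N-i)}}{\prod_{n=1}^N\xi_n}\,d\xi_1\cdots d\xi_N-\sum_{j=1}^N\epsilon_j\frac{K_je^{-r(T_j-t)}}{(2\pi i)^j}\int_{L_1}\!\!\cdots\!\int_{L_j}\frac{e^{\,i\sum_{n=1}^j\xi_n\ln\frac{s}{S_n^*}-\Psi_j(\xi_1,\dots,\xi_j)}}{\prod_{n=1}^j\xi_n}\,d\xi_1\cdots d\xi_j .$$ Moreover $F^{(0)}$ is differentiable at $s$, and its derivative is the first term of this formula (the one with the $N$-fold integral in front of the sum) divided by $s$. (d) (Gaussian case.) Suppose $\psi(\xi)=i\big(\tfrac{\sigma^2}{2}-r\big)\xi+\tfrac{\sigma^2}{2}\xi^2$ for all $\xi\in\mathbb C$, with $\sigma>0$. Let $d_j^\pm=\dfrac{\ln(s/S_j^*)+(r\pm\sigma^2/2)(T_j-t)}{\sigma\sqrt{T_j-t}}$,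 let $\Xi_j$ be the symmetric $j\times j$ matrix with entries $v_kv_l\sqrt{(T_k-t)/(T_l-t)}$ for $k\le l$, and let $N_j(\,\cdot\,;\Xi)$ be the distribution function of the centred $j$-variate normal law with covariance matrix $\Xi$. Then for arbitrary $\omega_1,\dots,\omega_N>0$ the integrals in (c) converge absolutely, and the right-hand side of (c), as well as $F^{(0)}(s)$, equals $$s\prod_{n=1}^N w_n\,N_N(v_1d_1^+,\dots,v_Nd_N^+;\Xi_N)-\sum_{j=1}^N\Big(\prod_{n=1}^j w_n\Big)K_je^{-r(T_j-t)}N_j(v_1d_1^-,\dots,v_jd_j^-;\Xi_j).$$ When $w_2=\dots=w_N=1$ one has $v_n=w_n$ and $\epsilon_n=1$ for all $n$. -/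

import Mathlib

open MeasureTheory ProbabilityTheory Filter Topology
open scoped NNReal

noncomputable section

namespace Compound

/-- `X` is a one-dimensional Lévy process under `Q`: it starts at `0`, has independent and
stationary increments and is stochastically continuous. No path regularity is required. -/
structure IsLevy {Ω : Type*} [MeasurableSpace Ω] (X : ℝ≥0 → Ω → ℝ) (Q : Measure Ω) : Prop where
  measurable : ∀ t, Measurable (X t)
  zero : ∀ᵐ ω ∂Q, X 0 ω = 0
  indep : HasIndepIncrements X Q
  stationary : ∀ t h : ℝ≥0, IdentDistrib (fun ω => X (t + h) ω - X t ω) (X h) Q Q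
  continuous : ∀ t : ℝ≥0, TendstoInMeasure Q X (𝓝 t) (X t)

/-- `ψ` is the characteristic exponent of `X` under `Q`: `E e^{iξ X_t} = e^{-tψ(ξ)}`, `ξ` real. -/
def HasCharExponent {Ω : Type*} [MeasurableSpace Ω] (X : ℝ≥0 → Ω → ℝ) (Q : Measure Ω)
    (ψ : ℂ → ℂ) : Prop :=
  ∀ (t : ℝ≥0) (ξ : ℝ),
    ∫ ω, Complex.exp (Complex.I * (ξ : ℂ) * (X t ω : ℂ)) ∂Q =
      Complex.exp (-(((t : ℝ) : ℂ) * ψ (ξ : ℂ)))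

/-- `ψ` is a characteristic exponent regular of order `υ` and exponential type `[lm, lp]`:
`ψ(ξ) = -iμξ + φ(ξ)` on the strip `Im ξ ∈ [lm, lp]`, with `φ` holomorphic inside the strip,
continuous up to its boundary, `φ(ξ) = C|ξ|^υ + O(|ξ|^υ₁)` as `|ξ| → ∞` in the strip, and
`|φ'(ξ)| ≤ C'(1 + |ξ|^υ₂)`, where `C > 0` and `υ₁, υ₂ < υ`. -/
def IsRLPEExponent (ψ : ℂ → ℂ) (υ lm lp : ℝ) : Prop :=
  ∃ (μ : ℝ) (φ : ℂ → ℂ),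
    (∀ ξ : ℂ, ξ.im ∈ Set.Icc lm lp → ψ ξ = -(Complex.I * (μ : ℂ) * ξ) + φ ξ) ∧
    DifferentiableOn ℂ φ {ξ : ℂ | ξ.im ∈ Set.Ioo lm lp} ∧
    ContinuousOn φ {ξ : ℂ | ξ.im ∈ Set.Icc lm lp} ∧
    (∃ C υ₁ : ℝ, 0 < C ∧ υ₁ < υ ∧
      Asymptotics.IsBigO (Bornology.cobounded ℂ ⊓ 𝓟 {ξ : ℂ | ξ.im ∈ Set.Icc lm lp})
        (fun ξ : ℂ => φ ξ - ((C * ‖ξ‖ ^ υ : ℝ) : ℂ)) (fun ξ : ℂ => ‖ξ‖ ^ υ₁)) ∧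
    (∃ C' υ₂ : ℝ, υ₂ < υ ∧
      ∀ ξ : ℂ, ξ.im ∈ Set.Ioo lm lp → ‖deriv φ ξ‖ ≤ C' * (1 + ‖ξ‖ ^ υ₂))

section Value

variable {Ω : Type*} [MeasurableSpace Ω] (X : ℝ≥0 → Ω → ℝ) (Q : Measure Ω) (r : ℝ)
  (T : ℕ → ℝ≥0) (K w : ℕ → ℝ)

/-- Exercise payoff `(w (v - K))⁺`, discounted from `T_{j+1}` to `T_j`, of an option with expiry
`T_{j+1}`, strike `K_{j+1}` and call/put attribute `w_{j+1}` on an underlying worth `v` at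
`T_{j+1}`. -/
def discountedPayoff (j : ℕ) (v : ℝ) : ℝ :=
  Real.exp (-(r * ((T (j + 1) : ℝ) - (T j : ℝ)))) * max (w (j + 1) * (v - K (j + 1))) 0

/-- `value X Q r T K w m j s` is the price at time `T_j`, when the stock costs `s`, of the `m`-fold
compound option with expiries `T_{j+1}, …, T_{j+m}`, strikes `K_{j+1}, …, K_{j+m}` and call/put
attributes `w_{j+1}, …, w_{j+m}`. The `0`-fold option is the stock itself; given that the stock
`e^X` costs `s` at time `T_j`, it costs `s e^{X_{T_{j+1}} - X_{T_j}}` at time `T_{j+1}`. -/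
def value : ℕ → ℕ → ℝ → ℝ
  | 0, _, s => s
  | m + 1, j, s =>
      ∫ ω, discountedPayoff r T K w j
        (value m (j + 1) (s * Real.exp (X (T (j + 1)) ω - X (T j) ω))) ∂Q

end Value

/-- The sign `w_j w_{j+1} ⋯ w_N`: the option of order `N - j + 1` written at level `j` is
exercised at `T_j` above the critical stock price if this is `1`, below it if this is `-1`. -/
def exerciseSign (w : ℕ → ℝ) (N j : ℕ) : ℝ := ∏ n ∈ Finset.Icc j N, w n

/-- Stock price at time `T_j` when it is `s` at time `T_0`. -/
def stockAt {Ω : Type*} (X : ℝ≥0 → Ω → ℝ) (T : ℕ → ℝ≥0) (s : ℝ) (j : ℕ) (ω : Ω) : ℝ :=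
  s * Real.exp (X (T j) ω - X (T 0) ω)

/-- All of the options at levels `1, …, j` are exercised. -/
def exerciseEvent {Ω : Type*} (X : ℝ≥0 → Ω → ℝ) (T : ℕ → ℝ≥0) (w Sstar : ℕ → ℝ) (N : ℕ)
    (s : ℝ) (j : ℕ) : Set Ω :=
  {ω | ∀ n ∈ Finset.Icc 1 j,
    exerciseSign w N n * Sstar n ≤ exerciseSign w N n * stockAt X T s n ω}

section Contour

variable (ψ : ℂ → ℂ) (r : ℝ) (T : ℕ → ℝ≥0) (K w : ℕ → ℝ) (N : ℕ) (Sstar ω : ℕ → ℝ) (s : ℝ)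

/-- The point `(ξ_1, …, ξ_j)`, `ξ_n = x_n - i v_n ω_n`, of the product of the lines
`Im ξ_n = -v_n ω_n`, where `v_n` is the exercise sign (coordinate `n : Fin j` stands for `n+1`). -/
def contourPoint (j : ℕ) (x : Fin j → ℝ) (n : Fin j) : ℂ :=
  (x n : ℂ) - Complex.I * ((exerciseSign w N (n + 1) * ω (n + 1) : ℝ) : ℂ)

/-- `Ψ_j(ξ_1, …, ξ_j) = ∑_{k=1}^j (T_k - T_{k-1}) ψ(ξ_k + ⋯ + ξ_j)`. -/
def bigPsi (j : ℕ) (ξ : Fin j → ℂ) : ℂ :=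
  ∑ k : Fin j, (((T (k + 1) : ℝ) - (T k : ℝ) : ℝ) : ℂ) * ψ (∑ n ∈ Finset.Ici k, ξ n)

/-- `(ξ_1, …, ξ_j) ↦ (ξ_1, …, ξ_j - i)`. -/
def shiftLast (j : ℕ) (ξ : Fin j → ℂ) (n : Fin j) : ℂ :=
  if (n : ℕ) + 1 = j then ξ n - Complex.I else ξ n

/-- `(∏ ξ_n)⁻¹ exp(i ∑ ξ_n ln(s / S_n^*))`. -/
def kernelFactor (j : ℕ) (ξ : Fin j → ℂ) : ℂ :=
  (∏ n, ξ n)⁻¹ *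
    Complex.exp (Complex.I * ∑ n : Fin j, ξ n * ((Real.log (s / Sstar (n + 1)) : ℝ) : ℂ))

/-- Integrand of the `N`-fold contour integral of the stock term. -/
def stockIntegrand (x : Fin N → ℝ) : ℂ :=
  kernelFactor Sstar s N (contourPoint w N ω N x) *
    Complex.exp (-bigPsi ψ T N (shiftLast N (contourPoint w N ω N x)))

/-- Integrand of the `j`-fold contour integral of the `j`-th strike term. -/
def strikeIntegrand (j : ℕ) (x : Fin j → ℝ) : ℂ :=
  kernelFactor Sstar s j (contourPoint w N ω j x) *
    Complex.exp (-bigPsi ψ T j (contourPoint w N ω j x))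

/-- The sign `∏_{n ≤ j} w_n v_n`, with `v_n` the exercise sign. It is `1` for all `j` when
`w_2 = ⋯ = w_N = 1`. -/
def termSign (j : ℕ) : ℝ := ∏ n ∈ Finset.Icc 1 j, w n * exerciseSign w N n

/-- The stock term of the valuation formula. -/
def stockTerm : ℂ :=
  (termSign w N N : ℂ) * ((s * Real.exp (-(r * ((T N : ℝ) - (T 0 : ℝ)))) : ℝ) : ℂ) /
      (2 * (Real.pi : ℂ) * Complex.I) ^ N *
    ∫ x : Fin N → ℝ, stockIntegrand ψ T w N Sstar ω s x

/-- The `j`-th strike term of the valuation formula. -/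
def strikeTerm (j : ℕ) : ℂ :=
  (termSign w N j : ℂ) * ((K j * Real.exp (-(r * ((T j : ℝ) - (T 0 : ℝ)))) : ℝ) : ℂ) /
      (2 * (Real.pi : ℂ) * Complex.I) ^ j *
    ∫ x : Fin j → ℝ, strikeIntegrand ψ T w N Sstar ω s j x

/-- All contour integrals of the valuation formula converge absolutely. -/
def ContoursConverge : Prop :=
  Integrable (stockIntegrand ψ T w N Sstar ω s) ∧
    ∀ j ∈ Finset.Icc 1 N, Integrable (strikeIntegrand ψ T w N Sstar ω s j)

/-- The contour-integral formula for the `N`-fold compound option. -/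
def contourFormula : ℂ :=
  stockTerm ψ r T w N Sstar ω s - ∑ j ∈ Finset.Icc 1 N, strikeTerm ψ r T K w N Sstar ω s j

end Contour

/-- Shifts admissible for exponential type `[lm, lp]`: positive, with
`v_k ω_k + ⋯ + v_j ω_j ∈ ]-lp, -lm - 1[` for all `1 ≤ k ≤ j ≤ N`. -/
def AdmissibleShift (w : ℕ → ℝ) (N : ℕ) (lm lp : ℝ) (ω : ℕ → ℝ) : Prop :=
  (∀ n ∈ Finset.Icc 1 N, 0 < ω n) ∧
    ∀ k j : ℕ, 1 ≤ k → k ≤ j → j ≤ N →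
      ∑ n ∈ Finset.Icc k j, exerciseSign w N n * ω n ∈ Set.Ioo (-lp) (-lm - 1)

/-- Distribution function at `d` of the centred `j`-variate normal law with covariance matrix
`C`. -/
def normalCDF {j : ℕ} (d : Fin j → ℝ) (C : Matrix (Fin j) (Fin j) ℝ) : ℝ :=
  (multivariateGaussian 0 C).real {y : EuclideanSpace ℝ (Fin j) | ∀ n, y n ≤ d n}

section Gaussian

variable (r σ : ℝ) (T : ℕ → ℝ≥0) (K w : ℕ → ℝ) (N : ℕ) (Sstar : ℕ → ℝ) (s : ℝ)

/-- `d_n^± = (ln(s / S_n^*) + (r ± σ²/2)(T_n - T_0)) / (σ √(T_n - T_0))`, with `ε = ±1` the sign. -/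
def dGauss (ε : ℝ) (n : ℕ) : ℝ :=
  (Real.log (s / Sstar n) + (r + ε * (σ ^ 2 / 2)) * ((T n : ℝ) - (T 0 : ℝ))) /
    (σ * Real.sqrt ((T n : ℝ) - (T 0 : ℝ)))

/-- The `j × j` correlation matrix with entries `v_k v_l √((T_k - T_0) / (T_l - T_0))`,
`k ≤ l`. -/
def corrMatrix (j : ℕ) : Matrix (Fin j) (Fin j) ℝ :=
  Matrix.of fun k l =>
    exerciseSign w N (k + 1) * exerciseSign w N (l + 1) *
      Real.sqrt (((T (min (k : ℕ) l + 1) : ℝ) - (T 0 : ℝ)) /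
        ((T (max (k : ℕ) l + 1) : ℝ) - (T 0 : ℝ)))

/-- `N_j(v_1 d_1^±, …, v_j d_j^±; Ξ_j)`. -/
def gaussTerm (ε : ℝ) (j : ℕ) : ℝ :=
  normalCDF (fun n : Fin j => exerciseSign w N (n + 1) * dGauss r σ T Sstar s ε (n + 1))
    (corrMatrix T w N j)

/-- The multivariate-normal formula for the `N`-fold compound option. -/
def gaussFormula : ℝ :=
  s * (∏ n ∈ Finset.Icc 1 N, w n) * gaussTerm r σ T w N Sstar s 1 N -
    ∑ j ∈ Finset.Icc 1 N, (∏ n ∈ Finset.Icc 1 j, w n) * K j *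
      Real.exp (-(r * ((T j : ℝ) - (T 0 : ℝ)))) * gaussTerm r σ T w N Sstar s (-1) j

end Gaussian

end Compound

end

/-!
# Compound options under regular Lévy processes of exponential type

The price of a compound option is computed by unrolling the backward recursion for its value into a
sum over exercise events, and by rewriting the expectation over each exercise event as an iterated
contour integral.

*Exponential moments.* The exponent grows like `|ξ| ^ υ`, so the characteristic function of `X_t` is
integrable and Fourier inversion gives a bounded density (`eq_withDensity_invCharFun`). Shifting the
contour of the inversion integral within the strip of analyticity shows that this density decays
exponentially. Hence the exponential moments exist (`integrable_exp_mul_of_exponent`) and the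
formula for the characteristic function holds throughout the open strip
(`integral_exp_of_exponent`). The increments have no atoms.

*Unbounded support.* Critical prices are unique only if the increments take arbitrarily large and
arbitrarily small values with positive probability (`IsLevy.measure_gt_pos`,
`IsLevy.measure_lt_pos`). The Lévy–Khintchine representation is not needed for this. If the
increments were bounded on one side, a reflection and a shift by the essential bound would turn
them into a family of nonnegative infinitely divisible laws with support reaching `0`. Let `ρ_n` be
the convolution roots of such a law. The limits of `n ∫ y / (ε² + y²) dρ_n` and
`n ∫ y² / (ε² + y²) dρ_n` are, up to the sign and a factor `ε`, the Laplace transforms of the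
imaginary and real parts of the exponent. Comparing the two kernels pointwise makes the imaginary
part at least of the order of the real part, while the Laplace exponent of the law grows slower than linearly; for an exponent that is
`C |ξ| ^ υ` with a real `C > 0`, up to a drift and lower order terms, this is impossible
(`false_of_oneSided`).

*The value function.* The value is `1`-Lipschitz in the stock price, and strictly monotone in the
direction of the exercise sign once critical prices exist
(`StockModel.exerciseSign_mul_value_lt`). Therefore an option is exercised exactly when the stock
lies beyond the critical price, on the side given by that sign (`StockModel.discountedPayoff_value`).
Inserting this into the recursion, one level at a time, yields the value as the expectation of the
stock received minus the strikes paid (`StockModel.value_eq`). Since the payoff is Lipschitz, and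
differentiable except at a price attained with probability zero, the recursion can be differentiated
under the expectation; the same unrolling then identifies the derivative
(`StockModel.deriv_value_unroll`).

*Contour integrals.* After damping by `e^{∑ v_n ω_n Y_n}` the vector of log-prices at the expiries
has an integrable characteristic function. The Fourier transform of a damped half-line indicator is
a simple pole, so a Parseval identity writes the expectation over an orthant as an integral along
the lines `Im ξ_n = -v_n ω_n` with one pole in each variable (`integral_orthant_eq_contour`). The
joint characteristic function is computed from the independent increments, and the condition on
the sums of the `v_n ω_n` says exactly that its arguments stay in the strip of regularity
(`IsLevy.contourFormula_eq`).

*Gaussian case.* A quadratic exponent is regular on every strip (`isRLPEExponent_quadratic`), so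
every positive `ω` is admissible in a sufficiently wide one. The normalized log-prices are jointly
normal, both under `Q` and under the measure with the discounted stock as density, and the exercise
probabilities become values of multivariate normal distribution functions
(`IsLevy.value_eq_gaussFormula`).
-/

noncomputable section

namespace Compound

/-! ### Fourier inversion for finite measures -/

section Inversion

variable {V : Type*} [NormedAddCommGroup V] [InnerProductSpace ℝ V] [FiniteDimensional ℝ V]
  [MeasurableSpace V] [BorelSpace V]

set_option linter.unusedSectionVars false

/-- The centred Gaussian density whose variance is inversely proportional to `c`. -/
def gaussKernel (V : Type*) [NormedAddCommGroup V] [InnerProductSpace ℝ V] (c : ℝ) (v : V) : ℝ :=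
  (Real.pi * c) ^ ((Module.finrank ℝ V : ℝ) / 2) * Real.exp (-Real.pi ^ 2 * c * ‖v‖ ^ 2)

lemma gaussKernel_nonneg {c : ℝ} (hc : 0 < c) (v : V) : 0 ≤ gaussKernel V c v := by
  unfold gaussKernel; positivity

lemma continuous_gaussKernel (c : ℝ) : Continuous (gaussKernel V c) := by
  unfold gaussKernel; fun_prop

lemma gaussKernel_cast {c : ℝ} (hc : 0 < c) (v : V) :
    ((gaussKernel V c v : ℝ) : ℂ) = (Real.pi * c : ℂ) ^ ((Module.finrank ℝ V : ℂ) / 2) *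
      Complex.exp (-Real.pi ^ 2 * c * ‖v‖ ^ 2) := by
  unfold gaussKernel
  push_cast
  congr 1
  rw [← Complex.ofReal_mul, Complex.ofReal_cpow (by positivity)]
  simp

lemma integrable_gaussKernel {c : ℝ} (hc : 0 < c) : Integrable (gaussKernel V c) := by
  have h := GaussianFourier.integrable_cexp_neg_mul_sq_norm_add (V := V)
    (b := ((Real.pi ^ 2 * c : ℝ) : ℂ)) (by rw [Complex.ofReal_re]; positivity) 0 0
  have h2 := h.norm.const_mul ((Real.pi * c) ^ ((Module.finrank ℝ V : ℝ) / 2))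
  refine h2.congr (ae_of_all _ fun v => ?_)
  simp only [gaussKernel, Complex.norm_exp]
  congr 2
  simp [← Complex.ofReal_pow, ← Complex.ofReal_mul, ← Complex.ofReal_neg]

lemma integral_gaussKernel {c : ℝ} (hc : 0 < c) : ∫ v : V, gaussKernel V c v = 1 := by
  have h := GaussianFourier.integral_cexp_neg_mul_sq_norm (V := V)
    (b := ((Real.pi ^ 2 * c : ℝ) : ℂ)) (by rw [Complex.ofReal_re]; positivity)
  have h1 : ((∫ v : V, gaussKernel V c v : ℝ) : ℂ) = 1 := by
    rw [← integral_complex_ofReal]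
    simp_rw [gaussKernel_cast hc]
    rw [integral_const_mul]
    have e : (fun v : V => Complex.exp (-(Real.pi : ℂ) ^ 2 * c * (‖v‖ : ℂ) ^ 2)) =
        fun v : V => Complex.exp (-((Real.pi ^ 2 * c : ℝ) : ℂ) * (‖v‖ : ℂ) ^ 2) := by
      funext v; push_cast; ring_nf
    rw [e, h]
    have e1 : (Real.pi : ℂ) * c = ((Real.pi * c : ℝ) : ℂ) := by push_cast; ring
    have e2 : (Real.pi : ℂ) / ((Real.pi ^ 2 * c : ℝ) : ℂ) = ((Real.pi * c : ℝ) : ℂ)⁻¹ := by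
      have : (Real.pi : ℂ) ≠ 0 := by exact_mod_cast Real.pi_ne_zero
      have : (c : ℂ) ≠ 0 := by exact_mod_cast hc.ne'
      push_cast; field_simp
    have hpc : 0 < Real.pi * c := by positivity
    rw [e1, e2, Complex.inv_cpow _ _ (by
      rw [Complex.arg_ofReal_of_nonneg hpc.le]; exact Real.pi_pos.ne), mul_inv_cancel₀]
    rw [Complex.cpow_ne_zero_iff]
    left; exact_mod_cast hpc.ne'
  exact_mod_cast h1

/-- The inverse Fourier transform of the characteristic function of `ν`, with the normalisation
`e^{2πi⟨w,x⟩}`. -/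
def invCharFun (ν : Measure V) (w : V) : ℂ :=
  ∫ x : V, Complex.exp (2 * Real.pi * Complex.I * (inner ℝ w x : ℝ)) *
    charFun ν (-(2 * Real.pi) • x)

lemma integral_gaussKernel_sub (ν : Measure V) [IsFiniteMeasure ν] {c : ℝ} (hc : 0 < c) (w : V) :
    ((∫ v : V, gaussKernel V c (w - v) ∂ν : ℝ) : ℂ) =
      ∫ x : V, Complex.exp (-(c : ℂ)⁻¹ * ‖x‖ ^ 2) *
        (Complex.exp (2 * Real.pi * Complex.I * (inner ℝ w x : ℝ)) *
          charFun ν (-(2 * Real.pi) • x)) := by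
  have hb : 0 < ((c : ℂ)⁻¹).re := by
    rw [← Complex.ofReal_inv, Complex.ofReal_re]; positivity
  have hg := GaussianFourier.integrable_cexp_neg_mul_sq_norm_add (V := V) hb
    (2 * Real.pi * Complex.I) w
  rw [← integral_complex_ofReal]
  have e1 : ∀ v : V, ((gaussKernel V c (w - v) : ℝ) : ℂ) =
      ∫ x : V, Complex.exp (((-(2 * Real.pi) * inner ℝ x v : ℝ) : ℂ) * Complex.I) *
        Complex.exp (-(c : ℂ)⁻¹ * ‖x‖ ^ 2 + 2 * Real.pi * Complex.I * (inner ℝ w x : ℝ)) := by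
    intro v
    have := fourier_gaussian_innerProductSpace' (V := V) hb w v
    rw [gaussKernel_cast hc]
    rw [Real.fourier_eq'] at this
    simp only [smul_eq_mul] at this
    rw [show (Real.pi * c : ℂ) = Real.pi / (c : ℂ)⁻¹ by simp,
      show -(Real.pi : ℂ) ^ 2 * c * (‖w - v‖ : ℂ) ^ 2 =
          -(Real.pi : ℂ) ^ 2 * (‖w - v‖ : ℂ) ^ 2 / (c : ℂ)⁻¹ by
          rw [div_inv_eq_mul]; ring]
    simpa only [neg_mul] using this.symm
  simp_rw [e1]
  rw [integral_integral_swap]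
  · congr 1
    funext x
    rw [integral_mul_const, charFun_apply, Complex.exp_add]
    have : ∀ v : V, Complex.exp (((-(2 * Real.pi) * inner ℝ x v : ℝ) : ℂ) * Complex.I) =
        Complex.exp ((inner ℝ v (-(2 * Real.pi) • x) : ℝ) * Complex.I) := by
      intro v
      rw [inner_smul_right, real_inner_comm]
    simp_rw [this]
    ring
  · have h1 : Integrable (fun z : V × V => (1 : ℂ) * Complex.exp (-(c : ℂ)⁻¹ * ‖z.2‖ ^ 2 +
        2 * Real.pi * Complex.I * (inner ℝ w z.2 : ℝ))) (ν.prod volume) :=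
      (integrable_const (1 : ℂ)).mul_prod hg
    refine h1.mono (Continuous.aestronglyMeasurable (by unfold Function.uncurry; fun_prop))
      (ae_of_all _ fun z => ?_)
    simp only [Function.uncurry, norm_mul, Complex.norm_exp_ofReal_mul_I, norm_one]
    exact le_rfl

lemma integrable_invCharFun_integrand {ν : Measure V} [IsFiniteMeasure ν]
    (h : Integrable (charFun ν)) (w : V) :
    Integrable (fun x : V => Complex.exp (2 * Real.pi * Complex.I * (inner ℝ w x : ℝ)) *
    charFun ν (-(2 * Real.pi) • x)) := by
  have h2 : Integrable (fun x : V => charFun ν (-(2 * Real.pi) • x)) :=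
    h.comp_smul (by simp [Real.pi_ne_zero])
  refine h2.mono ((Continuous.aestronglyMeasurable (by fun_prop)).mul h2.1)
    (ae_of_all _ fun x => ?_)
  rw [norm_mul, show (2 * Real.pi * Complex.I * (inner ℝ w x : ℝ) : ℂ) =
    ((2 * Real.pi * inner ℝ w x : ℝ) : ℂ) * Complex.I by push_cast; ring,
    Complex.norm_exp_ofReal_mul_I, one_mul]

lemma norm_invCharFun_integrand_le (ν : Measure V) (w x : V) :
    ‖Complex.exp (2 * Real.pi * Complex.I * (inner ℝ w x : ℝ)) *
      charFun ν (-(2 * Real.pi) • x)‖ = ‖charFun ν (-(2 * Real.pi) • x)‖ := by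
  rw [norm_mul, show (2 * Real.pi * Complex.I * (inner ℝ w x : ℝ) : ℂ) =
    ((2 * Real.pi * inner ℝ w x : ℝ) : ℂ) * Complex.I by push_cast; ring,
    Complex.norm_exp_ofReal_mul_I, one_mul]

lemma norm_exp_neg_inv_mul_sq_le {c : ℝ} (hc : 0 < c) (x : V) :
    ‖Complex.exp (-(c : ℂ)⁻¹ * ‖x‖ ^ 2)‖ ≤ 1 := by
  rw [Complex.norm_exp, Real.exp_le_one_iff]
  rw [show (-(c : ℂ)⁻¹ * (‖x‖ : ℂ) ^ 2) = ((-c⁻¹ * ‖x‖ ^ 2 : ℝ) : ℂ) by push_cast; ring,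
    Complex.ofReal_re]
  have : 0 ≤ c⁻¹ * ‖x‖ ^ 2 := by positivity
  linarith

lemma tendsto_integral_gaussKernel_sub {ν : Measure V} [IsFiniteMeasure ν]
    (h : Integrable (charFun ν)) (w : V) :
    Tendsto (fun c : ℝ => ((∫ v : V, gaussKernel V c (w - v) ∂ν : ℝ) : ℂ)) atTop
      (𝓝 (invCharFun ν w)) := by
  have := Real.tendsto_integral_cexp_sq_smul (integrable_invCharFun_integrand h w)
  refine this.congr' ?_
  filter_upwards [Ioi_mem_atTop 0] with c (hc : 0 < c)
  rw [integral_gaussKernel_sub ν hc w]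
  simp

lemma continuous_invCharFun {ν : Measure V} [IsFiniteMeasure ν] (h : Integrable (charFun ν)) :
    Continuous (invCharFun ν) := by
  refine continuous_of_dominated (bound := fun x => ‖charFun ν (-(2 * Real.pi) • x)‖)
    (fun w => (integrable_invCharFun_integrand h w).1)
    (fun w => ae_of_all _ fun x => (norm_invCharFun_integrand_le ν w x).le)
    (h.comp_smul (R := -(2 * Real.pi)) (by simp [Real.pi_ne_zero])).norm
    (ae_of_all _ fun x => by fun_prop)

lemma invCharFun_eq_ofReal {ν : Measure V} [IsFiniteMeasure ν] (h : Integrable (charFun ν))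
    (w : V) : 0 ≤ (invCharFun ν w).re ∧ (((invCharFun ν w).re : ℝ) : ℂ) = invCharFun ν w := by
  have ht := tendsto_integral_gaussKernel_sub h w
  have h1 : Tendsto (fun c : ℝ => ∫ v : V, gaussKernel V c (w - v) ∂ν) atTop
      (𝓝 (invCharFun ν w).re) := (Complex.continuous_re.tendsto _).comp ht
  have h2 : Tendsto (fun c : ℝ => (0 : ℝ)) atTop (𝓝 (invCharFun ν w).im) := by
    have := (Complex.continuous_im.tendsto _).comp ht
    refine this.congr fun c => by simp
  constructor
  · refine ge_of_tendsto h1 ?_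
    filter_upwards [Ioi_mem_atTop 0] with c (hc : 0 < c)
    exact integral_nonneg fun v => gaussKernel_nonneg hc _
  · have := tendsto_nhds_unique h2 tendsto_const_nhds
    apply Complex.ext <;> simp [this]

/-- **Fourier inversion for measures.** A finite measure with integrable characteristic function
has the inverse Fourier transform of the latter as a density. The proof mollifies both sides with
Gaussian densities. -/
theorem eq_withDensity_invCharFun {ν : Measure V} [IsFiniteMeasure ν]
    (h : Integrable (charFun ν)) :
    ν = volume.withDensity (fun w => ENNReal.ofReal (invCharFun ν w).re) := by
  have hcont : Continuous fun w => (invCharFun ν w).re :=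
    Complex.continuous_re.comp (continuous_invCharFun h)
  have : IsLocallyFiniteMeasure
      (volume.withDensity (fun w : V => ENNReal.ofReal (invCharFun ν w).re)) := 
    IsLocallyFiniteMeasure.withDensity_ofReal hcont
  refine Measure.ext_of_integral_eq_on_compactlySupported fun f => ?_
  have hfi : Integrable (fun w => f w) (volume : Measure V) :=
    f.continuous.integrable_of_hasCompactSupport f.hasCompactSupport
  have hfν : Integrable (fun w => f w) ν :=
    f.continuous.integrable_of_hasCompactSupport f.hasCompactSupport
  obtain ⟨M, hM⟩ := f.continuous.bounded_above_of_compact_support f.hasCompactSupport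
  -- the mollified function, integrated against `ν`
  have hA : Tendsto (fun c : ℝ => ∫ v, ∫ w, gaussKernel V c (v - w) * f w ∂volume ∂ν) atTop
      (𝓝 (∫ v, f v ∂ν)) := by
    refine tendsto_integral_filter_of_dominated_convergence (fun _ => M) ?_ ?_
      (integrable_const _) ?_
    · filter_upwards [Ioi_mem_atTop 0] with c (hc : 0 < c)
      refine Continuous.aestronglyMeasurable ?_
      refine continuous_of_dominated (F := fun v w => gaussKernel V c (v - w) * f w)
        (bound := fun w => (Real.pi * c) ^ ((Module.finrank ℝ V : ℝ) / 2) * ‖f w‖) ?_ ?_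
        (hfi.norm.const_mul _) ?_
      · intro v
        exact (((continuous_gaussKernel c).comp (by fun_prop)).mul f.continuous).aestronglyMeasurable
      · intro v
        refine ae_of_all _ fun w => ?_
        rw [norm_mul, Real.norm_of_nonneg (gaussKernel_nonneg hc _)]
        gcongr
        unfold gaussKernel
        refine mul_le_of_le_one_right (by positivity) ?_
        rw [Real.exp_le_one_iff]
        have : 0 ≤ Real.pi ^ 2 * c * ‖v - w‖ ^ 2 := by positivity
        linarith
      · exact ae_of_all _ fun w =>
          ((continuous_gaussKernel c).comp (by fun_prop)).mul continuous_const
    · filter_upwards [Ioi_mem_atTop 0] with c (hc : 0 < c)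
      refine ae_of_all _ fun v => ?_
      have hk : Integrable fun w : V => gaussKernel V c (v - w) :=
        (integrable_gaussKernel hc).comp_sub_left v
      calc ‖∫ w, gaussKernel V c (v - w) * f w‖
          ≤ ∫ w, gaussKernel V c (v - w) * M := by
            refine norm_integral_le_of_norm_le (hk.mul_const _) (ae_of_all _ fun w => ?_)
            rw [norm_mul, Real.norm_of_nonneg (gaussKernel_nonneg hc _)]
            exact mul_le_mul_of_nonneg_left (hM w) (gaussKernel_nonneg hc _)
        _ = M := by
            rw [integral_mul_const, integral_sub_left_eq_self, integral_gaussKernel hc, one_mul]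
    · refine ae_of_all _ fun v => ?_
      have := Real.tendsto_integral_gaussian_smul' (f := fun w => ((f w : ℝ) : ℂ)) hfi.ofReal (v := v)
        (Complex.continuous_ofReal.comp f.continuous).continuousAt
      have h2 := (Complex.continuous_re.tendsto _).comp this
      refine h2.congr' ?_
      filter_upwards [Ioi_mem_atTop 0] with c (hc : 0 < c)
      simp only [Function.comp_apply, smul_eq_mul, ← gaussKernel_cast hc]
      rw [← Complex.ofReal_re (∫ w, gaussKernel V c (v - w) * f w), ← integral_complex_ofReal]
      simp only [Complex.ofReal_mul]
  have hB : Tendsto (fun c : ℝ => ∫ v, ∫ w, gaussKernel V c (v - w) * f w ∂volume ∂ν) atTop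
      (𝓝 (∫ w, (invCharFun ν w).re * f w)) := by
    have hswap : ∀ᶠ c : ℝ in atTop, ∫ w, (∫ v, gaussKernel V c (w - v) ∂ν) * f w =
        ∫ v, ∫ w, gaussKernel V c (v - w) * f w ∂volume ∂ν := by
      filter_upwards [Ioi_mem_atTop 0] with c (hc : 0 < c)
      rw [integral_integral_swap]
      · refine integral_congr_ae (ae_of_all _ fun w => ?_)
        simp only
        rw [integral_mul_const]
        congr 2; funext v
        simp [gaussKernel, norm_sub_rev]
      · have h1 : Integrable (fun z : V × V => (Real.pi * c) ^ ((Module.finrank ℝ V : ℝ) / 2) *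
            f z.2) (ν.prod volume) :=
          (integrable_const (μ := ν) ((Real.pi * c) ^ ((Module.finrank ℝ V : ℝ) / 2))).mul_prod hfi
        refine h1.mono (Continuous.aestronglyMeasurable ?_) (ae_of_all _ fun z => ?_)
        · exact ((continuous_gaussKernel c).comp (by fun_prop)).mul
            (f.continuous.comp continuous_snd)
        · simp only [Function.uncurry, norm_mul]
          rw [Real.norm_of_nonneg (gaussKernel_nonneg hc _)]
          gcongr
          refine le_trans ?_ (le_abs_self _)
          unfold gaussKernel
          refine mul_le_of_le_one_right (by positivity) ?_
          rw [Real.exp_le_one_iff]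
          have : 0 ≤ Real.pi ^ 2 * c * ‖z.1 - z.2‖ ^ 2 := by positivity
          linarith
    refine Tendsto.congr' hswap ?_
    refine tendsto_integral_filter_of_dominated_convergence
      (fun w => (∫ x : V, ‖charFun ν (-(2 * Real.pi) • x)‖) * ‖f w‖) ?_ ?_
      (hfi.norm.const_mul _) ?_
    · filter_upwards [Ioi_mem_atTop 0] with c (hc : 0 < c)
      refine AEStronglyMeasurable.mul (StronglyMeasurable.aestronglyMeasurable ?_) hfi.1
      exact StronglyMeasurable.integral_prod_right
        (f := fun w v : V => gaussKernel V c (w - v))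
        ((continuous_gaussKernel c).comp
          (continuous_fst.sub continuous_snd)).stronglyMeasurable
    · filter_upwards [Ioi_mem_atTop 0] with c (hc : 0 < c)
      refine ae_of_all _ fun w => ?_
      rw [norm_mul]
      gcongr
      rw [← Complex.norm_real, integral_gaussKernel_sub ν hc w]
      refine norm_integral_le_of_norm_le
        (h.comp_smul (R := -(2 * Real.pi)) (by simp [Real.pi_ne_zero])).norm
        (ae_of_all _ fun x => ?_)
      rw [norm_mul, norm_invCharFun_integrand_le]
      exact mul_le_of_le_one_left (norm_nonneg _) (norm_exp_neg_inv_mul_sq_le hc x)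
    · refine ae_of_all _ fun w => Tendsto.mul_const _ ?_
      exact (Complex.continuous_re.tendsto _).comp (tendsto_integral_gaussKernel_sub h w)
  rw [tendsto_nhds_unique hA hB, integral_withDensity_eq_integral_toReal_smul
    hcont.measurable.ennreal_ofReal (ae_of_all _ fun _ => ENNReal.ofReal_lt_top)]
  refine integral_congr_ae (ae_of_all _ fun w => ?_)
  simp [ENNReal.toReal_ofReal (invCharFun_eq_ofReal h w).1]

end Inversion

/-! ### Contour representation of orthant expectations -/

section Contour

/-- Parseval's identity: the expectation of `h`, through the Fourier transform of `h` and the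
characteristic function of the law. -/
lemma integral_eq_integral_mul_charFun {V : Type*} [NormedAddCommGroup V] [InnerProductSpace ℝ V]
    [FiniteDimensional ℝ V] [MeasurableSpace V] [BorelSpace V] {ν : Measure V}
    [IsFiniteMeasure ν] (hν : Integrable (charFun ν)) {h : V → ℂ} (hh : Integrable h) :
    ∫ w, h w ∂ν = (((2 * Real.pi) ^ Module.finrank ℝ V)⁻¹ : ℝ) *
      ∫ x : V, (∫ w : V, h w * Complex.exp (-(Complex.I * (inner ℝ w x : ℝ)))) *
        charFun ν x := by
  have h1 : ∫ w, h w ∂ν = ∫ w, h w * invCharFun ν w := by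
    have hcont : Continuous fun w => (invCharFun ν w).re :=
      Complex.continuous_re.comp (continuous_invCharFun hν)
    conv_lhs => rw [eq_withDensity_invCharFun hν]
    rw [integral_withDensity_eq_integral_toReal_smul
      hcont.measurable.ennreal_ofReal (ae_of_all _ fun _ => ENNReal.ofReal_lt_top)]
    refine integral_congr_ae (ae_of_all _ fun w => ?_)
    simp only
    rw [ENNReal.toReal_ofReal (invCharFun_eq_ofReal hν w).1, Complex.real_smul,
      (invCharFun_eq_ofReal hν w).2, mul_comm]
  have hc2 : Integrable (fun x : V => charFun ν (-(2 * Real.pi) • x)) :=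
    hν.comp_smul (by simp [Real.pi_ne_zero])
  have h2 : ∫ w, h w * invCharFun ν w =
      ∫ x : V, (∫ w : V, h w * Complex.exp (2 * Real.pi * Complex.I * (inner ℝ w x : ℝ))) *
        charFun ν (-(2 * Real.pi) • x) := by
    simp_rw [invCharFun, ← integral_const_mul, ← integral_mul_const]
    rw [integral_integral_swap]
    · simp_rw [mul_assoc]
    · refine (hh.mul_prod hc2).mono ?_ (ae_of_all _ fun z => ?_)
      · refine AEStronglyMeasurable.mul hh.1.comp_fst (AEStronglyMeasurable.mul
          (Continuous.aestronglyMeasurable (by fun_prop)) hc2.1.comp_snd)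
      · simp only [Function.uncurry]
        rw [norm_mul, norm_invCharFun_integrand_le, norm_mul]
  have h3 := Measure.integral_comp_smul (volume : Measure V)
    (fun x : V => (∫ w : V, h w * Complex.exp (-(Complex.I * (inner ℝ w x : ℝ)))) *
        charFun ν x) (-(2 * Real.pi))
  rw [h1, h2]
  have e : (fun x : V => (∫ w : V, h w * Complex.exp (2 * Real.pi * Complex.I *
      (inner ℝ w x : ℝ))) * charFun ν (-(2 * Real.pi) • x)) = fun x : V =>
      (fun x : V => (∫ w : V, h w * Complex.exp (-(Complex.I * (inner ℝ w x : ℝ)))) *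
        charFun ν x) (-(2 * Real.pi) • x) := by
    funext x
    simp only
    congr 2; funext w; congr 2
    rw [inner_smul_right]; push_cast; ring
  rw [e, h3, Complex.real_smul]
  congr 2
  rw [abs_inv, abs_pow, abs_neg, abs_of_pos Real.two_pi_pos]

/-- The Fourier transform of a damped half-line indicator: a simple pole. -/
lemma integral_halfLine {v om : ℝ} (hv : v = 1 ∨ v = -1) (hom : 0 < om) (a x : ℝ) :
    Integrable (fun w : ℝ => {w : ℝ | 0 ≤ v * (a + w)}.indicator
      (fun w => Complex.exp (-((v * om * w : ℝ) : ℂ))) w) ∧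
    ∫ w : ℝ, {w : ℝ | 0 ≤ v * (a + w)}.indicator
        (fun w => Complex.exp (-((v * om * w : ℝ) : ℂ))) w * Complex.exp (-(Complex.I * (w * x : ℝ)))
      = v * Complex.I⁻¹ * ((x - Complex.I * ((v * om : ℝ) : ℂ))⁻¹ *
        Complex.exp (Complex.I * ((x - Complex.I * ((v * om : ℝ) : ℂ)) * a))) := by
  set ξ : ℂ := x - Complex.I * ((v * om : ℝ) : ℂ) with hξ
  have hre : (-(Complex.I * ξ)).re = -(v * om) := by
    simp [hξ, Complex.mul_re, Complex.mul_im]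
  have hmul : ∀ w : ℝ, Complex.exp (-((v * om * w : ℝ) : ℂ)) *
      Complex.exp (-(Complex.I * (w * x : ℝ))) = Complex.exp (-(Complex.I * ξ) * w) := by
    intro w
    rw [← Complex.exp_add, hξ]
    congr 1
    push_cast
    linear_combination (-(v : ℂ) * om * w) * (Complex.I_sq)
  have h0 : ∀ w : ℝ, Complex.exp (-((v * om * w : ℝ) : ℂ)) =
      Complex.exp (((-(v * om) : ℝ) : ℂ) * w) := by
    intro w; congr 1; push_cast; ring
  have hprod : ∀ w : ℝ, {w : ℝ | 0 ≤ v * (a + w)}.indicator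
        (fun w => Complex.exp (-((v * om * w : ℝ) : ℂ))) w * Complex.exp (-(Complex.I * (w * x : ℝ)))
      = {w : ℝ | 0 ≤ v * (a + w)}.indicator (fun w : ℝ => Complex.exp (-(Complex.I * ξ) * w)) w := by
    intro w
    by_cases hw : w ∈ {w : ℝ | 0 ≤ v * (a + w)}
    · simp only [Set.indicator_of_mem hw]; exact hmul w
    · simp only [Set.indicator_of_notMem hw, zero_mul]
  simp_rw [hprod]
  have hms : MeasurableSet {w : ℝ | 0 ≤ v * (a + w)} :=
    measurableSet_le measurable_const (by fun_prop)
  rw [integral_indicator hms, integrable_indicator_iff hms]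
  simp_rw [h0]
  have hξ0 : Complex.I * ξ ≠ 0 := by
    intro h
    rw [h] at hre
    rcases hv with rfl | rfl <;> simp at hre <;> linarith
  have hξ0' : ξ ≠ 0 := right_ne_zero_of_mul hξ0
  rcases hv with rfl | rfl
  · have hs : {w : ℝ | 0 ≤ 1 * (a + w)} = Set.Ici (-a) := by
      ext w; simp only [Set.mem_ofPred_eq, Set.mem_Ici]; constructor <;> intro h <;> linarith
    rw [hs, integrableOn_Ici_iff_integrableOn_Ioi, integral_Ici_eq_integral_Ioi]
    refine ⟨integrableOn_exp_mul_complex_Ioi (by rw [Complex.ofReal_re]; linarith) _, ?_⟩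
    rw [integral_exp_mul_complex_Ioi (by rw [hre]; linarith)]
    have : -(Complex.I * ξ) * ((-a : ℝ) : ℂ) = Complex.I * (ξ * a) := by push_cast; ring
    rw [this]
    have := Complex.I_ne_zero
    push_cast
    field_simp
  · have hs : {w : ℝ | 0 ≤ -1 * (a + w)} = Set.Iic (-a) := by
      ext w; simp only [Set.mem_ofPred_eq, Set.mem_Iic]; constructor <;> intro h <;> linarith
    rw [hs]
    refine ⟨integrableOn_exp_mul_complex_Iic (by rw [Complex.ofReal_re]; linarith) _, ?_⟩
    rw [integral_exp_mul_complex_Iic (by rw [hre]; linarith)]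
    have : -(Complex.I * ξ) * ((-a : ℝ) : ℂ) = Complex.I * (ξ * a) := by push_cast; ring
    rw [this]
    have := Complex.I_ne_zero
    push_cast
    field_simp

lemma integral_comp_ofLp {j : ℕ} (g : (Fin j → ℝ) → ℂ) :
    ∫ w : EuclideanSpace ℝ (Fin j), g w.ofLp = ∫ x, g x :=
  (EuclideanSpace.volume_preserving_symm_measurableEquiv_toLp (Fin j)).integral_comp' g

/-- **Contour representation of an orthant expectation.** After damping by
`e^{∑ v_n ω_n Y_n}` the law of `Y` has an integrable characteristic function, hence a density, and
Fubini's theorem integrates the orthant first. -/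
theorem integral_orthant_eq_contour {Ω : Type*} [MeasurableSpace Ω] {Q : Measure Ω}
    {j : ℕ} {W : Ω → ℝ} {Y : Ω → Fin j → ℝ} {v a om : Fin j → ℝ}
    (hv : ∀ n, v n = 1 ∨ v n = -1) (hom : ∀ n, 0 < om n) (hW0 : ∀ ω, 0 ≤ W ω)
    (hW : Measurable W) (hY : Measurable Y)
    (hint : Integrable (fun ω => W ω * Real.exp (∑ n, v n * om n * Y ω n)) Q)
    (hG : Integrable (fun x : Fin j → ℝ => ∫ ω, (W ω : ℂ) *
      Complex.exp (Complex.I * ∑ n, (x n - Complex.I * ((v n * om n : ℝ) : ℂ)) * Y ω n) ∂Q)) :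
    ((∫ ω, {ω | ∀ n, 0 ≤ v n * (a n + Y ω n)}.indicator W ω ∂Q : ℝ) : ℂ) =
      (∏ n, (v n : ℂ)) / (2 * Real.pi * Complex.I) ^ j *
      ∫ x : Fin j → ℝ, ((∏ n, (x n - Complex.I * ((v n * om n : ℝ) : ℂ)))⁻¹ *
        Complex.exp (Complex.I * ∑ n, (x n - Complex.I * ((v n * om n : ℝ) : ℂ)) * a n)) *
        ∫ ω, (W ω : ℂ) *
          Complex.exp (Complex.I * ∑ n, (x n - Complex.I * ((v n * om n : ℝ) : ℂ)) * Y ω n) ∂Q := by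
  classical
  let f : Ω → ℝ := fun ω => W ω * Real.exp (∑ n, v n * om n * Y ω n)
  have hfm : Measurable f := by fun_prop
  have hf0 : ∀ ω, 0 ≤ f ω := fun ω => mul_nonneg (hW0 ω) (Real.exp_pos _).le
  let μ : Measure Ω := Q.withDensity fun ω => ENNReal.ofReal (f ω)
  have : IsFiniteMeasure μ := isFiniteMeasure_withDensity_ofReal hint.2
  let Z : Ω → EuclideanSpace ℝ (Fin j) := fun ω => WithLp.toLp 2 (Y ω)
  have hZ : Measurable Z := (PiLp.continuous_toLp 2 _).measurable.comp hY
  let ν : Measure (EuclideanSpace ℝ (Fin j)) := μ.map Z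
  have hintμ : ∀ g : Ω → ℂ, ∫ ω, g ω ∂μ = ∫ ω, (f ω : ℂ) * g ω ∂Q := by
    intro g
    rw [integral_withDensity_eq_integral_toReal_smul hfm.ennreal_ofReal
      (ae_of_all _ fun _ => ENNReal.ofReal_lt_top)]
    refine integral_congr_ae (ae_of_all _ fun ω => ?_)
    simp only
    rw [ENNReal.toReal_ofReal (hf0 ω), Complex.real_smul]
  let G : (Fin j → ℝ) → ℂ := fun x => ∫ ω, (W ω : ℂ) *
      Complex.exp (Complex.I * ∑ n, (x n - Complex.I * ((v n * om n : ℝ) : ℂ)) * Y ω n) ∂Q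
  have hchar : ∀ x : EuclideanSpace ℝ (Fin j), charFun ν x = G x.ofLp := by
    intro x
    rw [charFun_apply, integral_map hZ.aemeasurable
      (Continuous.aestronglyMeasurable (by fun_prop)), hintμ]
    refine integral_congr_ae (ae_of_all _ fun ω => ?_)
    simp only [f, Z]
    push_cast
    rw [mul_assoc, ← Complex.exp_add]
    congr 2
    simp only [PiLp.inner_apply, RCLike.inner_apply, conj_trivial]
    push_cast
    rw [Finset.sum_mul, ← Finset.sum_add_distrib, Finset.mul_sum]
    refine Finset.sum_congr rfl fun n _ => ?_
    linear_combination (v n * om n * Y ω n : ℂ) * Complex.I_sq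
  have hvp := PiLp.volume_preserving_ofLp (Fin j)
  have hcharI : Integrable (charFun ν) := by
    have : charFun ν = G ∘ WithLp.ofLp := funext hchar
    rw [this]
    exact hvp.integrable_comp_of_integrable hG
  let φ : Fin j → ℝ → ℂ := fun n w => {w : ℝ | 0 ≤ v n * (a n + w)}.indicator
      (fun w => Complex.exp (-((v n * om n * w : ℝ) : ℂ))) w
  have hφ := fun n x => integral_halfLine (hv n) (hom n) (a n) x
  let h : EuclideanSpace ℝ (Fin j) → ℂ := fun w => ∏ n, φ n (w n)
  have hh : Integrable h := by
    have h1 : Integrable (fun w : Fin j → ℝ => ∏ n, φ n (w n)) :=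
      Integrable.fintype_prod fun n => (hφ n 0).1
    exact hvp.integrable_comp_of_integrable h1
  have hmain := integral_eq_integral_mul_charFun hcharI hh
  have hlhs : ∫ w, h w ∂ν = ((∫ ω, {ω | ∀ n, 0 ≤ v n * (a n + Y ω n)}.indicator W ω ∂Q : ℝ) : ℂ) := by
    have hhm : Measurable h := by
      refine Finset.measurable_prod _ fun n _ => ?_
      have : Measurable (φ n) := Measurable.indicator (by fun_prop)
        (measurableSet_le measurable_const (by fun_prop))
      exact this.comp (by fun_prop)
    rw [integral_map hZ.aemeasurable hhm.aestronglyMeasurable, hintμ, ← integral_complex_ofReal]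
    refine integral_congr_ae (ae_of_all _ fun ω => ?_)
    simp only [h, f, Z]
    by_cases hω : ω ∈ {ω | ∀ n, 0 ≤ v n * (a n + Y ω n)}
    · rw [Set.indicator_of_mem hω]
      have : ∀ n, φ n (Y ω n) = Complex.exp (-((v n * om n * Y ω n : ℝ) : ℂ)) := fun n =>
        Set.indicator_of_mem (show Y ω n ∈ {w : ℝ | 0 ≤ v n * (a n + w)} from hω n) _
      simp_rw [this]
      rw [← Complex.exp_sum, Finset.sum_neg_distrib, Complex.exp_neg]
      push_cast
      rw [mul_assoc, mul_inv_cancel₀ (Complex.exp_ne_zero _), mul_one]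
    · rw [Set.indicator_of_notMem hω]
      simp only [Set.mem_ofPred_eq, not_forall] at hω
      obtain ⟨n, hn⟩ := hω
      rw [Finset.prod_eq_zero (Finset.mem_univ n)]
      · simp
      · exact Set.indicator_of_notMem (show Y ω n ∉ {w : ℝ | 0 ≤ v n * (a n + w)} from hn) _
  have hinner : ∀ x : EuclideanSpace ℝ (Fin j), (∫ w : EuclideanSpace ℝ (Fin j), h w * Complex.exp (-(Complex.I * (inner ℝ w x : ℝ)))) =
      ∏ n, ((v n : ℂ) * Complex.I⁻¹ * ((x n - Complex.I * ((v n * om n : ℝ) : ℂ))⁻¹ *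
        Complex.exp (Complex.I * ((x n - Complex.I * ((v n * om n : ℝ) : ℂ)) * a n)))) := by
    intro x
    have e : ∀ w : EuclideanSpace ℝ (Fin j), h w * Complex.exp (-(Complex.I * (inner ℝ w x : ℝ))) =
        (fun w : Fin j → ℝ => ∏ n, (φ n (w n) * Complex.exp (-(Complex.I * (w n * x n : ℝ)))))
          (WithLp.ofLp w) := by
      intro w
      simp only [h]
      rw [Finset.prod_mul_distrib, ← Complex.exp_sum]
      congr 2
      simp only [PiLp.inner_apply, RCLike.inner_apply, conj_trivial]
      push_cast
      rw [Finset.mul_sum, ← Finset.sum_neg_distrib]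
      refine Finset.sum_congr rfl fun n _ => by ring
    simp_rw [e]
    rw [integral_comp_ofLp
      (fun w : Fin j → ℝ => ∏ n, (φ n (w n) * Complex.exp (-(Complex.I * (w n * x n : ℝ)))))]
    rw [volume_pi, integral_fintype_prod_eq_prod
      (fun n (w : ℝ) => φ n w * Complex.exp (-(Complex.I * (w * x n : ℝ))))]
    exact Finset.prod_congr rfl fun n _ => (hφ n (x n)).2
  rw [← hlhs, hmain]
  simp_rw [hinner, hchar]
  rw [integral_comp_ofLp
    (fun x : Fin j → ℝ => (∏ n, ((v n : ℂ) * Complex.I⁻¹ *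
      ((x n - Complex.I * ((v n * om n : ℝ) : ℂ))⁻¹ *
        Complex.exp (Complex.I * ((x n - Complex.I * ((v n * om n : ℝ) : ℂ)) * a n))))) * G x)]
  rw [finrank_euclideanSpace, Fintype.card_fin, ← integral_const_mul, ← integral_const_mul]
  refine integral_congr_ae (ae_of_all _ fun x => ?_)
  simp only [G]
  rw [Finset.prod_mul_distrib, Finset.prod_mul_distrib, Finset.prod_mul_distrib,
    Finset.prod_const, Finset.card_univ, Fintype.card_fin, ← Complex.exp_sum, ← Finset.mul_sum,
    Finset.prod_inv_distrib, mul_pow]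
  push_cast
  rw [inv_pow, div_eq_mul_inv, mul_inv]
  ring

end Contour

/-! ### Consequences of regularity of the characteristic exponent -/

section Exponent

variable {ψ : ℂ → ℂ} {υ lm lp : ℝ}

lemma IsRLPEExponent.continuousOn (h : IsRLPEExponent ψ υ lm lp) :
    ContinuousOn ψ {ξ : ℂ | ξ.im ∈ Set.Icc lm lp} := by
  obtain ⟨μ, φ, h1, -, h3, -⟩ := h
  exact ((Continuous.continuousOn (by fun_prop)).add h3).congr fun ξ hξ => h1 ξ hξ

lemma IsRLPEExponent.differentiableOn (h : IsRLPEExponent ψ υ lm lp) :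
    DifferentiableOn ℂ ψ {ξ : ℂ | ξ.im ∈ Set.Ioo lm lp} := by
  obtain ⟨μ, φ, h1, h2, -⟩ := h
  have : DifferentiableOn ℂ (fun ξ => -(Complex.I * (μ : ℂ) * ξ) + φ ξ)
      {ξ : ℂ | ξ.im ∈ Set.Ioo lm lp} := by
    refine DifferentiableOn.add (Differentiable.differentiableOn ?_) h2
    fun_prop
  exact this.congr fun ξ hξ => h1 ξ (Set.Ioo_subset_Icc_self hξ)

/-- The real part of a regular exponent grows like `|Re ξ| ^ υ`, uniformly in the closed strip. -/
lemma IsRLPEExponent.exists_re_ge (h : IsRLPEExponent ψ υ lm lp) (hυ : 0 < υ) :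
    ∃ c D : ℝ, 0 < c ∧ ∀ ξ : ℂ, ξ.im ∈ Set.Icc lm lp → c * |ξ.re| ^ υ - D ≤ (ψ ξ).re := by
  obtain ⟨μ, φ, h1, -, h3, ⟨C, υ₁, hC, hυ₁, hO⟩, -⟩ := h
  obtain ⟨A, hA⟩ := hO.bound
  have hlit : ∀ᶠ r : ℝ in atTop, A * r ^ υ₁ ≤ C / 2 * r ^ υ := by
    have := (tendsto_rpow_neg_atTop (sub_pos.2 hυ₁)).const_mul A
    rw [mul_zero] at this
    filter_upwards [this.eventually_le_const (half_pos hC), eventually_gt_atTop 0] with r hr h0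
    calc A * r ^ υ₁ = A * r ^ (-(υ - υ₁)) * r ^ υ := by
          rw [mul_assoc, ← Real.rpow_add h0]; congr 2; ring
      _ ≤ _ := by gcongr
  obtain ⟨R₁, hR₁⟩ := eventually_atTop.1 hlit
  rw [eventually_inf_principal] at hA
  obtain ⟨R₂, -, hR₂⟩ := (Filter.hasBasis_cobounded_norm (E := ℂ)).mem_iff.1 hA
  set R := max (max R₁ R₂) 1
  have hcomp : IsCompact (Metric.closedBall (0 : ℂ) R ∩ {ξ : ℂ | ξ.im ∈ Set.Icc lm lp}) :=
    (isCompact_closedBall _ _).inter_right (isClosed_Icc.preimage Complex.continuous_im)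
  obtain ⟨B, hB⟩ := hcomp.exists_bound_of_continuousOn (h3.mono Set.inter_subset_right)
  refine ⟨C / 2, |μ| * max |lm| |lp| + |B| + C / 2 * R ^ υ, half_pos hC, fun ξ hξ => ?_⟩
  have him : |ξ.im| ≤ max |lm| |lp| := abs_le_max_abs_abs hξ.1 hξ.2
  have hre : (ψ ξ).re = μ * ξ.im + (φ ξ).re := by
    rw [h1 ξ hξ]; simp [Complex.mul_re, Complex.mul_im]
  have hμ : -(|μ| * max |lm| |lp|) ≤ μ * ξ.im := by
    have : |μ * ξ.im| ≤ |μ| * max |lm| |lp| := by rw [abs_mul]; gcongr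
    linarith [neg_abs_le (μ * ξ.im)]
  have hle : |ξ.re| ^ υ ≤ ‖ξ‖ ^ υ :=
    Real.rpow_le_rpow (abs_nonneg _) (Complex.abs_re_le_norm ξ) hυ.le
  have hRυ : 0 ≤ C / 2 * R ^ υ := by positivity
  rw [hre]
  by_cases hn : ‖ξ‖ ≤ R
  · have hb := hB ξ ⟨by simpa using hn, hξ⟩
    have h5 : ‖ξ‖ ^ υ ≤ R ^ υ := Real.rpow_le_rpow (norm_nonneg _) hn hυ.le
    have h6 : C / 2 * |ξ.re| ^ υ ≤ C / 2 * R ^ υ :=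
      mul_le_mul_of_nonneg_left (hle.trans h5) (half_pos hC).le
    have h7 := Complex.abs_re_le_norm (φ ξ)
    have h8 := neg_abs_le (φ ξ).re
    have h9 := le_abs_self B
    linarith
  · push Not at hn
    have hm : R₂ ≤ ‖ξ‖ := (le_max_right R₁ R₂).trans ((le_max_left _ _).trans hn.le)
    have hm1 : R₁ ≤ ‖ξ‖ := (le_max_left R₁ R₂).trans ((le_max_left _ _).trans hn.le)
    have h4 : ‖φ ξ - ((C * ‖ξ‖ ^ υ : ℝ) : ℂ)‖ ≤ A * ‖‖ξ‖ ^ υ₁‖ := hR₂ hm hξ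
    rw [Real.norm_of_nonneg (by positivity)] at h4
    have h5 := hR₁ _ hm1
    have h6 := (Complex.abs_re_le_norm _).trans (h4.trans h5)
    rw [Complex.sub_re, Complex.ofReal_re] at h6
    have h7 := neg_abs_le ((φ ξ).re - C * ‖ξ‖ ^ υ)
    have h8 : C / 2 * |ξ.re| ^ υ ≤ C / 2 * ‖ξ‖ ^ υ := by gcongr
    have h9 := abs_nonneg B
    linarith

lemma integrable_exp_neg_mul_abs_rpow {k p : ℝ} (hk : 0 < k) (hp : 0 < p) :
    Integrable fun u : ℝ => Real.exp (-(k * |u| ^ p)) := by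
  have h := integrableOn_rpow_mul_exp_neg_mul_rpow (s := 0) (by norm_num) hp hk
  rw [← integrable_indicator_iff measurableSet_Ioi] at h
  refine (h.add h.comp_neg).congr ?_
  have hne : ∀ᵐ u : ℝ, u ≠ 0 := by simp [ae_iff]
  filter_upwards [hne] with u hu
  rcases lt_or_gt_of_ne hu with h0 | h0
  · have h1 : u ∉ Set.Ioi (0 : ℝ) := by simp [h0.le]
    have h2 : -u ∈ Set.Ioi (0 : ℝ) := by simp [h0]
    simp [Set.indicator_of_notMem h1, Set.indicator_of_mem h2, abs_of_neg h0]
  · have h1 : u ∈ Set.Ioi (0 : ℝ) := h0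
    have h2 : -u ∉ Set.Ioi (0 : ℝ) := by simp [h0.le]
    simp [Set.indicator_of_notMem h2, Set.indicator_of_mem h1, abs_of_pos h0]

lemma tendsto_exp_neg_mul_abs_rpow {k p : ℝ} (hk : 0 < k) (hp : 0 < p) :
    Tendsto (fun u : ℝ => Real.exp (-(k * |u| ^ p))) atTop (𝓝 0) := by
  refine Real.tendsto_exp_neg_atTop_nhds_zero.comp (Tendsto.const_mul_atTop hk ?_)
  exact (tendsto_rpow_atTop hp).comp tendsto_abs_atTop_atTop

lemma IsRLPEExponent.exists_norm_exp_le (h : IsRLPEExponent ψ υ lm lp) (hυ : 0 < υ) {t : ℝ}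
    (ht : 0 < t) : ∃ M k : ℝ, 0 < k ∧ 0 ≤ M ∧ ∀ ξ : ℂ, ξ.im ∈ Set.Icc lm lp →
      ‖Complex.exp (-(t * ψ ξ))‖ ≤ M * Real.exp (-(k * |ξ.re| ^ υ)) := by
  obtain ⟨c, D, hc, hcD⟩ := h.exists_re_ge hυ
  refine ⟨Real.exp (t * D), t * c, by positivity, (Real.exp_pos _).le, fun ξ hξ => ?_⟩
  rw [Complex.norm_exp, ← Real.exp_add, Real.exp_le_exp]
  have := hcD ξ hξ
  rw [Complex.neg_re, Complex.re_ofReal_mul]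
  nlinarith

lemma IsRLPEExponent.continuous_exp_line (h : IsRLPEExponent ψ υ lm lp) (t : ℝ) {a : ℝ}
    (ha : a ∈ Set.Icc lm lp) :
    Continuous fun u : ℝ => Complex.exp (-(t * ψ (u + a * Complex.I))) := by
  have : Continuous fun u : ℝ => ψ (u + a * Complex.I) := by
    refine h.continuousOn.comp_continuous (by fun_prop) fun u => ?_
    simpa using ha
  exact Complex.continuous_exp.comp (continuous_const.mul this).neg

lemma IsRLPEExponent.integrable_exp_line (h : IsRLPEExponent ψ υ lm lp) (hυ : 0 < υ) {t : ℝ}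
    (ht : 0 < t) {a : ℝ} (ha : a ∈ Set.Icc lm lp) :
    Integrable fun u : ℝ => Complex.exp (-(t * ψ (u + a * Complex.I))) := by
  obtain ⟨M, k, hk, -, hM⟩ := h.exists_norm_exp_le hυ ht
  refine ((integrable_exp_neg_mul_abs_rpow hk hυ).const_mul M).mono'
    (h.continuous_exp_line t ha).aestronglyMeasurable (ae_of_all _ fun u => ?_)
  simpa using hM (u + a * Complex.I) (by simpa using ha)

/-- Cauchy's theorem for a strip: the contour of an integral along the real line may be moved to
`Im = a` if the integrand tends to `0` at both ends of the strip. -/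
lemma integral_line_shift {F : ℂ → ℂ} {a : ℝ} {B : ℝ → ℝ}
    (hd : DifferentiableOn ℂ F {ξ : ℂ | ξ.im ∈ Set.uIcc 0 a}) (hB : Tendsto B atTop (𝓝 0))
    (hF : ∀ ξ : ℂ, ξ.im ∈ Set.uIcc 0 a → ‖F ξ‖ ≤ B |ξ.re|)
    (h0 : Integrable fun u : ℝ => F u) (ha : Integrable fun u : ℝ => F (u + a * Complex.I)) :
    ∫ u : ℝ, F u = ∫ u : ℝ, F (u + a * Complex.I) := by
  have hrect : ∀ R : ℝ, (∫ x in -R..R, F x) - (∫ x in -R..R, F (x + a * Complex.I)) =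
      Complex.I • (∫ y in (0 : ℝ)..a, F ((-R : ℝ) + y * Complex.I)) -
        Complex.I • ∫ y in (0 : ℝ)..a, F (R + y * Complex.I) := by
    intro R
    have := Complex.integral_boundary_rect_eq_zero_of_differentiableOn F ((-R : ℝ) : ℂ)
      (R + a * Complex.I) (hd.mono fun ξ hξ => by simpa using hξ.2)
    simp only [Complex.ofReal_re, Complex.ofReal_im, Complex.add_re, Complex.add_im,
      Complex.mul_re, Complex.mul_im, Complex.I_re, Complex.I_im, mul_zero, mul_one, sub_zero,
      add_zero, zero_add, Complex.ofReal_zero, zero_mul] at this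
    linear_combination this
  have hv : ∀ s : ℝ → ℝ, (∀ R, |s R| = |R|) →
      Tendsto (fun R : ℝ => Complex.I • ∫ y in (0 : ℝ)..a, F (s R + y * Complex.I))
      atTop (𝓝 0) := by
    intro s hs
    refine squeeze_zero_norm' (a := fun R => B |R| * |a - 0|) ?_ ?_
    · refine Eventually.of_forall fun R => ?_
      rw [norm_smul, Complex.norm_I, one_mul]
      refine intervalIntegral.norm_integral_le_of_norm_le_const fun y hy => ?_
      have := hF (s R + y * Complex.I) (by simpa using Set.uIoc_subset_uIcc hy)
      simpa [hs] using this
    · have := (hB.comp tendsto_abs_atTop_atTop).mul_const |a - 0|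
      simpa using this
  have hl := (intervalIntegral_tendsto_integral h0 tendsto_neg_atTop_atBot tendsto_id).sub
    (intervalIntegral_tendsto_integral ha tendsto_neg_atTop_atBot tendsto_id)
  have hr := (hv (fun R => -R) (by simp)).sub (hv (fun R => R) (by simp))
  simp only [id] at hl
  simp_rw [hrect] at hl
  have := tendsto_nhds_unique hl hr
  rw [sub_zero] at this
  exact sub_eq_zero.1 this

set_option linter.unusedSectionVars false

variable {μ : Measure ℝ} [IsProbabilityMeasure μ] {t : ℝ}

lemma integrable_charFun_of_exponent (h : IsRLPEExponent ψ υ lm lp) (hυ : 0 < υ) (hlm : lm < 0)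
    (hlp : 0 < lp) (ht : 0 < t) (hμ : ∀ ξ : ℝ, charFun μ ξ = Complex.exp (-(t * ψ ξ))) :
    Integrable (charFun μ) := by
  have := h.integrable_exp_line hυ ht (a := 0) ⟨hlm.le, hlp.le⟩
  refine this.congr (ae_of_all _ fun u => ?_)
  simp [hμ]

lemma invCharFun_real (μ : Measure ℝ) (w : ℝ) :
    invCharFun μ w = ((2 * Real.pi)⁻¹ : ℝ) *
      ∫ u : ℝ, Complex.exp (-(Complex.I * u * w)) * charFun μ u := by
  have h3 := Measure.integral_comp_smul (volume : Measure ℝ)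
    (fun u : ℝ => Complex.exp (-(Complex.I * u * w)) * charFun μ u) (-(2 * Real.pi))
  rw [Module.finrank_self, pow_one, abs_inv, abs_neg, abs_of_pos Real.two_pi_pos,
    Complex.real_smul] at h3
  rw [← h3, invCharFun]
  congr 1; funext x
  congr 2
  simp only [smul_eq_mul, RCLike.inner_apply, conj_trivial]
  push_cast; ring

/-- Moving the contour of the inversion integral bounds the density by `e^{aw}` for every `a` in
the strip of analyticity of the exponent. -/
lemma exists_invCharFun_le (h : IsRLPEExponent ψ υ lm lp) (hυ : 0 < υ) (hlm : lm < 0)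
    (hlp : 0 < lp) (ht : 0 < t) (hμ : ∀ ξ : ℝ, charFun μ ξ = Complex.exp (-(t * ψ ξ)))
    {a : ℝ} (ha : a ∈ Set.Ioo lm lp) :
    ∃ M : ℝ, ∀ w : ℝ, (invCharFun μ w).re ≤ M * Real.exp (a * w) := by
  obtain ⟨M, k, hk, hM0, hM⟩ := h.exists_norm_exp_le hυ ht
  have hsub : Set.uIcc 0 a ⊆ Set.Ioo lm lp :=
    Set.OrdConnected.uIcc_subset Set.ordConnected_Ioo ⟨hlm, hlp⟩ ha
  refine ⟨(2 * Real.pi)⁻¹ * ∫ u : ℝ, ‖Complex.exp (-(t * ψ (u + a * Complex.I)))‖, fun w => ?_⟩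
  set F : ℂ → ℂ := fun ξ => Complex.exp (-(Complex.I * ξ * w)) * Complex.exp (-(t * ψ ξ)) with hF
  have hnorm : ∀ ξ : ℂ, ‖Complex.exp (-(Complex.I * ξ * w))‖ = Real.exp (ξ.im * w) := by
    intro ξ
    rw [Complex.norm_exp]; congr 1
    simp [Complex.mul_re, Complex.mul_im]
  have hshift : ∫ u : ℝ, F u = ∫ u : ℝ, F (u + a * Complex.I) := by
    refine integral_line_shift
      (B := fun r => Real.exp (|a| * |w|) * (M * Real.exp (-(k * |r| ^ υ)))) ?_ ?_ ?_ ?_ ?_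
    · have := h.differentiableOn.mono fun ξ (hξ : ξ ∈ {ξ : ℂ | ξ.im ∈ Set.uIcc 0 a}) => hsub hξ
      fun_prop
    · simpa using ((tendsto_exp_neg_mul_abs_rpow hk hυ).const_mul M).const_mul
        (Real.exp (|a| * |w|))
    · intro ξ hξ
      rw [hF, norm_mul, hnorm, abs_abs]
      refine mul_le_mul (Real.exp_le_exp.2 ?_) (hM ξ (Set.Ioo_subset_Icc_self (hsub hξ)))
        (norm_nonneg _) (Real.exp_pos _).le
      refine (le_abs_self _).trans ?_
      rw [abs_mul]
      have := Set.abs_sub_left_of_mem_uIcc hξ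
      exact mul_le_mul_of_nonneg_right (by simpa using this) (abs_nonneg w)
    · have := h.integrable_exp_line hυ ht (a := 0) ⟨hlm.le, hlp.le⟩
      refine this.bdd_mul (c := 1) (Continuous.aestronglyMeasurable (by fun_prop)) ?_ |>.congr
        (ae_of_all _ fun u => ?_) (f := fun u : ℝ => Complex.exp (-(Complex.I * u * w)) * _)
      · refine ae_of_all _ fun u => ?_
        rw [hnorm]; simp
      · simp [hF]
    · have := h.integrable_exp_line hυ ht (a := a) (Set.Ioo_subset_Icc_self ha)
      refine this.bdd_mul (c := Real.exp (a * w)) (f := fun u : ℝ =>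
        Complex.exp (-(Complex.I * (u + a * Complex.I) * w)))
        (Continuous.aestronglyMeasurable (by fun_prop)) ?_
      refine ae_of_all _ fun u => ?_
      rw [hnorm]; simp
  have e : invCharFun μ w = ((2 * Real.pi)⁻¹ : ℝ) * ∫ u : ℝ, F (u + a * Complex.I) := by
    rw [invCharFun_real, ← hshift]
    simp only [hF, hμ]
  refine (Complex.re_le_norm _).trans ?_
  rw [e, norm_mul, Complex.norm_real, Real.norm_of_nonneg (by positivity), mul_assoc]
  gcongr
  refine (norm_integral_le_integral_norm _).trans_eq ?_
  rw [← integral_mul_const]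
  congr 1; funext u
  rw [hF, norm_mul, hnorm]
  simp [mul_comm]

/-- A law whose characteristic exponent is regular in a strip has the exponential moments that
the strip suggests. -/
theorem integrable_exp_mul_of_exponent (h : IsRLPEExponent ψ υ lm lp) (hυ : 0 < υ)
    (hlm : lm < 0) (hlp : 0 < lp) (ht : 0 < t)
    (hμ : ∀ ξ : ℝ, charFun μ ξ = Complex.exp (-(t * ψ ξ))) {θ : ℝ}
    (hθ : θ ∈ Set.Ioo (-lp) (-lm)) : Integrable (fun x => Real.exp (θ * x)) μ := by
  have hI := integrable_charFun_of_exponent h hυ hlm hlp ht hμ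
  have hcont : Continuous fun w => (invCharFun μ w).re :=
    Complex.continuous_re.comp (continuous_invCharFun hI)
  obtain ⟨a₁, h1l, h1u⟩ := exists_between (show lm < -θ by linarith [hθ.2])
  obtain ⟨a₂, h2l, h2u⟩ := exists_between (show -θ < lp by linarith [hθ.1])
  obtain ⟨M₁, hM₁⟩ := exists_invCharFun_le h hυ hlm hlp ht hμ (a := a₁) ⟨h1l, by linarith⟩
  obtain ⟨M₂, hM₂⟩ := exists_invCharFun_le h hυ hlm hlp ht hμ (a := a₂) ⟨by linarith, h2u⟩
  rw [eq_withDensity_invCharFun hI, integrable_withDensity_iff_integrable_smul'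
    hcont.measurable.ennreal_ofReal (ae_of_all _ fun _ => ENNReal.ofReal_lt_top)]
  simp_rw [ENNReal.toReal_ofReal (invCharFun_eq_ofReal hI _).1, smul_eq_mul]
  have hc : Continuous fun w => (invCharFun μ w).re * Real.exp (θ * w) := by fun_prop
  have key : ∀ (a M w : ℝ), (invCharFun μ w).re ≤ M * Real.exp (a * w) →
      ‖(invCharFun μ w).re * Real.exp (θ * w)‖ ≤ M * Real.exp ((a + θ) * w) := by
    intro a M w hw
    rw [Real.norm_of_nonneg (mul_nonneg (invCharFun_eq_ofReal hI _).1 (Real.exp_pos _).le),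
      add_mul, Real.exp_add, ← mul_assoc]
    gcongr
  rw [← integrableOn_univ, ← Set.Iic_union_Ioi (a := (0 : ℝ))]
  refine IntegrableOn.union ?_ ?_
  · exact ((integrableOn_exp_mul_Iic (show 0 < a₂ + θ by linarith) 0).const_mul M₂).mono'
      hc.aestronglyMeasurable (ae_of_all _ fun w => key a₂ M₂ w (hM₂ w))
  · exact ((integrableOn_exp_mul_Ioi (show a₁ + θ < 0 by linarith) 0).const_mul M₁).mono'
      hc.aestronglyMeasurable (ae_of_all _ fun w => key a₁ M₁ w (hM₁ w))

/-- The formula for the characteristic function persists in the open strip. -/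
theorem integral_exp_of_exponent (h : IsRLPEExponent ψ υ lm lp) (hυ : 0 < υ)
    (hlm : lm < 0) (hlp : 0 < lp) (ht : 0 < t)
    (hμ : ∀ ξ : ℝ, charFun μ ξ = Complex.exp (-(t * ψ ξ))) {ξ : ℂ}
    (hξ : ξ.im ∈ Set.Ioo lm lp) :
    ∫ x, Complex.exp (Complex.I * ξ * x) ∂μ = Complex.exp (-(t * ψ ξ)) := by
  set U : Set ℂ := {ξ : ℂ | ξ.im ∈ Set.Ioo lm lp} with hU
  have hUo : IsOpen U := isOpen_Ioo.preimage Complex.continuous_im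
  have hUc : Convex ℝ U := (convex_Ioo lm lp).linear_preimage Complex.imLm
  have hint : Set.Ioo (-lp) (-lm) ⊆ integrableExpSet id μ := fun θ hθ =>
    integrable_exp_mul_of_exponent h hυ hlm hlp ht hμ hθ
  have hf : AnalyticOnNhd ℂ (fun ξ => complexMGF id μ (Complex.I * ξ)) U := by
    have hd : DifferentiableOn ℂ (complexMGF id μ)
      {z | z.re ∈ interior (integrableExpSet id μ)} := differentiableOn_complexMGF
    refine DifferentiableOn.analyticOnNhd (hd.comp (by fun_prop) fun z hz => ?_) hUo
    refine interior_maximal hint isOpen_Ioo ?_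
    simp only [Complex.mul_re, Complex.I_re, zero_mul, Complex.I_im, one_mul, zero_sub]
    exact ⟨by linarith [hz.2], by linarith [hz.1]⟩
  have hg : AnalyticOnNhd ℂ (fun ξ => Complex.exp (-(t * ψ ξ))) U := by
    have := h.differentiableOn
    exact DifferentiableOn.analyticOnNhd (by fun_prop) hUo
  have h0 : (0 : ℂ) ∈ U := by simp [hU, hlm, hlp]
  have heq := hf.eqOn_of_preconnected_of_frequently_eq hg hUc.isPreconnected h0 ?_
  · have := heq hξ
    simpa [complexMGF, mul_assoc] using this
  · have hreal : ∀ x : ℝ, complexMGF id μ (Complex.I * x) = Complex.exp (-(t * ψ x)) := by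
      intro x
      rw [mul_comm, complexMGF_id_mul_I, hμ]
    have ht : Tendsto (fun x : ℝ => (x : ℂ)) (𝓝[≠] 0) (𝓝[≠] 0) := by
      refine tendsto_nhdsWithin_iff.2 ⟨?_, ?_⟩
      · exact (Complex.continuous_ofReal.tendsto' 0 0 (by simp)).mono_left nhdsWithin_le_nhds
      · filter_upwards [self_mem_nhdsWithin] with x hx
        simpa using hx
    exact ht.frequently (Eventually.frequently (Eventually.of_forall hreal))

/-- A law with an integrable characteristic function has no atoms. -/
lemma measure_singleton_of_exponent (h : IsRLPEExponent ψ υ lm lp) (hυ : 0 < υ)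
    (hlm : lm < 0) (hlp : 0 < lp) (ht : 0 < t)
    (hμ : ∀ ξ : ℝ, charFun μ ξ = Complex.exp (-(t * ψ ξ))) (x : ℝ) :
    μ {x} = 0 := by
  rw [eq_withDensity_invCharFun (integrable_charFun_of_exponent h hυ hlm hlp ht hμ)]
  exact withDensity_absolutelyContinuous _ _ (by simp)

end Exponent

/-! ### Unbounded support of the increments -/

section Support

lemma norm_one_sub_exp_neg_le {z : ℂ} (hz : 0 ≤ z.re) : ‖1 - Complex.exp (-z)‖ ≤ ‖z‖ := by
  have hs : Convex ℝ {z : ℂ | 0 ≤ z.re} := (convex_Ici 0).linear_preimage Complex.reLm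
  have h := hs.norm_image_sub_le_of_norm_hasDerivWithin_le (𝕜 := ℂ)
    (f := fun z => Complex.exp (-z)) (f' := fun z => -Complex.exp (-z)) (C := 1)
    (x := z) (y := 0) (fun x _ => ?_) (fun x hx => ?_) hz (by simp)
  · simpa using h
  · have := ((hasDerivAt_neg x).cexp).hasDerivWithinAt (s := {z : ℂ | 0 ≤ z.re})
    simpa using this
  · rw [norm_neg, Complex.norm_exp, Real.exp_le_one_iff]
    simpa using hx

lemma tendsto_nat_mul_one_sub_exp (z : ℂ) :
    Tendsto (fun n : ℕ => ((n : ℂ) + 1) * (1 - Complex.exp (-(z / (n + 1))))) atTop (𝓝 z) := by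
  rw [tendsto_iff_norm_sub_tendsto_zero]
  have h0 : Tendsto (fun n : ℕ => ‖z‖ ^ 2 * (1 / ((n : ℝ) + 1))) atTop (𝓝 0) := by
    simpa using tendsto_one_div_add_atTop_nhds_zero_nat.const_mul (‖z‖ ^ 2)
  have h1 : Tendsto (fun n : ℕ => ‖z‖ * (1 / ((n : ℝ) + 1))) atTop (𝓝 0) := by
    simpa using tendsto_one_div_add_atTop_nhds_zero_nat.const_mul ‖z‖
  refine squeeze_zero' (Eventually.of_forall fun _ => norm_nonneg _) ?_ h0
  filter_upwards [h1.eventually_le_const one_pos] with n hn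
  have hpos : (0 : ℝ) < n + 1 := by positivity
  have hne : (n : ℂ) + 1 ≠ 0 := by exact_mod_cast hpos.ne'
  have hnn : ‖(n : ℂ) + 1‖ = n + 1 := by
    rw [show (n : ℂ) + 1 = ((n + 1 : ℝ) : ℂ) by push_cast; ring, Complex.norm_real,
      Real.norm_of_nonneg hpos.le]
  have hle : ‖-(z / (n + 1))‖ ≤ 1 := by
    rw [norm_neg, norm_div, hnn, div_eq_mul_one_div]; exact hn
  have := Complex.norm_exp_sub_one_sub_id_le hle
  have e : ((n : ℂ) + 1) * (1 - Complex.exp (-(z / (n + 1)))) - z =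
      -((n : ℂ) + 1) * (Complex.exp (-(z / (n + 1))) - 1 - -(z / (n + 1))) := by
    field_simp; ring
  rw [e, norm_mul, norm_neg, hnn]
  calc ((n : ℝ) + 1) * _ ≤ (n + 1) * ‖-(z / (n + 1))‖ ^ 2 := by gcongr
    _ = ‖z‖ ^ 2 * (1 / (n + 1)) := by
      rw [norm_neg, norm_div, hnn]; field_simp

/-- `1/ε - 1/(ε - iy) = ∫_0^∞ e^{-εξ} (1 - e^{iξy}) dξ`. -/
def cauchyKernel (ε y : ℝ) : ℂ := (ε : ℂ)⁻¹ - ((ε : ℂ) - Complex.I * y)⁻¹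

lemma integral_exp_mul_one_sub_exp {ε : ℝ} (hε : 0 < ε) (y : ℝ) :
    ∫ ξ in Set.Ioi (0 : ℝ), Complex.exp (-(ε * ξ : ℝ)) * (1 - Complex.exp (Complex.I * ξ * y)) =
      cauchyKernel ε y := by
  have e : ∀ ξ : ℝ, Complex.exp (-(ε * ξ : ℝ)) * (1 - Complex.exp (Complex.I * ξ * y)) =
      Complex.exp (-(ε : ℂ) * ξ) - Complex.exp ((-(ε : ℂ) + Complex.I * y) * ξ) := by
    intro ξ
    rw [mul_sub, mul_one, ← Complex.exp_add]
    congr 2 <;> push_cast <;> ring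
  have h1 : (-(ε : ℂ)).re < 0 := by simpa using hε
  have h2 : (-(ε : ℂ) + Complex.I * y).re < 0 := by simpa using hε
  simp_rw [e]
  rw [integral_sub (integrableOn_exp_mul_complex_Ioi h1 0) (integrableOn_exp_mul_complex_Ioi h2 0),
    integral_exp_mul_complex_Ioi h1, integral_exp_mul_complex_Ioi h2, cauchyKernel]
  simp only [Complex.ofReal_zero, mul_zero, Complex.exp_zero]
  rw [show -(ε : ℂ) + Complex.I * y = -((ε : ℂ) - Complex.I * y) by ring, neg_div_neg_eq,
    neg_div_neg_eq, one_div, one_div]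

lemma cauchyKernel_re {ε : ℝ} (hε : 0 < ε) (y : ℝ) :
    ε * (cauchyKernel ε y).re = y ^ 2 / (ε ^ 2 + y ^ 2) := by
  have : 0 < ε ^ 2 + y ^ 2 := by positivity
  have h : (cauchyKernel ε y).re = ε⁻¹ - ε / (ε * ε + y * y) := by
    simp [cauchyKernel, Complex.inv_re, Complex.normSq_apply]
  rw [h]
  have : ε * ε + y * y ≠ 0 := by nlinarith
  field_simp
  ring

lemma cauchyKernel_im (ε y : ℝ) :
    -(cauchyKernel ε y).im = y / (ε ^ 2 + y ^ 2) := by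
  simp [cauchyKernel, Complex.inv_im, Complex.normSq_apply]
  ring_nf

variable {ρ : ℕ → Measure ℝ} [∀ n, IsProbabilityMeasure (ρ n)] {a : ℝ → ℂ}

lemma integrable_cauchyKernel {ε : ℝ} (hε : 0 < ε) (μ : Measure ℝ) [IsFiniteMeasure μ] :
    Integrable (cauchyKernel ε) μ := by
  have hne : ∀ y : ℝ, (ε : ℂ) - Complex.I * y ≠ 0 := by
    intro y h
    have := congrArg Complex.re h
    simp at this; exact hε.ne' this
  have hc : Continuous (cauchyKernel ε) := by
    unfold cauchyKernel
    exact continuous_const.sub (Continuous.inv₀ (by fun_prop) hne)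
  refine Integrable.of_bound hc.aestronglyMeasurable (ε⁻¹ + ε⁻¹) (ae_of_all _ fun y => ?_)
  refine (norm_sub_le _ _).trans ?_
  rw [norm_inv, norm_inv, Complex.norm_real, Real.norm_of_nonneg hε.le]
  gcongr
  have := Complex.abs_re_le_norm ((ε : ℂ) - Complex.I * y)
  simp only [Complex.sub_re, Complex.ofReal_re, Complex.mul_re, Complex.I_re, zero_mul,
    Complex.I_im, Complex.ofReal_im, mul_zero, sub_zero] at this
  exact (le_abs_self ε).trans this

lemma integral_cauchyKernel {ε : ℝ} (hε : 0 < ε) (μ : Measure ℝ) [IsProbabilityMeasure μ] :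
    ∫ y, cauchyKernel ε y ∂μ =
      ∫ ξ in Set.Ioi (0 : ℝ), Complex.exp (-(ε * ξ : ℝ)) * (1 - charFun μ ξ) := by
  simp_rw [← integral_exp_mul_one_sub_exp hε]
  rw [integral_integral_swap]
  · refine integral_congr_ae (ae_of_all _ fun ξ => ?_)
    simp only
    rw [integral_const_mul, integral_sub (integrable_const _), charFun_apply_real]
    · simp [mul_comm, mul_left_comm]
    · refine Integrable.of_bound (Continuous.aestronglyMeasurable (by fun_prop)) 1
        (ae_of_all _ fun y => ?_)
      rw [show Complex.I * ξ * y = ((ξ * y : ℝ) : ℂ) * Complex.I by push_cast; ring,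
        Complex.norm_exp_ofReal_mul_I]
  · have h1 : Integrable (fun z : ℝ × ℝ => (2 : ℝ) * Real.exp (-ε * z.2))
        (μ.prod (volume.restrict (Set.Ioi 0))) :=
      (integrable_const (μ := μ) (2 : ℝ)).mul_prod
        (integrableOn_exp_mul_Ioi (neg_lt_zero.2 hε) 0)
    refine h1.mono' (Continuous.aestronglyMeasurable (by unfold Function.uncurry; fun_prop))
      (ae_of_all _ fun z => ?_)
    simp only [Function.uncurry]
    rw [norm_mul, mul_comm]
    refine mul_le_mul ?_ ?_ (norm_nonneg _) (by norm_num)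
    · refine (norm_sub_le _ _).trans ?_
      rw [show Complex.I * z.2 * z.1 = ((z.2 * z.1 : ℝ) : ℂ) * Complex.I by push_cast; ring,
        Complex.norm_exp_ofReal_mul_I]
      norm_num
    · rw [Complex.norm_exp]; simp

/-- The Laplace transform of the exponent is a limit of integrals of the kernel. -/
lemma tendsto_integral_cauchyKernel (ha : Continuous a)
    (hchar : ∀ n ξ, charFun (ρ n) ξ = Complex.exp (-(a ξ / (n + 1))))
    {ε : ℝ} (hε : 0 < ε)
    (hint : IntegrableOn (fun ξ => Complex.exp (-(ε * ξ : ℝ)) * a ξ) (Set.Ioi 0)) :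
    Tendsto (fun n : ℕ => ((n : ℂ) + 1) * ∫ y, cauchyKernel ε y ∂(ρ n)) atTop
      (𝓝 (∫ ξ in Set.Ioi (0 : ℝ), Complex.exp (-(ε * ξ : ℝ)) * a ξ)) := by
  have hre : ∀ ξ, 0 ≤ (a ξ).re := by
    intro ξ
    have := norm_charFun_le_one (μ := ρ 0) ξ
    rw [hchar, Complex.norm_exp, Real.exp_le_one_iff] at this
    simpa using this
  simp_rw [integral_cauchyKernel hε, ← integral_const_mul, hchar]
  refine tendsto_integral_of_dominated_convergence
    (fun ξ => ‖Complex.exp (-(ε * ξ : ℝ)) * a ξ‖) (fun n => ?_) hint.norm (fun n => ?_) ?_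
  · exact Continuous.aestronglyMeasurable (by fun_prop)
  · refine ae_of_all _ fun ξ => ?_
    rw [mul_left_comm, norm_mul, norm_mul (Complex.exp _) (a ξ)]
    refine mul_le_mul_of_nonneg_left ?_ (norm_nonneg _)
    have hpos : (0 : ℝ) < n + 1 := by positivity
    have hnn : ‖(n : ℂ) + 1‖ = n + 1 := by
      rw [show (n : ℂ) + 1 = ((n + 1 : ℝ) : ℂ) by push_cast; ring, Complex.norm_real,
        Real.norm_of_nonneg hpos.le]
    have h1 := norm_one_sub_exp_neg_le (z := a ξ / (n + 1)) (by
      rw [show (n : ℂ) + 1 = ((n + 1 : ℝ) : ℂ) by push_cast; ring, Complex.div_ofReal_re]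
      exact div_nonneg (hre ξ) hpos.le)
    rw [norm_mul, hnn]
    rw [norm_div, hnn] at h1
    calc ((n : ℝ) + 1) * _ ≤ (n + 1) * (‖a ξ‖ / (n + 1)) := by gcongr
      _ = ‖a ξ‖ := by field_simp
  · refine ae_of_all _ fun ξ => ?_
    simp_rw [mul_left_comm]
    exact (tendsto_nat_mul_one_sub_exp (a ξ)).const_mul _

end Support

section Support

/-- The growth comparison that rules out one-sided laws: `A` and `B` stand for the limits of
`n E[Y_n / (ε² + Y_n²)]` and `n E[Y_n² / (ε² + Y_n²)]`. -/
lemma false_of_kernel_growth {A B : ℝ → ℝ} {d C D υ υ₁ : ℝ} (hC : 0 < C) (hυ₁ : 0 < υ₁)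
    (hυ : υ₁ < υ)
    (h1 : ∀ ε κ : ℝ, 0 < ε → 0 < κ → B ε ≤ κ * ε * A ε + 2 * B (κ * ε))
    (h2 : ∀ δ : ℝ, 0 < δ → ∃ c : ℝ, ∀ ε : ℝ, 0 < ε → ε ^ 2 * A ε ≤ 2 * (δ + ε * c))
    (h3 : ∀ x : ℝ, 1 ≤ x → |A x⁻¹ + d * x ^ 2| ≤ D * x ^ (υ₁ + 1))
    (h4 : ∀ x : ℝ, 1 ≤ x → |B x⁻¹ - C * x ^ υ| ≤ D * x ^ υ₁) : False := by
  have hυ0 : 0 < υ := hυ₁.trans hυ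
  have hD : 0 ≤ D := by
    have := (abs_nonneg _).trans (h3 1 le_rfl); simpa using this
  -- by `h4` this choice makes `2 B(κε)` about half of `B(ε)`, so `h1` bounds `A` from below
  set κ : ℝ := 4 ^ υ⁻¹ with hκ
  have hκ1 : 1 ≤ κ := Real.one_le_rpow (by norm_num) (inv_nonneg.2 hυ0.le)
  have hκ0 : 0 < κ := one_pos.trans_le hκ1
  have hκυ : κ ^ υ = 4 := by
    rw [hκ, ← Real.rpow_mul (by norm_num), inv_mul_cancel₀ hυ0.ne', Real.rpow_one]
  have hneg : Tendsto (fun x : ℝ => x ^ (υ₁ - υ)) atTop (𝓝 0) := by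
    have := tendsto_rpow_neg_atTop (sub_pos.2 hυ)
    simpa using this
  set c₀ := C / (4 * κ) with hc₀
  have hc₀pos : 0 < c₀ := by positivity
  -- `A` grows at least like `ε^{-υ-1}`
  have hlow : ∀ᶠ x : ℝ in atTop, c₀ * x ^ (υ + 1) ≤ A x⁻¹ := by
    have hη := (hneg.const_mul (3 * D)).eventually_le_const
      (show 3 * D * 0 < C / 4 by rw [mul_zero]; positivity)
    filter_upwards [hη, eventually_ge_atTop κ] with x hx hxκ
    have hx1 : 1 ≤ x := hκ1.trans hxκ
    have hx0 : 0 < x := one_pos.trans_le hx1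
    have hxk : 1 ≤ x / κ := (one_le_div hκ0).2 hxκ
    have e1 := h1 x⁻¹ κ (inv_pos.2 hx0) hκ0
    have e2 := (abs_le.1 (h4 x hx1)).1
    have e3 := (abs_le.1 (h4 (x / κ) hxk)).2
    rw [inv_div, div_eq_mul_inv κ x, Real.div_rpow hx0.le hκ0.le, Real.div_rpow hx0.le hκ0.le,
      hκυ] at e3
    have e4 : x ^ υ₁ / κ ^ υ₁ ≤ x ^ υ₁ :=
      div_le_self (by positivity) (Real.one_le_rpow hκ1 hυ₁.le)
    have e5 : 3 * D * x ^ υ₁ ≤ C / 4 * x ^ υ := by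
      have : x ^ υ₁ = x ^ (υ₁ - υ) * x ^ υ := by rw [← Real.rpow_add hx0]; congr 1; ring
      rw [this, ← mul_assoc]; gcongr
    have e6 : D * (x ^ υ₁ / κ ^ υ₁) ≤ D * x ^ υ₁ := by gcongr
    have e7 : C / 4 * x ^ υ ≤ κ * x⁻¹ * A x⁻¹ := by linarith
    rw [Real.rpow_add_one hx0.ne', hc₀]
    have e8 : A x⁻¹ = (κ * x⁻¹ * A x⁻¹) * (x / κ) := by field_simp
    rw [e8]
    calc C / (4 * κ) * (x ^ υ * x) = C / 4 * x ^ υ * (x / κ) := by field_simp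
      _ ≤ _ := by gcongr
  -- `ε² A` is asymptotically at most `0`
  have hup : ∀ δ : ℝ, 0 < δ → ∃ c : ℝ, ∀ x : ℝ, 0 < x → A x⁻¹ ≤ 2 * (δ + x⁻¹ * c) * x ^ 2 := by
    intro δ hδ
    obtain ⟨c, hc⟩ := h2 δ hδ
    refine ⟨c, fun x hx => ?_⟩
    have := hc x⁻¹ (inv_pos.2 hx)
    calc A x⁻¹ = (x⁻¹ ^ 2 * A x⁻¹) * x ^ 2 := by field_simp
      _ ≤ _ := by gcongr
  have hlim : ∀ δ c : ℝ, Tendsto (fun x : ℝ => 2 * (δ + x⁻¹ * c)) atTop (𝓝 (2 * δ)) := by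
    intro δ c
    have := ((tendsto_inv_atTop_zero (𝕜 := ℝ)).mul_const c).const_add δ |>.const_mul 2
    simpa using this
  -- For `υ ≥ 1` the two bounds on `A` are incompatible. For `υ < 1` the term `-d x²` dominates `A`
  -- and the upper bound forces `d ≥ 0`; but then `A ≤ D x^(υ₁ + 1)` contradicts the lower bound.
  rcases le_or_gt 1 υ with hυ1 | hυ1
  · obtain ⟨c, hc⟩ := hup (c₀ / 4) (by positivity)
    have : c₀ ≤ 2 * (c₀ / 4) := by
      refine ge_of_tendsto (hlim (c₀ / 4) c) ?_
      filter_upwards [hlow, eventually_ge_atTop 1] with x hx hx1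
      have hx0 : 0 < x := one_pos.trans_le hx1
      have e1 := hx.trans (hc x hx0)
      have e2 : x ^ (2 : ℕ) ≤ x ^ (υ + 1) := by
        rw [← Real.rpow_natCast]
        exact Real.rpow_le_rpow_of_exponent_le hx1 (by push_cast; linarith)
      have e3 : c₀ * x ^ 2 ≤ c₀ * x ^ (υ + 1) := by gcongr
      exact le_of_mul_le_mul_right (e3.trans e1) (by positivity)
    linarith
  · have hd : -d ≤ 0 := by
      refine le_of_forall_pos_le_add fun δ hδ => ?_
      obtain ⟨c, hc⟩ := hup (δ / 2) (by positivity)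
      have hl : Tendsto (fun x : ℝ => 2 * (δ / 2 + x⁻¹ * c) + D * x ^ (υ₁ - 1)) atTop
          (𝓝 (0 + δ)) := by
        have h5 : Tendsto (fun x : ℝ => x ^ (υ₁ - 1)) atTop (𝓝 0) := by
          have := tendsto_rpow_neg_atTop (show 0 < 1 - υ₁ by linarith)
          simpa using this
        have := (hlim (δ / 2) c).add (h5.const_mul D)
        rw [mul_zero, add_zero, mul_div_cancel₀ δ two_ne_zero] at this
        rwa [zero_add]
      refine ge_of_tendsto hl ?_
      filter_upwards [eventually_ge_atTop 1] with x hx1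
      have hx0 : 0 < x := one_pos.trans_le hx1
      have e1 := (abs_le.1 (h3 x hx1)).2
      have e1' := (abs_le.1 (h3 x hx1)).1
      have e2 := hc x hx0
      have e3 : x ^ (υ₁ + 1) = x ^ (υ₁ - 1) * x ^ 2 := by
        rw [← Real.rpow_natCast, ← Real.rpow_add hx0]; congr 1; push_cast; ring
      rw [e3] at e1'
      have : -d * x ^ 2 ≤ (2 * (δ / 2 + x⁻¹ * c) + D * x ^ (υ₁ - 1)) * x ^ 2 := by nlinarith
      exact le_of_mul_le_mul_right this (by positivity)
    have : c₀ ≤ 0 := by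
      refine ge_of_tendsto (by simpa using hneg.const_mul D) ?_
      filter_upwards [hlow, eventually_ge_atTop 1] with x hx hx1
      have hx0 : 0 < x := one_pos.trans_le hx1
      have e1 := (abs_le.1 (h3 x hx1)).2
      have e3 : x ^ (υ₁ + 1) = x ^ (υ₁ - υ) * x ^ (υ + 1) := by
        rw [← Real.rpow_add hx0]; congr 1; ring
      have e4 : 0 ≤ d * x ^ 2 := mul_nonneg (by linarith) (by positivity)
      have : c₀ * x ^ (υ + 1) ≤ D * x ^ (υ₁ - υ) * x ^ (υ + 1) := by
        rw [mul_assoc, ← e3]; linarith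
      exact le_of_mul_le_mul_right this (by positivity)
    linarith

lemma integrableOn_rpow_mul_exp {p ε : ℝ} (hp : 0 < p) (hε : 0 < ε) :
    IntegrableOn (fun ξ : ℝ => ξ ^ p * Real.exp (-(ε * ξ))) (Set.Ioi 0) := by
  have := integrableOn_rpow_mul_exp_neg_mul_rpow (s := p) (by linarith) one_pos hε
  simpa [neg_mul] using this

lemma integral_rpow_mul_exp {p ε : ℝ} (hp : 0 < p) (hε : 0 < ε) :
    ∫ ξ in Set.Ioi (0 : ℝ), ξ ^ p * Real.exp (-(ε * ξ)) = (ε⁻¹) ^ (p + 1) * Real.Gamma (p + 1) := by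
  have := Real.integral_rpow_mul_exp_neg_mul_Ioi (a := p + 1) (by linarith) hε
  simpa using this

/-- Laplace transforms of a function with a power-type asymptotic expansion. -/
lemma laplace_asymptotics {a : ℝ → ℂ} (ha : Continuous a) {d C D υ υ₁ : ℝ} (hυ₁ : 0 < υ₁)
    (hυ : 0 < υ)
    (hasym : ∀ ξ : ℝ, 0 ≤ ξ →
      ‖a ξ - (Complex.I * ((d * ξ : ℝ) : ℂ) + ((C * ξ ^ υ : ℝ) : ℂ))‖ ≤ D * (1 + ξ ^ υ₁))
    {ε : ℝ} (hε : 0 < ε) :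
    IntegrableOn (fun ξ => Complex.exp (-(ε * ξ : ℝ)) * a ξ) (Set.Ioi 0) ∧
    ‖(∫ ξ in Set.Ioi (0 : ℝ), Complex.exp (-(ε * ξ : ℝ)) * a ξ) -
      (Complex.I * ((d * ε⁻¹ ^ 2 : ℝ) : ℂ) + ((C * (ε⁻¹ ^ (υ + 1) * Real.Gamma (υ + 1)) : ℝ) : ℂ))‖
      ≤ D * (ε⁻¹ + ε⁻¹ ^ (υ₁ + 1) * Real.Gamma (υ₁ + 1)) := by
  set b : ℝ → ℂ := fun ξ => Complex.I * ((d * ξ : ℝ) : ℂ) + ((C * ξ ^ υ : ℝ) : ℂ) with hb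
  have hexp : IntegrableOn (fun ξ : ℝ => Real.exp (-(ε * ξ))) (Set.Ioi 0) := by
    simpa [neg_mul] using integrableOn_exp_mul_Ioi (neg_lt_zero.2 hε) 0
  have hexpI : ∫ ξ in Set.Ioi (0 : ℝ), Real.exp (-(ε * ξ)) = ε⁻¹ := by
    have := integral_exp_mul_Ioi (neg_lt_zero.2 hε) 0
    simpa [neg_mul, neg_div_neg_eq] using this
  have h1I : IntegrableOn (fun ξ : ℝ => ξ * Real.exp (-(ε * ξ))) (Set.Ioi 0) := by
    simpa using integrableOn_rpow_mul_exp one_pos hε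
  have h1v : ∫ ξ in Set.Ioi (0 : ℝ), ξ * Real.exp (-(ε * ξ)) = ε⁻¹ ^ 2 := by
    have := integral_rpow_mul_exp one_pos hε
    simp only [Real.rpow_one] at this
    rw [this, show (1 : ℝ) + 1 = 2 by norm_num, Real.Gamma_two, mul_one, Real.rpow_two]
  have hυI := integrableOn_rpow_mul_exp hυ hε
  have hυ₁I := integrableOn_rpow_mul_exp hυ₁ hε
  have hbe : ∀ ξ : ℝ, Complex.exp (-(ε * ξ : ℝ)) * b ξ =
      Complex.I * ((d * (ξ * Real.exp (-(ε * ξ))) : ℝ) : ℂ) +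
        ((C * (ξ ^ υ * Real.exp (-(ε * ξ))) : ℝ) : ℂ) := by
    intro ξ; simp only [hb]; push_cast; ring
  have hb1 : IntegrableOn (fun ξ : ℝ => Complex.I * ((d * (ξ * Real.exp (-(ε * ξ))) : ℝ) : ℂ))
      (Set.Ioi 0) := ((h1I.const_mul d).ofReal (𝕜 := ℂ)).const_mul _
  have hb2 : IntegrableOn (fun ξ : ℝ => ((C * (ξ ^ υ * Real.exp (-(ε * ξ))) : ℝ) : ℂ))
      (Set.Ioi 0) := (hυI.const_mul C).ofReal (𝕜 := ℂ)
  have hbI : IntegrableOn (fun ξ : ℝ => Complex.exp (-(ε * ξ : ℝ)) * b ξ) (Set.Ioi 0) := by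
    simp_rw [hbe]; exact hb1.add hb2
  have hbv : ∫ ξ in Set.Ioi (0 : ℝ), Complex.exp (-(ε * ξ : ℝ)) * b ξ =
      Complex.I * ((d * ε⁻¹ ^ 2 : ℝ) : ℂ) +
        ((C * (ε⁻¹ ^ (υ + 1) * Real.Gamma (υ + 1)) : ℝ) : ℂ) := by
    simp_rw [hbe]
    rw [integral_add hb1 hb2, integral_const_mul, integral_complex_ofReal,
      integral_complex_ofReal, integral_const_mul, integral_const_mul, h1v,
      integral_rpow_mul_exp hυ hε]
  have hdom : IntegrableOn (fun ξ : ℝ => D * (Real.exp (-(ε * ξ)) + ξ ^ υ₁ * Real.exp (-(ε * ξ))))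
      (Set.Ioi 0) := (hexp.add hυ₁I).const_mul D
  have hle : ∀ᵐ ξ ∂(volume.restrict (Set.Ioi (0 : ℝ))),
      ‖Complex.exp (-(ε * ξ : ℝ)) * a ξ - Complex.exp (-(ε * ξ : ℝ)) * b ξ‖ ≤
        D * (Real.exp (-(ε * ξ)) + ξ ^ υ₁ * Real.exp (-(ε * ξ))) := by
    filter_upwards [self_mem_ae_restrict measurableSet_Ioi] with ξ hξ
    rw [← mul_sub, norm_mul, ← Complex.ofReal_neg, ← Complex.ofReal_exp, Complex.norm_real,
      Real.norm_of_nonneg (Real.exp_pos _).le]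
    have := hasym ξ (le_of_lt hξ)
    calc _ ≤ Real.exp (-(ε * ξ)) * (D * (1 + ξ ^ υ₁)) := by gcongr
      _ = _ := by ring
  have hdiff : IntegrableOn (fun ξ : ℝ => Complex.exp (-(ε * ξ : ℝ)) * a ξ -
      Complex.exp (-(ε * ξ : ℝ)) * b ξ) (Set.Ioi 0) :=
    hdom.mono' ((Continuous.aestronglyMeasurable (by fun_prop)).sub hbI.1) hle
  have haI : IntegrableOn (fun ξ : ℝ => Complex.exp (-(ε * ξ : ℝ)) * a ξ) (Set.Ioi 0) :=
    (hdiff.add hbI).congr (ae_of_all _ fun ξ => by simp)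
  refine ⟨haI, ?_⟩
  rw [← hbv, ← integral_sub haI hbI]
  refine (norm_integral_le_of_norm_le hdom hle).trans_eq ?_
  rw [integral_const_mul, integral_add hexp hυ₁I, hexpI, integral_rpow_mul_exp hυ₁ hε]

end Support

section Support

variable {ρ : ℕ → Measure ℝ} [∀ n, IsProbabilityMeasure (ρ n)] {a : ℝ → ℂ}

/-- An infinitely divisible law on `[0, ∞)` whose support reaches `0` cannot have an exponent with
the expansion `i d ξ + C ξ^υ + O(ξ^υ₁)`, where `C > 0` is real: for such a law the imaginary part
of the exponent would have to be at least of the order of the real part. Here `ρ n` is the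
`(n + 1)`-st convolution root of the law. -/
lemma false_of_oneSided (hρ : ∀ n, ∀ᵐ y ∂(ρ n), 0 ≤ y) (ha : Continuous a)
    (hchar : ∀ n ξ, charFun (ρ n) ξ = Complex.exp (-(a ξ / (n + 1))))
    {d C D υ υ₁ : ℝ} (hC : 0 < C) (hυ₁ : 0 < υ₁) (hυ : υ₁ < υ)
    (hasym : ∀ ξ : ℝ, 0 ≤ ξ →
      ‖a ξ - (Complex.I * ((d * ξ : ℝ) : ℂ) + ((C * ξ ^ υ : ℝ) : ℂ))‖ ≤ D * (1 + ξ ^ υ₁))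
    (hess : ∀ δ : ℝ, 0 < δ → 0 < (ρ 0).real (Set.Iio δ))
    (hroot : ∀ (n : ℕ) (l : ℝ), 0 < l →
      (∫ y, Real.exp (-(l * y)) ∂(ρ n)) ^ (n + 1) = ∫ y, Real.exp (-(l * y)) ∂(ρ 0)) : False := by
  have hυ0 := hυ₁.trans hυ
  have hD : 0 ≤ D := by
    have h := (norm_nonneg _).trans (hasym 0 le_rfl)
    rw [Real.zero_rpow hυ₁.ne'] at h
    simpa using h
  have hL := fun {ε : ℝ} (hε : 0 < ε) => laplace_asymptotics ha hυ₁ hυ0 hasym hε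
  set H : ℝ → ℂ := fun ε => ∫ ξ in Set.Ioi (0 : ℝ), Complex.exp (-(ε * ξ : ℝ)) * a ξ with hH
  have hlim := fun {ε : ℝ} (hε : 0 < ε) =>
    tendsto_integral_cauchyKernel (ρ := ρ) ha hchar hε (hL hε).1
  have hIA : ∀ (ε : ℝ), 0 < ε → ∀ n, Integrable (fun y => y / (ε ^ 2 + y ^ 2)) (ρ n) := by
    intro ε hε n
    refine (integrable_cauchyKernel hε (ρ n)).im.neg.congr (ae_of_all _ fun y => ?_)
    simpa using cauchyKernel_im ε y
  have hIB : ∀ (ε : ℝ), 0 < ε → ∀ n, Integrable (fun y => y ^ 2 / (ε ^ 2 + y ^ 2)) (ρ n) := by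
    intro ε hε n
    refine ((integrable_cauchyKernel hε (ρ n)).re.const_mul ε).congr (ae_of_all _ fun y => ?_)
    simpa using cauchyKernel_re hε y
  have hre : ∀ (n : ℕ) (z : ℂ), (((n : ℂ) + 1) * z).re = (n + 1) * z.re := by
    intro n z
    rw [show (n : ℂ) + 1 = ((n + 1 : ℝ) : ℂ) by push_cast; ring, Complex.re_ofReal_mul]
  have him : ∀ (n : ℕ) (z : ℂ), (((n : ℂ) + 1) * z).im = (n + 1) * z.im := by
    intro n z
    rw [show (n : ℂ) + 1 = ((n + 1 : ℝ) : ℂ) by push_cast; ring, Complex.im_ofReal_mul]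
  have hA : ∀ (ε : ℝ), 0 < ε → Tendsto (fun n : ℕ => ((n : ℝ) + 1) *
      ∫ y, y / (ε ^ 2 + y ^ 2) ∂(ρ n)) atTop (𝓝 (-(H ε).im)) := by
    intro ε hε
    refine ((Complex.continuous_im.tendsto _).comp (hlim hε)).neg.congr fun n => ?_
    simp only [Function.comp_apply]
    rw [him, ← RCLike.im_eq_complex_im, ← integral_im (integrable_cauchyKernel hε (ρ n)),
      ← mul_neg, ← integral_neg]
    simp only [RCLike.im_eq_complex_im, cauchyKernel_im]
  have hB : ∀ (ε : ℝ), 0 < ε → Tendsto (fun n : ℕ => ((n : ℝ) + 1) *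
      ∫ y, y ^ 2 / (ε ^ 2 + y ^ 2) ∂(ρ n)) atTop (𝓝 (ε * (H ε).re)) := by
    intro ε hε
    refine (((Complex.continuous_re.tendsto _).comp (hlim hε)).const_mul ε).congr fun n => ?_
    simp only [Function.comp_apply]
    rw [hre, ← RCLike.re_eq_complex_re, ← integral_re (integrable_cauchyKernel hε (ρ n)),
      mul_left_comm, ← integral_const_mul]
    simp only [RCLike.re_eq_complex_re, cauchyKernel_re hε]
  have hG : 0 < Real.Gamma (υ₁ + 1) := Real.Gamma_pos_of_pos (by linarith)
  have hdiff : ∀ x : ℝ, 1 ≤ x →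
      ‖H x⁻¹ - (Complex.I * ((d * x ^ 2 : ℝ) : ℂ) +
        ((C * (x ^ (υ + 1) * Real.Gamma (υ + 1)) : ℝ) : ℂ))‖ ≤
      D * (1 + Real.Gamma (υ₁ + 1)) * x ^ (υ₁ + 1) := by
    intro x hx
    have h := (hL (inv_pos.2 (one_pos.trans_le hx))).2
    rw [inv_inv] at h
    refine h.trans ?_
    have : x ≤ x ^ (υ₁ + 1) := by
      simpa using Real.rpow_le_rpow_of_exponent_le hx (show (1 : ℝ) ≤ υ₁ + 1 by linarith)
    rw [mul_assoc]
    gcongr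
    linarith
  refine false_of_kernel_growth (A := fun ε => -(H ε).im) (B := fun ε => ε * (H ε).re) (d := d)
    (C := C * Real.Gamma (υ + 1)) (D := D * (1 + Real.Gamma (υ₁ + 1)))
    (mul_pos hC (Real.Gamma_pos_of_pos (by linarith))) hυ₁ hυ ?_ ?_ ?_ ?_
  · -- compare the kernels on `y ≤ κε` and on `y > κε`
    intro ε κ hε hκ
    have hκε : 0 < κ * ε := mul_pos hκ hε
    refine le_of_tendsto_of_tendsto' (hB ε hε)
      (((hA ε hε).const_mul (κ * ε)).add ((hB _ hκε).const_mul 2)) fun n => ?_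
    rw [mul_left_comm (κ * ε), mul_left_comm (2 : ℝ), ← mul_add, ← integral_const_mul (κ * ε),
      ← integral_const_mul (2 : ℝ), ← integral_add ((hIA ε hε n).const_mul _) ((hIB _ hκε n).const_mul _)]
    refine mul_le_mul_of_nonneg_left ?_ (by positivity)
    refine integral_mono_ae (hIB ε hε n)
      (((hIA ε hε n).const_mul _).add ((hIB _ hκε n).const_mul _)) ?_
    filter_upwards [hρ n] with y hy
    have h1 : 0 < ε ^ 2 + y ^ 2 := by positivity
    have h2 : 0 < (κ * ε) ^ 2 + y ^ 2 := by positivity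
    rcases le_or_gt y (κ * ε) with h | h
    · have : y ^ 2 / (ε ^ 2 + y ^ 2) ≤ κ * ε * (y / (ε ^ 2 + y ^ 2)) := by
        rw [← mul_div_assoc]; gcongr; nlinarith
      have h3 : 0 ≤ 2 * (y ^ 2 / ((κ * ε) ^ 2 + y ^ 2)) := by positivity
      linarith
    · have : y ^ 2 / (ε ^ 2 + y ^ 2) ≤ 2 * (y ^ 2 / ((κ * ε) ^ 2 + y ^ 2)) := by
        have e1 : y ^ 2 / (ε ^ 2 + y ^ 2) ≤ 1 := by
          rw [div_le_one h1]; nlinarith [sq_nonneg ε]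
        have e2 : 1 ≤ 2 * (y ^ 2 / ((κ * ε) ^ 2 + y ^ 2)) := by
          rw [← mul_div_assoc, one_le_div h2]; nlinarith
        linarith
      have h3 : 0 ≤ κ * ε * (y / (ε ^ 2 + y ^ 2)) := by positivity
      linarith
  · -- the support reaches `0`, so the Laplace exponent grows more slowly than linearly
    intro δ hδ
    set p := (ρ 0).real (Set.Iio δ) with hp
    have hp0 : 0 < p := hess δ hδ
    refine ⟨-Real.log p, fun ε hε => ?_⟩
    set l := ε⁻¹ with hl
    have hl0 : 0 < l := inv_pos.2 hε
    have hexpI : ∀ n, Integrable (fun y => Real.exp (-(l * y))) (ρ n) := by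
      intro n
      refine Integrable.of_bound (Continuous.aestronglyMeasurable (by fun_prop)) 1 ?_
      filter_upwards [hρ n] with y hy
      rw [Real.norm_of_nonneg (Real.exp_pos _).le, Real.exp_le_one_iff]
      have := mul_nonneg hl0.le hy
      linarith
    have hexp_pos : ∀ n, 0 < ∫ y, Real.exp (-(l * y)) ∂(ρ n) := fun n =>
      integral_exp_pos (hexpI n)
    have hL0 : Real.exp (-(l * δ)) * p ≤ ∫ y, Real.exp (-(l * y)) ∂(ρ 0) := by
      have : ∫ y, (Set.Iio δ).indicator (fun _ => Real.exp (-(l * δ))) y ∂(ρ 0) =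
          Real.exp (-(l * δ)) * p := by
        rw [integral_indicator_const _ measurableSet_Iio, smul_eq_mul, mul_comm]
      rw [← this]
      refine integral_mono ((integrable_const _).indicator measurableSet_Iio) (hexpI 0) fun y => ?_
      by_cases hy : y ∈ Set.Iio δ
      · rw [Set.indicator_of_mem hy]
        have : y < δ := hy
        gcongr
      · rw [Set.indicator_of_notMem hy]; positivity
    have hlog : -Real.log (∫ y, Real.exp (-(l * y)) ∂(ρ 0)) ≤ l * δ - Real.log p := by
      have := Real.log_le_log (by positivity) hL0
      rw [Real.log_mul (Real.exp_pos _).ne' hp0.ne', Real.log_exp] at this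
      linarith
    have hbound : ε ^ 2 * -(H ε).im ≤ 2 * ε * (l * δ - Real.log p) := by
      refine le_of_tendsto' ((hA ε hε).const_mul (ε ^ 2)) fun n => ?_
      have hn : (0 : ℝ) < n + 1 := by positivity
      have e1 : ∫ y, y / (ε ^ 2 + y ^ 2) ∂(ρ n) ≤
          2 / ε * (1 - ∫ y, Real.exp (-(l * y)) ∂(ρ n)) := by
        have : (1 : ℝ) = ∫ _, (1 : ℝ) ∂(ρ n) := by simp
        rw [this, ← integral_sub (integrable_const _) (hexpI n), ← integral_const_mul]
        refine integral_mono_ae (hIA ε hε n)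
          (((integrable_const _).sub (hexpI n)).const_mul _) ?_
        filter_upwards [hρ n] with y hy
        set u := l * y with hu
        have hu0 : 0 ≤ u := mul_nonneg hl0.le hy
        have hy' : y = ε * u := by rw [hu, hl]; field_simp
        have e2 : Real.exp (-u) ≤ 1 / (1 + u) := by
          rw [Real.exp_neg, ← one_div]
          exact one_div_le_one_div_of_le (by positivity) (by linarith [Real.add_one_le_exp u])
        have e3 : y / (ε ^ 2 + y ^ 2) = 1 / ε * (u / (1 + u ^ 2)) := by
          rw [hy']; field_simp
        rw [e3, div_mul_eq_mul_div, div_mul_eq_mul_div]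
        refine div_le_div_of_nonneg_right ?_ hε.le
        have e4 : u / (1 + u ^ 2) ≤ 2 * (1 - 1 / (1 + u)) := by
          rw [show 2 * (1 - 1 / (1 + u)) = 2 * u / (1 + u) by field_simp; ring,
            div_le_div_iff₀ (by positivity) (by positivity)]
          nlinarith [mul_nonneg hu0 hu0, mul_nonneg hu0 (sq_nonneg u), mul_nonneg hu0 (sq_nonneg (u - 1))]
        linarith
      have e5 : ((n : ℝ) + 1) * (1 - ∫ y, Real.exp (-(l * y)) ∂(ρ n)) ≤ l * δ - Real.log p := by
        refine le_trans ?_ hlog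
        rw [← hroot n l hl0, Real.log_pow]
        have := Real.log_le_sub_one_of_pos (hexp_pos n)
        push_cast
        nlinarith
      calc ε ^ 2 * (((n : ℝ) + 1) * ∫ y, y / (ε ^ 2 + y ^ 2) ∂(ρ n))
          ≤ ε ^ 2 * (((n : ℝ) + 1) * (2 / ε * (1 - ∫ y, Real.exp (-(l * y)) ∂(ρ n)))) := by gcongr
        _ = 2 * ε * (((n : ℝ) + 1) * (1 - ∫ y, Real.exp (-(l * y)) ∂(ρ n))) := by
          field_simp
        _ ≤ _ := by gcongr
    refine hbound.trans_eq ?_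
    rw [hl]; field_simp; ring
  · intro x hx
    have := (Complex.abs_im_le_norm _).trans (hdiff x hx)
    rw [← abs_neg] at this
    convert! this using 2
    simp only [Complex.sub_im, Complex.add_im, Complex.mul_im, Complex.I_re,
      Complex.I_im, Complex.ofReal_re, Complex.ofReal_im]
    ring
  · intro x hx
    have hx0 : 0 < x := one_pos.trans_le hx
    have := (Complex.abs_re_le_norm _).trans (hdiff x hx)
    simp only [Complex.sub_re, Complex.add_re, Complex.ofReal_re, Complex.mul_re, Complex.I_re,
      zero_mul, Complex.ofReal_im, mul_zero, sub_zero, zero_add] at this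
    have e : x⁻¹ * (H x⁻¹).re - C * Real.Gamma (υ + 1) * x ^ υ =
        x⁻¹ * ((H x⁻¹).re - C * (x ^ (υ + 1) * Real.Gamma (υ + 1))) := by
      rw [Real.rpow_add_one hx0.ne']; field_simp
    rw [e, abs_mul, abs_of_pos (inv_pos.2 hx0)]
    calc _ ≤ x⁻¹ * (D * (1 + Real.Gamma (υ₁ + 1)) * x ^ (υ₁ + 1)) := by gcongr
      _ = _ := by rw [Real.rpow_add_one hx0.ne']; field_simp

end Support

/-! ### Lévy processes -/

section Levy

set_option linter.unusedSectionVars false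

variable {Ω : Type*} [MeasurableSpace Ω] {Q : Measure Ω} [IsProbabilityMeasure Q]
  {X : ℝ≥0 → Ω → ℝ} {ψ : ℂ → ℂ} {υ lm lp : ℝ}

lemma IsLevy.neg (hX : IsLevy X Q) : IsLevy (fun t ω => -X t ω) Q where
  measurable t := (hX.measurable t).neg
  zero := by filter_upwards [hX.zero] with ω h; simp [h]
  indep := hX.indep.neg
  stationary t h := by
    have := (hX.stationary t h).comp measurable_neg
    convert! this using 1
    funext ω; simp; ring
  continuous t := by
    have := hX.continuous t
    rw [tendstoInMeasure_iff_dist] at this ⊢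
    simpa using this

lemma HasCharExponent.neg (hψ : HasCharExponent X Q ψ) :
    HasCharExponent (fun t ω => -X t ω) Q (fun ξ => ψ (-ξ)) := by
  intro t ξ
  have := hψ t (-ξ)
  push_cast at this ⊢
  simpa using this

lemma IsLevy.charFun_map (hX : IsLevy X Q) (hψ : HasCharExponent X Q ψ) (t : ℝ≥0) (ξ : ℝ) :
    charFun (Q.map (X t)) ξ = Complex.exp (-((t : ℝ) * ψ ξ)) := by
  rw [charFun_apply_real, integral_map (hX.measurable t).aemeasurable
    (Continuous.aestronglyMeasurable (by fun_prop)), ← hψ t ξ]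
  congr 1; funext ω; congr 1; ring

lemma IsLevy.map_sub (hX : IsLevy X Q) {t u : ℝ≥0} (htu : t ≤ u) :
    Q.map (fun ω => X u ω - X t ω) = Q.map (X (u - t)) := by
  have := (hX.stationary t (u - t)).map_eq
  rwa [add_tsub_cancel_of_le htu] at this

lemma IsLevy.measurable_sub (hX : IsLevy X Q) (t u : ℝ≥0) :
    Measurable fun ω => X u ω - X t ω := (hX.measurable u).sub (hX.measurable t)

/-- `X_t` is a sum of `n + 1` independent copies of `X_{t / (n + 1)}`. -/
lemma IsLevy.exists_iid_sum (hX : IsLevy X Q) (t : ℝ≥0) (n : ℕ) :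
    ∃ Y : Fin (n + 1) → Ω → ℝ, iIndepFun Y Q ∧ (∀ i, Measurable (Y i)) ∧
      (∀ i, Q.map (Y i) = Q.map (X (t / (n + 1)))) ∧ (∀ᵐ ω ∂Q, X t ω = ∑ i, Y i ω) := by
  let τ : ℕ → ℝ≥0 := fun k => k * (t / (n + 1))
  have hτ : Monotone τ := fun i j hij => by
    simp only [τ]; gcongr
  refine ⟨fun i ω => X (τ (i + 1)) ω - X (τ i) ω, ?_, fun i => hX.measurable_sub _ _, ?_, ?_⟩
  · exact (hX.indep.nat hτ).precomp (g := fun i : Fin (n + 1) => (i : ℕ)) Fin.val_injective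
  · intro i
    rw [hX.map_sub (hτ (Nat.le_succ _))]
    congr 2
    simp only [τ]
    push_cast
    rw [add_mul, one_mul, add_tsub_cancel_left]
  · filter_upwards [hX.zero] with ω h0
    rw [Fin.sum_univ_eq_sum_range (fun k => X (τ (k + 1)) ω - X (τ k) ω),
      Finset.sum_range_sub (fun k => X (τ k) ω)]
    have h1 : τ (n + 1) = t := by
      simp only [τ]; push_cast; field_simp
    have h2 : τ 0 = 0 := by simp [τ]
    rw [h1, h2, h0, sub_zero]

/-- Expansion of a regular exponent along the real line. -/
lemma IsRLPEExponent.exists_real_asymptotics (h : IsRLPEExponent ψ υ lm lp) (hυ : 0 < υ)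
    (hlm : lm < 0) (hlp : 0 < lp) :
    ∃ m C D υ₁ : ℝ, 0 < C ∧ 0 < υ₁ ∧ υ₁ < υ ∧ ∀ ξ : ℝ,
      ‖ψ ξ - (Complex.I * ((m * ξ : ℝ) : ℂ) + ((C * |ξ| ^ υ : ℝ) : ℂ))‖ ≤ D * (1 + |ξ| ^ υ₁) := by
  have hcψ := h.continuousOn
  obtain ⟨μ, φ, h1, -, h3, ⟨C, υ₁, hC, hυ₁, hO⟩, -⟩ := h
  obtain ⟨A, hA⟩ := hO.bound
  rw [eventually_inf_principal] at hA
  obtain ⟨R, -, hR⟩ := (Filter.hasBasis_cobounded_norm (E := ℂ)).mem_iff.1 hA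
  have hstrip : ∀ ξ : ℝ, (ξ : ℂ).im ∈ Set.Icc lm lp := fun ξ => by
    simp [hlm.le, hlp.le]
  set g : ℝ → ℂ := fun ξ => ψ ξ -
    (Complex.I * ((-μ * ξ : ℝ) : ℂ) + ((C * |ξ| ^ υ : ℝ) : ℂ)) with hg
  have hgφ : ∀ ξ : ℝ, g ξ = φ ξ - ((C * ‖(ξ : ℂ)‖ ^ υ : ℝ) : ℂ) := by
    intro ξ
    simp only [hg]
    rw [h1 ξ (hstrip ξ), Complex.norm_real, Real.norm_eq_abs]
    push_cast; ring
  have hgc : Continuous g := by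
    have hc1 : Continuous fun ξ : ℝ => ψ ξ :=
      hcψ.comp_continuous Complex.continuous_ofReal hstrip
    have hc2 : Continuous fun ξ : ℝ => |ξ| ^ υ :=
      continuous_abs.rpow_const fun _ => Or.inr hυ.le
    exact hc1.sub ((by fun_prop : Continuous fun ξ : ℝ => Complex.I * ((-μ * ξ : ℝ) : ℂ)).add
      (Complex.continuous_ofReal.comp (continuous_const.mul hc2)))
  obtain ⟨B, hB⟩ := (isCompact_Icc (a := -max R 1) (b := max R 1)).exists_bound_of_continuousOn
    hgc.continuousOn
  refine ⟨-μ, C, |B| + |A|, max υ₁ (υ / 2), hC, lt_max_of_lt_right (by positivity),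
    max_lt hυ₁ (by linarith), fun ξ => ?_⟩
  change ‖g ξ‖ ≤ _
  have hp : 0 ≤ |ξ| ^ max υ₁ (υ / 2) := by positivity
  rcases le_or_gt |ξ| (max R 1) with hξ | hξ
  · have := (hB ξ (abs_le.1 hξ)).trans (le_abs_self B)
    nlinarith [abs_nonneg A, abs_nonneg B]
  · have hm : ‖(ξ : ℂ)‖ = |ξ| := by rw [Complex.norm_real, Real.norm_eq_abs]
    have hx1 : 1 ≤ |ξ| := (le_max_right _ _).trans hξ.le
    have := hR (show R ≤ ‖(ξ : ℂ)‖ by rw [hm]; exact (le_max_left _ _).trans hξ.le) (hstrip ξ)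
    rw [← hgφ, hm, Real.norm_of_nonneg (by positivity)] at this
    have h5 : |ξ| ^ υ₁ ≤ |ξ| ^ max υ₁ (υ / 2) :=
      Real.rpow_le_rpow_of_exponent_le hx1 (le_max_left _ _)
    calc ‖g ξ‖ ≤ A * |ξ| ^ υ₁ := this
      _ ≤ |A| * |ξ| ^ max υ₁ (υ / 2) := by gcongr; exact le_abs_self A
      _ ≤ _ := by nlinarith [abs_nonneg A, abs_nonneg B]

/-- The law of `X_t` charges every neighbourhood of `+∞`. If it did not, `t ↦ Mt - X_t` would,
for the least possible `M`, be a process of the kind excluded by `false_of_oneSided`. -/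
theorem IsLevy.measure_gt_pos_of_asymptotics (hX : IsLevy X Q) (hψ : HasCharExponent X Q ψ)
    (hc : Continuous fun ξ : ℝ => ψ ξ) {m C D υ₁ : ℝ} (hC : 0 < C) (hυ₁ : 0 < υ₁) (hυ : υ₁ < υ)
    (hasym : ∀ ξ : ℝ,
      ‖ψ ξ - (Complex.I * ((m * ξ : ℝ) : ℂ) + ((C * |ξ| ^ υ : ℝ) : ℂ))‖ ≤ D * (1 + |ξ| ^ υ₁))
    {t : ℝ≥0} (ht : 0 < t) (b : ℝ) : 0 < Q {ω | b < X t ω} := by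
  by_contra hcon
  have hb : Q {ω | b < X t ω} = 0 := by simpa using hcon
  have hmeas : ∀ (s : ℝ≥0) (x : ℝ), MeasurableSet {ω | x < X s ω} := fun s x =>
    measurableSet_lt measurable_const (hX.measurable s)
  set S : Set ℝ := {x | Q {ω | x < X t ω} = 0} with hS
  have hSne : S.Nonempty := ⟨b, hb⟩
  have hSbdd : BddBelow S := by
    by_contra hnb
    rw [not_bddBelow_iff] at hnb
    have h0 : ∀ n : ℕ, Q {ω | -(n : ℝ) < X t ω} = 0 := by
      intro n
      obtain ⟨y, hy, hyn⟩ := hnb (-(n : ℝ))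
      refine measure_mono_null (fun ω hω => ?_) hy
      exact lt_trans hyn hω
    have h1 : Q Set.univ = 0 := by
      refine measure_mono_null (fun ω _ => ?_) (measure_iUnion_null h0)
      obtain ⟨n, hn⟩ := exists_nat_gt (-X t ω)
      exact Set.mem_iUnion.2 ⟨n, show -(n : ℝ) < X t ω by linarith⟩
    simp at h1
  set M := sInf S with hM
  have hMlow : ∀ δ : ℝ, 0 < δ → 0 < Q {ω | M - δ < X t ω} := by
    intro δ hδ
    rw [pos_iff_ne_zero]
    intro h0
    have := csInf_le hSbdd (show M - δ ∈ S from h0)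
    linarith
  have hM0 : Q {ω | M < X t ω} = 0 := by
    have h0 : ∀ n : ℕ, Q {ω | M + 1 / ((n : ℝ) + 1) < X t ω} = 0 := by
      intro n
      obtain ⟨y, hy, hyn⟩ := exists_lt_of_csInf_lt hSne
        (show sInf S < M + 1 / ((n : ℝ) + 1) by linarith [Nat.one_div_pos_of_nat (α := ℝ) (n := n)])
      exact measure_mono_null (fun ω hω => lt_trans hyn hω) hy
    refine measure_mono_null (fun ω hω => ?_) (measure_iUnion_null h0)
    obtain ⟨n, hn⟩ := exists_nat_one_div_lt (sub_pos.2 (show M < X t ω from hω))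
    exact Set.mem_iUnion.2 ⟨n, show M + 1 / ((n : ℝ) + 1) < X t ω by linarith⟩
  have hroot0 : ∀ n : ℕ, Q {ω | M / (n + 1) < X (t / (n + 1)) ω} = 0 := by
    intro n
    obtain ⟨Y, hYi, hYm, hYl, hYs⟩ := hX.exists_iid_sum t n
    have hYset : ∀ i, Q (Y i ⁻¹' Set.Ioi (M / (n + 1))) =
        Q {ω | M / (n + 1) < X (t / (n + 1)) ω} := by
      intro i
      rw [← Measure.map_apply (hYm i) measurableSet_Ioi, hYl i,
        Measure.map_apply (hX.measurable _) measurableSet_Ioi]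
      rfl
    have hprod := hYi.measure_inter_preimage_eq_mul Finset.univ
      (sets := fun _ => Set.Ioi (M / (n + 1))) (fun _ _ => measurableSet_Ioi)
    simp_rw [hYset] at hprod
    rw [Finset.prod_const, Finset.card_univ, Fintype.card_fin] at hprod
    have hzero : Q (⋂ i ∈ (Finset.univ : Finset (Fin (n + 1))),
        Y i ⁻¹' Set.Ioi (M / (n + 1))) = 0 := by
      have hae : ∀ᵐ ω ∂Q, ¬ M < X t ω := by
        rw [ae_iff]; simpa using hM0
      rw [← compl_compl (⋂ i ∈ (Finset.univ : Finset (Fin (n + 1))),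
        Y i ⁻¹' Set.Ioi (M / (n + 1)))]
      change _ ∈ ae Q
      filter_upwards [hae, hYs] with ω h1 h2 h3
      apply h1
      rw [h2]
      have h4 : ∀ i, M / (n + 1) < Y i ω := by simpa using h3
      calc M = ∑ _i : Fin (n + 1), M / (n + 1) := by
            rw [Finset.sum_const, Finset.card_univ, Fintype.card_fin, nsmul_eq_mul]
            push_cast; field_simp
        _ < _ := Finset.sum_lt_sum_of_nonempty Finset.univ_nonempty fun i _ => h4 i
    rw [hzero] at hprod
    exact pow_eq_zero_iff (Nat.succ_ne_zero n) |>.1 hprod.symm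
  let Z : ℕ → Ω → ℝ := fun n ω => M / (n + 1) - X (t / (n + 1)) ω
  have hZm : ∀ n, Measurable (Z n) := fun n => measurable_const.sub (hX.measurable _)
  let ρ : ℕ → Measure ℝ := fun n => Q.map (Z n)
  have : ∀ n, IsProbabilityMeasure (ρ n) := fun n =>
    Measure.isProbabilityMeasure_map (hZm n).aemeasurable
  have ht' : (0 : ℝ) < t := ht
  refine false_of_oneSided (ρ := ρ) (a := fun ξ => (t : ℝ) * ψ ((-ξ : ℝ) : ℂ) - Complex.I * (M * ξ))
    (d := -(t * m) - M) (C := t * C) (D := t * D) (υ := υ) (υ₁ := υ₁) ?_ ?_ ?_ (by positivity)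
    hυ₁ hυ ?_ ?_ ?_
  · intro n
    rw [ae_map_iff (hZm n).aemeasurable measurableSet_Ici, ae_iff]
    convert hroot0 n using 2
    ext ω
    simp [Z]
  · have : Continuous fun ξ : ℝ => ψ ((-ξ : ℝ) : ℂ) := hc.comp continuous_neg
    exact (continuous_const.mul this).sub (by fun_prop)
  · intro n ξ
    rw [charFun_apply_real, integral_map (hZm n).aemeasurable
      (Continuous.aestronglyMeasurable (by fun_prop))]
    have h1 := hψ (t / (n + 1)) (-ξ)
    have e : ∀ ω, Complex.exp (ξ * (Z n ω : ℂ) * Complex.I) =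
        Complex.exp (Complex.I * (M * ξ / (n + 1))) *
          Complex.exp (Complex.I * ((-ξ : ℝ) : ℂ) * (X (t / (n + 1)) ω : ℂ)) := by
      intro ω
      rw [← Complex.exp_add]
      simp only [Z]
      congr 1; push_cast; ring
    simp_rw [e]
    rw [integral_const_mul, h1, ← Complex.exp_add]
    congr 1
    push_cast
    ring
  · intro ξ hξ
    have h1 := hasym (-ξ)
    rw [abs_neg, abs_of_nonneg hξ] at h1
    have e : (t : ℝ) * ψ ((-ξ : ℝ) : ℂ) - Complex.I * (M * ξ) -
        (Complex.I * (((-(t * m) - M) * ξ : ℝ) : ℂ) + ((t * C * ξ ^ υ : ℝ) : ℂ)) =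
        ((t : ℝ) : ℂ) * (ψ ((-ξ : ℝ) : ℂ) -
          (Complex.I * ((m * -ξ : ℝ) : ℂ) + ((C * ξ ^ υ : ℝ) : ℂ))) := by
      push_cast; ring
    rw [e, norm_mul, Complex.norm_real, Real.norm_of_nonneg ht'.le, mul_assoc]
    gcongr
  · intro δ hδ
    rw [Measure.real, ENNReal.toReal_pos_iff]
    refine ⟨?_, measure_lt_top _ _⟩
    rw [Measure.map_apply (hZm 0) measurableSet_Iio]
    refine lt_of_lt_of_eq (hMlow δ hδ) (congrArg Q ?_)
    ext ω
    simp only [Set.mem_ofPred_eq, Set.mem_preimage, Set.mem_Iio, Z]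
    norm_num
    constructor <;> intro h <;> linarith
  · intro n l hl
    obtain ⟨Y, hYi, hYm, hYl, hYs⟩ := hX.exists_iid_sum t n
    have h1 := hYi.mgf_sum hYm Finset.univ (t := l)
    have h2 : ∀ i, mgf (Y i) Q l = mgf (X (t / (n + 1))) Q l := by
      intro i
      rw [← mgf_id_map (hYm i).aemeasurable, hYl i, mgf_id_map (hX.measurable _).aemeasurable]
    have h3 : mgf (X t) Q l = mgf (∑ i, Y i) Q l := by
      refine integral_congr_ae ?_
      filter_upwards [hYs] with ω hω
      simp [hω]
    simp_rw [h2] at h1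
    rw [Finset.prod_const, Finset.card_univ, Fintype.card_fin, ← h3] at h1
    have h4 : ∀ n : ℕ, ∫ y, Real.exp (-(l * y)) ∂(ρ n) =
        Real.exp (-(l * (M / (n + 1)))) * mgf (X (t / (n + 1))) Q l := by
      intro n
      rw [integral_map (hZm n).aemeasurable (Continuous.aestronglyMeasurable (by fun_prop)),
        mgf, ← integral_const_mul]
      congr 1; funext ω
      rw [← Real.exp_add]
      simp only [Z]; congr 1; ring
    have h5 : t / ((0 : ℕ) + 1) = t := by simp
    rw [h4, h4, h5, h1, mul_pow, ← Real.exp_nat_mul]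
    congr 2
    push_cast
    field_simp
    simp

lemma IsRLPEExponent.continuous_real (h : IsRLPEExponent ψ υ lm lp) (hlm : lm < 0)
    (hlp : 0 < lp) : Continuous fun ξ : ℝ => ψ ξ :=
  h.continuousOn.comp_continuous Complex.continuous_ofReal fun ξ => by simp [hlm.le, hlp.le]

/-- A Lévy process with a regular exponent takes arbitrarily large values at every positive time. -/
theorem IsLevy.measure_gt_pos (hX : IsLevy X Q) (hψ : HasCharExponent X Q ψ)
    (h : IsRLPEExponent ψ υ lm lp) (hυ : 0 < υ) (hlm : lm < 0) (hlp : 0 < lp)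
    {t : ℝ≥0} (ht : 0 < t) (b : ℝ) : 0 < Q {ω | b < X t ω} := by
  obtain ⟨m, C, D, υ₁, hC, h1, h2, h3⟩ := h.exists_real_asymptotics hυ hlm hlp
  exact hX.measure_gt_pos_of_asymptotics hψ (h.continuous_real hlm hlp) hC h1 h2 h3 ht b

/-- The counterpart of `IsLevy.measure_gt_pos` for `-∞`, by reflection of the process. -/
theorem IsLevy.measure_lt_pos (hX : IsLevy X Q) (hψ : HasCharExponent X Q ψ)
    (h : IsRLPEExponent ψ υ lm lp) (hυ : 0 < υ) (hlm : lm < 0) (hlp : 0 < lp)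
    {t : ℝ≥0} (ht : 0 < t) (b : ℝ) : 0 < Q {ω | X t ω < b} := by
  obtain ⟨m, C, D, υ₁, hC, h1, h2, h3⟩ := h.exists_real_asymptotics hυ hlm hlp
  have hc : Continuous fun ξ : ℝ => ψ (-(ξ : ℂ)) := by
    refine ((h.continuous_real hlm hlp).comp continuous_neg).congr fun ξ => ?_
    simp
  have := hX.neg.measure_gt_pos_of_asymptotics hψ.neg hc (m := -m) hC h1 h2
    (fun ξ => by simpa using h3 (-ξ)) ht (-b)
  simpa using this

end Levy

/-! ### Increments of the log-price -/

section Increments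

set_option linter.unusedSectionVars false

variable {Ω : Type*} [MeasurableSpace Ω] {Q : Measure Ω} [IsProbabilityMeasure Q]
  {X : ℝ≥0 → Ω → ℝ} {ψ : ℂ → ℂ} {υ lm lp : ℝ}

lemma IsLevy.charFun_map_sub (hX : IsLevy X Q) (hψ : HasCharExponent X Q ψ) {t u : ℝ≥0}
    (htu : t ≤ u) (ξ : ℝ) :
    charFun (Q.map fun ω => X u ω - X t ω) ξ =
      Complex.exp (-((((u : ℝ) - t : ℝ) : ℂ) * ψ ξ)) := by
  rw [hX.map_sub htu, hX.charFun_map hψ, NNReal.coe_sub htu]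

lemma IsLevy.integrable_exp_mul_sub (hX : IsLevy X Q) (hψ : HasCharExponent X Q ψ)
    (h : IsRLPEExponent ψ υ lm lp) (hυ : 0 < υ) (hlm : lm < 0) (hlp : 0 < lp)
    {t u : ℝ≥0} (htu : t < u) {θ : ℝ} (hθ : θ ∈ Set.Ioo (-lp) (-lm)) :
    Integrable (fun ω => Real.exp (θ * (X u ω - X t ω))) Q := by
  have := Measure.isProbabilityMeasure_map (μ := Q) (hX.measurable_sub t u).aemeasurable
  have h1 := integrable_exp_mul_of_exponent h hυ hlm hlp
    (show (0 : ℝ) < (u : ℝ) - t from sub_pos.2 htu) (hX.charFun_map_sub hψ htu.le) hθ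
  exact h1.comp_measurable (hX.measurable_sub t u)

lemma IsLevy.integral_cexp_mul_sub (hX : IsLevy X Q) (hψ : HasCharExponent X Q ψ)
    (h : IsRLPEExponent ψ υ lm lp) (hυ : 0 < υ) (hlm : lm < 0) (hlp : 0 < lp)
    {t u : ℝ≥0} (htu : t < u) {ξ : ℂ} (hξ : ξ.im ∈ Set.Ioo lm lp) :
    ∫ ω, Complex.exp (Complex.I * ξ * ((X u ω - X t ω : ℝ) : ℂ)) ∂Q =
      Complex.exp (-((((u : ℝ) - t : ℝ) : ℂ) * ψ ξ)) := by
  have := Measure.isProbabilityMeasure_map (μ := Q) (hX.measurable_sub t u).aemeasurable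
  have h1 := integral_exp_of_exponent h hυ hlm hlp
    (show (0 : ℝ) < (u : ℝ) - t from sub_pos.2 htu) (hX.charFun_map_sub hψ htu.le) hξ
  rwa [integral_map (hX.measurable_sub t u).aemeasurable
    (Continuous.aestronglyMeasurable (by fun_prop))] at h1

lemma IsLevy.integral_exp_sub (hX : IsLevy X Q) (hψ : HasCharExponent X Q ψ)
    (h : IsRLPEExponent ψ υ lm lp) (hυ : 0 < υ) (hlm : lm < -1) (hlp : 0 < lp) {r : ℝ}
    (hEMM : (r : ℂ) + ψ (-Complex.I) = 0) {t u : ℝ≥0} (htu : t < u) :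
    ∫ ω, Real.exp (X u ω - X t ω) ∂Q = Real.exp (r * ((u : ℝ) - t)) := by
  have h1 := hX.integral_cexp_mul_sub hψ h hυ (by linarith) hlp htu (ξ := -Complex.I)
    (by simp [hlm]; linarith)
  have h2 : ψ (-Complex.I) = -(r : ℂ) := by linear_combination hEMM
  rw [h2] at h1
  have h3 : ∀ ω, Complex.exp (Complex.I * -Complex.I * ((X u ω - X t ω : ℝ) : ℂ)) =
      ((Real.exp (X u ω - X t ω) : ℝ) : ℂ) := by
    intro ω
    rw [mul_neg, Complex.I_mul_I, neg_neg, one_mul, Complex.ofReal_exp]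
  simp_rw [h3] at h1
  rw [integral_complex_ofReal] at h1
  apply Complex.ofReal_injective
  rw [h1, Complex.ofReal_exp]
  congr 1
  push_cast; ring

lemma IsLevy.measure_sub_eq (hX : IsLevy X Q) (hψ : HasCharExponent X Q ψ)
    (h : IsRLPEExponent ψ υ lm lp) (hυ : 0 < υ) (hlm : lm < 0) (hlp : 0 < lp)
    {t u : ℝ≥0} (htu : t < u) (x : ℝ) : Q {ω | X u ω - X t ω = x} = 0 := by
  have := Measure.isProbabilityMeasure_map (μ := Q) (hX.measurable_sub t u).aemeasurable
  have h1 := measure_singleton_of_exponent h hυ hlm hlp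
    (show (0 : ℝ) < (u : ℝ) - t from sub_pos.2 htu) (hX.charFun_map_sub hψ htu.le) x
  rwa [Measure.map_apply (hX.measurable_sub t u) (measurableSet_singleton x)] at h1

lemma IsLevy.measure_sub_gt_pos (hX : IsLevy X Q) (hψ : HasCharExponent X Q ψ)
    (h : IsRLPEExponent ψ υ lm lp) (hυ : 0 < υ) (hlm : lm < 0) (hlp : 0 < lp)
    {t u : ℝ≥0} (htu : t < u) (b : ℝ) : 0 < Q {ω | b < X u ω - X t ω} := by
  have h1 := hX.measure_gt_pos hψ h hυ hlm hlp (tsub_pos_of_lt htu) b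
  have h2 := congrArg (fun μ => μ (Set.Ioi b)) (hX.map_sub htu.le)
  simp only [Measure.map_apply (hX.measurable_sub t u) measurableSet_Ioi,
    Measure.map_apply (hX.measurable _) measurableSet_Ioi] at h2
  exact h1.trans_eq h2.symm

lemma IsLevy.measure_sub_lt_pos (hX : IsLevy X Q) (hψ : HasCharExponent X Q ψ)
    (h : IsRLPEExponent ψ υ lm lp) (hυ : 0 < υ) (hlm : lm < 0) (hlp : 0 < lp)
    {t u : ℝ≥0} (htu : t < u) (b : ℝ) : 0 < Q {ω | X u ω - X t ω < b} := by
  have h1 := hX.measure_lt_pos hψ h hυ hlm hlp (tsub_pos_of_lt htu) b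
  have h2 := congrArg (fun μ => μ (Set.Iio b)) (hX.map_sub htu.le)
  simp only [Measure.map_apply (hX.measurable_sub t u) measurableSet_Iio,
    Measure.map_apply (hX.measurable _) measurableSet_Iio] at h2
  exact h1.trans_eq h2.symm

/-- The properties of the log-price at the dates `T_0 < ⋯ < T_N` on which the theory of the
compound option rests: independent increments with the martingale normalization, without atoms
and unbounded in both directions. -/
structure StockModel (X : ℝ≥0 → Ω → ℝ) (Q : Measure Ω) (r : ℝ) (T : ℕ → ℝ≥0) (N : ℕ) :
    Prop where
  measurable : ∀ t, Measurable (X t)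
  indep : iIndepFun (fun (k : Fin N) ω => X (T (k + 1)) ω - X (T k) ω) Q
  integrable_exp : ∀ j < N, Integrable (fun ω => Real.exp (X (T (j + 1)) ω - X (T j) ω)) Q
  integral_exp : ∀ j < N, ∫ ω, Real.exp (X (T (j + 1)) ω - X (T j) ω) ∂Q =
    Real.exp (r * ((T (j + 1) : ℝ) - T j))
  measure_eq : ∀ j < N, ∀ x, Q {ω | X (T (j + 1)) ω - X (T j) ω = x} = 0
  measure_gt_pos : ∀ j < N, ∀ x, 0 < Q {ω | x < X (T (j + 1)) ω - X (T j) ω}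
  measure_lt_pos : ∀ j < N, ∀ x, 0 < Q {ω | X (T (j + 1)) ω - X (T j) ω < x}

lemma monotone_comp_min {T : ℕ → ℝ≥0} {N : ℕ} (hT : ∀ j < N, T j < T (j + 1)) :
    Monotone fun n => T (min n N) := by
  refine monotone_nat_of_le_succ fun n => ?_
  rcases lt_or_ge n N with h | h
  · rw [min_eq_left h.le, min_eq_left (Nat.succ_le_of_lt h)]
    exact (hT n h).le
  · rw [min_eq_right h, min_eq_right (h.trans (Nat.le_succ n))]

lemma IsLevy.iIndepFun_sub (hX : IsLevy X Q) {T : ℕ → ℝ≥0} {N : ℕ}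
    (hT : ∀ j < N, T j < T (j + 1)) :
    iIndepFun (fun (k : Fin N) ω => X (T (k + 1)) ω - X (T k) ω) Q := by
  have := (hX.indep.nat (monotone_comp_min hT)).precomp (g := fun i : Fin N => (i : ℕ))
    Fin.val_injective
  convert! this using 4 with k ω
  · rw [min_eq_left (Nat.succ_le_of_lt k.2)]
  · rw [min_eq_left k.2.le]

lemma IsLevy.stockModel (hX : IsLevy X Q) (hψ : HasCharExponent X Q ψ)
    (h : IsRLPEExponent ψ υ lm lp) (hυ : 0 < υ) (hlm : lm < -1) (hlp : 0 < lp) {r : ℝ}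
    (hEMM : (r : ℂ) + ψ (-Complex.I) = 0) {T : ℕ → ℝ≥0} {N : ℕ}
    (hT : ∀ j < N, T j < T (j + 1)) : StockModel X Q r T N where
  measurable := hX.measurable
  indep := hX.iIndepFun_sub hT
  integrable_exp j hj := by
    simpa using hX.integrable_exp_mul_sub hψ h hυ (by linarith) hlp (hT j hj) (θ := 1)
      ⟨by linarith, by linarith⟩
  integral_exp j hj := hX.integral_exp_sub hψ h hυ hlm hlp hEMM (hT j hj)
  measure_eq j hj := hX.measure_sub_eq hψ h hυ (by linarith) hlp (hT j hj)
  measure_gt_pos j hj := hX.measure_sub_gt_pos hψ h hυ (by linarith) hlp (hT j hj)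
  measure_lt_pos j hj := hX.measure_sub_lt_pos hψ h hυ (by linarith) hlp (hT j hj)

variable {r : ℝ} {T : ℕ → ℝ≥0} {N : ℕ}

lemma StockModel.measurable_sub (M : StockModel X Q r T N) (t u : ℝ≥0) :
    Measurable fun ω => X u ω - X t ω := (M.measurable u).sub (M.measurable t)

/-- The path of the log-price up to `T_m` is independent of its next increment. -/
lemma StockModel.indepFun_path (M : StockModel X Q r T N) {m : ℕ} (hm : m < N) :
    IndepFun (fun ω (n : Fin (m + 1)) => X (T n) ω - X (T 0) ω)
      (fun ω => X (T (m + 1)) ω - X (T m) ω) Q := by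
  have h1 := M.indep.indepFun_finset (Finset.univ.filter fun k : Fin N => (k : ℕ) < m)
    {⟨m, hm⟩} (by simp) (fun k => M.measurable_sub _ _)
  have hlast : Measurable fun u : ({⟨m, hm⟩} : Finset (Fin N)) → ℝ =>
      u ⟨⟨m, hm⟩, by simp⟩ := measurable_pi_apply _
  have h2 := h1.comp
    (φ := fun (u : (Finset.univ.filter fun k : Fin N => (k : ℕ) < m) → ℝ) (n : Fin (m + 1)) =>
      ∑ k : (Finset.univ.filter fun k : Fin N => (k : ℕ) < m),
        if ((k : Fin N) : ℕ) < n then u k else 0)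
    (by
      refine measurable_pi_lambda _ fun n => Finset.measurable_fun_sum _ fun k _ => ?_
      split_ifs
      · exact measurable_pi_apply k
      · exact measurable_const)
    hlast
  convert! h2 using 1
  funext ω n
  simp only [Function.comp_apply]
  rw [← Finset.sum_range_sub (fun k => X (T k) ω) n]
  have hn := n.2
  rw [Finset.sum_coe_sort (Finset.univ.filter fun k : Fin N => (k : ℕ) < m)
    (fun k : Fin N => if (k : ℕ) < n then X (T (k + 1)) ω - X (T k) ω else 0),
    ← Finset.sum_filter, Finset.filter_filter]
  refine Finset.sum_bij' (fun k hk => ⟨k, by have := Finset.mem_range.1 hk; omega⟩)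
    (fun k _ => (k : ℕ)) ?_ ?_ ?_ ?_ ?_
  · intro k hk
    have := Finset.mem_range.1 hk
    simp; omega
  · intro k hk
    simp at hk
    simp [hk.2]
  · intro k hk; rfl
  · intro k hk; rfl
  · intro k hk; rfl

/-- Integration over an independent pair can be carried out one variable at a time. -/
lemma integral_indep_pair {A B : Type*} [MeasurableSpace A] [MeasurableSpace B]
    {U : Ω → A} {Z : Ω → B} (hUZ : IndepFun U Z Q) (hU : Measurable U) (hZ : Measurable Z)
    {f : A × B → ℝ} (hf : Measurable f) (hint : Integrable (fun ω => f (U ω, Z ω)) Q) :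
    ∫ ω, f (U ω, Z ω) ∂Q = ∫ ω, ∫ ω', f (U ω, Z ω') ∂Q ∂Q := by
  have hmap := (indepFun_iff_map_prod_eq_prod_map_map hU.aemeasurable hZ.aemeasurable).1 hUZ
  have := Measure.isProbabilityMeasure_map (μ := Q) hU.aemeasurable
  have := Measure.isProbabilityMeasure_map (μ := Q) hZ.aemeasurable
  have hint' : Integrable f ((Q.map U).prod (Q.map Z)) := by
    rw [← hmap]
    exact (integrable_map_measure hf.aestronglyMeasurable (hU.prodMk hZ).aemeasurable).2 hint
  have e1 : ∫ ω, f (U ω, Z ω) ∂Q = ∫ p, f p ∂((Q.map U).prod (Q.map Z)) := by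
    rw [← hmap, integral_map (hU.prodMk hZ).aemeasurable hf.aestronglyMeasurable]
  rw [e1, integral_prod _ hint', integral_map hU.aemeasurable]
  · refine integral_congr_ae (ae_of_all _ fun ω => ?_)
    exact integral_map hZ.aemeasurable (hf.comp measurable_prodMk_left).aestronglyMeasurable
  · exact hint'.integral_prod_left.aestronglyMeasurable

/-- Conditioning on one of two independent variables amounts to integrating out the other. -/
lemma condExp_indep_pair {A : Type*} [MeasurableSpace A]
    {U : Ω → A} {Z : Ω → ℝ} (hUZ : IndepFun U Z Q) (hU : Measurable U) (hZ : Measurable Z)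
    {f : A × ℝ → ℝ} (hf : StronglyMeasurable f) (hint : Integrable (fun ω => f (U ω, Z ω)) Q) :
    Q[fun ω => f (U ω, Z ω) | MeasurableSpace.comap U inferInstance]
      =ᵐ[Q] fun ω => ∫ ω', f (U ω, Z ω') ∂Q := by
  have := Measure.isProbabilityMeasure_map (μ := Q) hZ.aemeasurable
  have h1 : condDistrib Z U Q =ᵐ[Q.map U] Kernel.const A (Q.map Z) := by
    refine condDistrib_ae_eq_of_measure_eq_compProd U hZ.aemeasurable ?_
    rw [Measure.compProd_const,
      (indepFun_iff_map_prod_eq_prod_map_map hU.aemeasurable hZ.aemeasurable).1 hUZ]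
  refine (condExp_prod_ae_eq_integral_condDistrib hU hZ.aemeasurable hf hint).trans ?_
  filter_upwards [ae_of_ae_map hU.aemeasurable h1] with ω hω
  rw [hω, Kernel.const_apply]
  exact integral_map hZ.aemeasurable (hf.measurable.comp measurable_prodMk_left).aestronglyMeasurable

end Increments

/-! ### The value function: regularity and monotonicity -/

section ValueFunction

set_option linter.unusedSectionVars false

variable {Ω : Type*} [MeasurableSpace Ω] {Q : Measure Ω} [IsProbabilityMeasure Q]
  {X : ℝ≥0 → Ω → ℝ} {r : ℝ} {T : ℕ → ℝ≥0} {K w : ℕ → ℝ} {N : ℕ}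

lemma exerciseSign_succ {j : ℕ} (hj : j < N) :
    exerciseSign w N (j + 1) = w (j + 1) * exerciseSign w N (j + 2) := by
  rw [exerciseSign, exerciseSign, ← Finset.mul_prod_Ioc_eq_prod_Icc (by omega)]
  refine congrArg _ (Finset.prod_congr ?_ fun _ _ => rfl)
  ext; simp; omega

lemma exerciseSign_top : exerciseSign w N (N + 1) = 1 := by simp [exerciseSign]

lemma exerciseSign_eq (hw : ∀ j ∈ Finset.Icc 1 N, w j = 1 ∨ w j = -1) {j : ℕ} (hj : 1 ≤ j) :
    exerciseSign w N j = 1 ∨ exerciseSign w N j = -1 := by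
  unfold exerciseSign
  have : ∀ n ∈ Finset.Icc j N, w n = 1 ∨ w n = -1 := fun n hn =>
    hw n (Finset.mem_Icc.2 ⟨hj.trans (Finset.mem_Icc.1 hn).1, (Finset.mem_Icc.1 hn).2⟩)
  refine Finset.prod_induction _ (fun x : ℝ => x = 1 ∨ x = -1) ?_ (Or.inl rfl) this
  rintro a b (rfl | rfl) (rfl | rfl) <;> norm_num

lemma abs_eq_one_of_sign {x : ℝ} (h : x = 1 ∨ x = -1) : |x| = 1 := by
  rcases h with rfl | rfl <;> norm_num

lemma continuous_discountedPayoff (j : ℕ) : Continuous (discountedPayoff r T K w j) := by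
  unfold discountedPayoff; fun_prop

lemma abs_discountedPayoff_sub_le {j : ℕ} (hw : |w (j + 1)| = 1) (v v' : ℝ) :
    |discountedPayoff r T K w j v - discountedPayoff r T K w j v'| ≤
      Real.exp (-(r * ((T (j + 1) : ℝ) - T j))) * |v - v'| := by
  unfold discountedPayoff
  rw [← mul_sub, abs_mul, abs_of_pos (Real.exp_pos _)]
  refine mul_le_mul_of_nonneg_left ((abs_max_sub_max_le_abs _ _ _).trans ?_) (Real.exp_pos _).le
  rw [← mul_sub, abs_mul, hw, one_mul]
  simp

/-- A payoff of linear growth is integrable. -/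
lemma integrable_payoff {F : ℝ → ℝ} (hF : LipschitzWith 1 F) {j : ℕ} (hw : |w (j + 1)| = 1) {Z : Ω → ℝ}
    (hZm : Measurable Z) (hZ : Integrable (fun ω => Real.exp (Z ω)) Q) (s : ℝ) :
    Integrable (fun ω => discountedPayoff r T K w j (F (s * Real.exp (Z ω)))) Q := by
  have hm : Measurable fun ω => discountedPayoff r T K w j (F (s * Real.exp (Z ω))) :=
    (continuous_discountedPayoff j).measurable.comp
      (hF.continuous.measurable.comp (measurable_const.mul hZm.exp))
  have hb : Integrable (fun ω => |discountedPayoff r T K w j (F 0)| +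
      Real.exp (-(r * ((T (j + 1) : ℝ) - T j))) * (|s| * Real.exp (Z ω))) Q :=
    (integrable_const _).add ((hZ.const_mul _).const_mul _)
  refine hb.mono' hm.aestronglyMeasurable (ae_of_all _ fun ω => ?_)
  have h1 := abs_discountedPayoff_sub_le (r := r) (T := T) (K := K) hw
    (F (s * Real.exp (Z ω))) (F 0)
  have h2 := hF.dist_le_mul (s * Real.exp (Z ω)) 0
  rw [Real.dist_eq, Real.dist_eq, NNReal.coe_one, one_mul, sub_zero, abs_mul,
    abs_of_pos (Real.exp_pos _)] at h2
  have h3 := mul_le_mul_of_nonneg_left h2 (Real.exp_pos (-(r * ((T (j + 1) : ℝ) - T j)))).le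
  rw [Real.norm_eq_abs]
  have h4 := abs_sub_abs_le_abs_sub
    (discountedPayoff r T K w j (F (s * Real.exp (Z ω)))) (discountedPayoff r T K w j (F 0))
  linarith

/-- The value of a compound option is a `1`-Lipschitz function of the stock price. -/
lemma StockModel.lipschitzWith_value (M : StockModel X Q r T N)
    (hw : ∀ j ∈ Finset.Icc 1 N, w j = 1 ∨ w j = -1) (m j : ℕ) (hmj : j + m ≤ N) :
    LipschitzWith 1 (value X Q r T K w m j) := by
  induction m generalizing j with
  | zero => exact LipschitzWith.id
  | succ m ih =>
    have hF := ih (j + 1) (by omega)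
    have hj : j < N := by omega
    have hwj : |w (j + 1)| = 1 := abs_eq_one_of_sign (hw (j + 1) (by simp; omega))
    have hI := fun s => integrable_payoff (r := r) (T := T) (K := K) hF hwj (M.measurable_sub _ _)
      (M.integrable_exp j hj) s
    refine LipschitzWith.of_dist_le_mul fun s s' => ?_
    rw [Real.dist_eq, Real.dist_eq, NNReal.coe_one, one_mul]
    simp only [value]
    rw [← integral_sub (hI s) (hI s')]
    refine (abs_integral_le_integral_abs).trans ?_
    have hb : ∀ ω, |discountedPayoff r T K w j (value X Q r T K w m (j + 1)
          (s * Real.exp (X (T (j + 1)) ω - X (T j) ω))) -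
        discountedPayoff r T K w j (value X Q r T K w m (j + 1)
          (s' * Real.exp (X (T (j + 1)) ω - X (T j) ω)))| ≤
        Real.exp (-(r * ((T (j + 1) : ℝ) - T j))) *
          (|s - s'| * Real.exp (X (T (j + 1)) ω - X (T j) ω)) := by
      intro ω
      refine (abs_discountedPayoff_sub_le hwj _ _).trans ?_
      gcongr
      have := hF.dist_le_mul (s * Real.exp (X (T (j + 1)) ω - X (T j) ω))
        (s' * Real.exp (X (T (j + 1)) ω - X (T j) ω))
      rwa [Real.dist_eq, Real.dist_eq, NNReal.coe_one, one_mul, ← sub_mul, abs_mul,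
        abs_of_pos (Real.exp_pos _)] at this
    refine (integral_mono ((hI s).sub (hI s')).abs
      (((M.integrable_exp j hj).const_mul _).const_mul _) hb).trans ?_
    rw [integral_const_mul, integral_const_mul, M.integral_exp j hj, mul_left_comm, ← Real.exp_add]
    simp

lemma StockModel.integrable_value_payoff (M : StockModel X Q r T N)
    (hw : ∀ j ∈ Finset.Icc 1 N, w j = 1 ∨ w j = -1) {m j : ℕ} (hmj : j + 1 + m ≤ N) (s : ℝ) :
    Integrable (fun ω => discountedPayoff r T K w j (value X Q r T K w m (j + 1)
      (s * Real.exp (X (T (j + 1)) ω - X (T j) ω)))) Q :=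
  integrable_payoff (M.lipschitzWith_value hw m (j + 1) hmj)
    (abs_eq_one_of_sign (hw (j + 1) (by simp; omega))) (M.measurable_sub _ _)
    (M.integrable_exp j (by omega)) s

/-- The value is monotone in the stock price in the direction of the exercise sign. -/
lemma StockModel.exerciseSign_mul_value_le (M : StockModel X Q r T N)
    (hw : ∀ j ∈ Finset.Icc 1 N, w j = 1 ∨ w j = -1) (m j : ℕ) (hmj : j + m = N) {s s' : ℝ}
    (hs : s ≤ s') :
    exerciseSign w N (j + 1) * value X Q r T K w m j s ≤
      exerciseSign w N (j + 1) * value X Q r T K w m j s' := by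
  induction m generalizing j s s' with
  | zero =>
    obtain rfl : j = N := by omega
    simpa [exerciseSign_top, value] using hs
  | succ m ih =>
    have hj : j < N := by omega
    have hstep : ∀ ω, w (j + 1) * exerciseSign w N (j + 1) * value X Q r T K w m (j + 1)
          (s * Real.exp (X (T (j + 1)) ω - X (T j) ω)) ≤
        w (j + 1) * exerciseSign w N (j + 1) * value X Q r T K w m (j + 1)
          (s' * Real.exp (X (T (j + 1)) ω - X (T j) ω)) := by
      intro ω
      have := ih (j + 1) (by omega) (mul_le_mul_of_nonneg_right hs
        (Real.exp_pos (X (T (j + 1)) ω - X (T j) ω)).le)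
      have h2 : w (j + 1) * exerciseSign w N (j + 1) = exerciseSign w N (j + 1 + 1) := by
        rw [exerciseSign_succ hj, ← mul_assoc]
        rcases hw (j + 1) (by simp; omega) with h | h <;> rw [h] <;> norm_num
      rwa [h2]
    have hI := fun s => M.integrable_value_payoff (K := K) hw (m := m) (j := j) (by omega) s
    simp only [value]
    rcases exerciseSign_eq hw (j := j + 1) (by omega) with hv | hv
    · rw [hv] at hstep ⊢
      rw [one_mul, one_mul]
      refine integral_mono (hI s) (hI s') fun ω => ?_
      have := hstep ω
      rw [mul_one] at this
      refine mul_le_mul_of_nonneg_left (max_le_max_right _ ?_) (Real.exp_pos _).le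
      rw [mul_sub, mul_sub]
      linarith
    · rw [hv] at hstep ⊢
      rw [neg_one_mul, neg_one_mul, neg_le_neg_iff]
      refine integral_mono (hI s') (hI s) fun ω => ?_
      have := hstep ω
      refine mul_le_mul_of_nonneg_left (max_le_max_right _ ?_) (Real.exp_pos _).le
      rw [mul_sub, mul_sub]
      linarith

/-- `S` lists critical prices of the options at the levels `j, …, N`, where the option at level
`N` is written on the stock itself. -/
def IsCritical (X : ℝ≥0 → Ω → ℝ) (Q : Measure Ω) (r : ℝ) (T : ℕ → ℝ≥0) (K w : ℕ → ℝ) (N j : ℕ)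
    (S : ℕ → ℝ) : Prop :=
  ∀ n ∈ Finset.Icc j N, 0 < S n ∧ value X Q r T K w (N - n) n (S n) = K n

lemma IsCritical.mono {j j' : ℕ} {S : ℕ → ℝ} (hS : IsCritical X Q r T K w N j S) (h : j ≤ j') :
    IsCritical X Q r T K w N j' S := fun n hn =>
  hS n (Finset.mem_Icc.2 ⟨h.trans (Finset.mem_Icc.1 hn).1, (Finset.mem_Icc.1 hn).2⟩)

lemma integral_lt_integral_of_le_of_lt_on {f g : Ω → ℝ} (hf : Integrable f Q) (hg : Integrable g Q)
    (hle : ∀ ω, f ω ≤ g ω) {A : Set Ω} (hA : 0 < Q A) (hlt : ∀ ω ∈ A, f ω < g ω) :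
    ∫ ω, f ω ∂Q < ∫ ω, g ω ∂Q := by
  rw [← sub_pos, ← integral_sub hg hf,
    integral_pos_iff_support_of_nonneg (fun ω => sub_nonneg.2 (hle ω)) (hg.sub hf)]
  exact hA.trans_le (measure_mono fun ω hω => (sub_pos.2 (hlt ω hω)).ne')

/-- Strict monotonicity: by the unboundedness of the increments, the option is exercised with
positive probability, and there its payoff is strictly monotone. -/
lemma StockModel.exerciseSign_mul_value_lt (M : StockModel X Q r T N)
    (hw : ∀ j ∈ Finset.Icc 1 N, w j = 1 ∨ w j = -1) (m j : ℕ) (hmj : j + m = N) {S : ℕ → ℝ}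
    (hS : IsCritical X Q r T K w N (j + 1) S) {s s' : ℝ} (h0 : 0 < s) (hs : s < s') :
    exerciseSign w N (j + 1) * value X Q r T K w m j s <
      exerciseSign w N (j + 1) * value X Q r T K w m j s' := by
  induction m generalizing j s s' with
  | zero =>
    obtain rfl : j = N := by omega
    simpa [exerciseSign_top, value] using hs
  | succ m ih =>
    have hj : j < N := by omega
    obtain ⟨hSpos, hSval⟩ := hS (j + 1) (by simp; omega)
    rw [show N - (j + 1) = m by omega] at hSval
    have h2 : w (j + 1) * exerciseSign w N (j + 1) = exerciseSign w N (j + 1 + 1) := by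
      rw [exerciseSign_succ hj, ← mul_assoc]
      rcases hw (j + 1) (by simp; omega) with h | h <;> rw [h] <;> norm_num
    have hstep : ∀ {x x' : ℝ}, 0 < x → x < x' →
        w (j + 1) * exerciseSign w N (j + 1) * value X Q r T K w m (j + 1) x <
        w (j + 1) * exerciseSign w N (j + 1) * value X Q r T K w m (j + 1) x' := by
      intro x x' hx hxx
      rw [h2]
      exact ih (j + 1) (by omega) (hS.mono (by omega)) hx hxx
    have hweak : ∀ {x x' : ℝ}, x ≤ x' →
        w (j + 1) * exerciseSign w N (j + 1) * value X Q r T K w m (j + 1) x ≤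
        w (j + 1) * exerciseSign w N (j + 1) * value X Q r T K w m (j + 1) x' := by
      intro x x' hxx
      rw [h2]
      exact M.exerciseSign_mul_value_le hw m (j + 1) (by omega) hxx
    have hI := fun s => M.integrable_value_payoff (K := K) hw (m := m) (j := j) (by omega) s
    simp only [value]
    have hs' : 0 < s' := h0.trans hs
    have hE : ∀ ω, s * Real.exp (X (T (j + 1)) ω - X (T j) ω) <
        s' * Real.exp (X (T (j + 1)) ω - X (T j) ω) := fun ω => by gcongr
    rcases exerciseSign_eq hw (j := j + 1) (by omega) with hv | hv
    · rw [hv] at hstep hweak ⊢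
      simp only [mul_one] at hstep hweak
      rw [one_mul, one_mul]
      refine integral_lt_integral_of_le_of_lt_on (hI s) (hI s') (fun ω => ?_)
        (M.measure_gt_pos j hj (Real.log (S (j + 1) / s'))) fun ω hω => ?_
      · refine mul_le_mul_of_nonneg_left (max_le_max_right _ ?_) (Real.exp_pos _).le
        have := hweak (hE ω).le
        rw [mul_sub, mul_sub]; linarith
      · have hω' : S (j + 1) < s' * Real.exp (X (T (j + 1)) ω - X (T j) ω) := by
          rw [Set.mem_ofPred_eq, Real.log_lt_iff_lt_exp (by positivity), div_lt_iff₀ hs'] at hω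
          linarith
        have h3 := hstep hSpos hω'
        have h4 := hstep (mul_pos h0 (Real.exp_pos _)) (hE ω)
        rw [hSval] at h3
        refine mul_lt_mul_of_pos_left ?_ (Real.exp_pos _)
        rw [mul_sub, mul_sub]
        exact max_lt (lt_max_of_lt_left (by linarith)) (lt_max_of_lt_left (by linarith))
    · rw [hv] at hstep hweak ⊢
      rw [neg_one_mul, neg_one_mul, neg_lt_neg_iff]
      refine integral_lt_integral_of_le_of_lt_on (hI s') (hI s) (fun ω => ?_)
        (M.measure_lt_pos j hj (Real.log (S (j + 1) / s))) fun ω hω => ?_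
      · refine mul_le_mul_of_nonneg_left (max_le_max_right _ ?_) (Real.exp_pos _).le
        have := hweak (hE ω).le
        rw [mul_sub, mul_sub]; linarith
      · have hω' : s * Real.exp (X (T (j + 1)) ω - X (T j) ω) < S (j + 1) := by
          rw [Set.mem_ofPred_eq, Real.lt_log_iff_exp_lt (by positivity), lt_div_iff₀ h0] at hω
          linarith
        have h3 := hstep (mul_pos h0 (Real.exp_pos _)) hω'
        have h4 := hstep (mul_pos h0 (Real.exp_pos _)) (hE ω)
        rw [hSval] at h3
        refine mul_lt_mul_of_pos_left ?_ (Real.exp_pos _)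
        rw [mul_sub, mul_sub]
        exact max_lt (lt_max_of_lt_left (by linarith)) (lt_max_of_lt_left (by linarith))


lemma StockModel.value_injOn (M : StockModel X Q r T N)
    (hw : ∀ j ∈ Finset.Icc 1 N, w j = 1 ∨ w j = -1) (m j : ℕ) (hmj : j + m = N) {S : ℕ → ℝ}
    (hS : IsCritical X Q r T K w N (j + 1) S) {s s' : ℝ} (h0 : 0 < s) (h0' : 0 < s')
    (h : value X Q r T K w m j s = value X Q r T K w m j s') : s = s' := by
  rcases lt_trichotomy s s' with h1 | h1 | h1
  · have := M.exerciseSign_mul_value_lt hw m j hmj hS h0 h1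
    rw [h] at this; exact absurd this (lt_irrefl _)
  · exact h1
  · have := M.exerciseSign_mul_value_lt hw m j hmj hS h0' h1
    rw [h] at this; exact absurd this (lt_irrefl _)

/-- A compound call is worthless on a worthless stock and lags the stock by a bounded amount. -/
lemma StockModel.value_call (M : StockModel X Q r T N)
    (hK : ∀ j ∈ Finset.Icc 1 N, 0 < K j) (hw : ∀ j ∈ Finset.Icc 1 N, w j = 1 ∨ w j = -1)
    (m j : ℕ) (hmj : j + m = N) (hcall : ∀ n ∈ Finset.Icc (j + 1) N, w n = 1) :
    value X Q r T K w m j 0 = 0 ∧ ∃ c : ℝ, ∀ s : ℝ, s - c ≤ value X Q r T K w m j s := by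
  induction m generalizing j with
  | zero => exact ⟨rfl, 0, fun s => by simp [value]⟩
  | succ m ih =>
    have hj : j < N := by omega
    obtain ⟨h0, c, hc⟩ := ih (j + 1) (by omega) fun n hn =>
      hcall n (by simp at hn ⊢; omega)
    have hw1 : w (j + 1) = 1 := hcall (j + 1) (by simp; omega)
    constructor
    · simp only [value, zero_mul, h0]
      have : discountedPayoff r T K w j 0 = 0 := by
        have := hK (j + 1) (by simp; omega)
        rw [discountedPayoff, hw1, max_eq_right (by linarith), mul_zero]
      simp [this]
    · refine ⟨Real.exp (-(r * ((T (j + 1) : ℝ) - T j))) * (c + K (j + 1)), fun s => ?_⟩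
      simp only [value]
      have hint : Integrable (fun ω => Real.exp (-(r * ((T (j + 1) : ℝ) - T j))) *
          (s * Real.exp (X (T (j + 1)) ω - X (T j) ω) - (c + K (j + 1)))) Q :=
        (((M.integrable_exp j hj).const_mul s).sub (integrable_const _)).const_mul _
      calc s - Real.exp (-(r * ((T (j + 1) : ℝ) - T j))) * (c + K (j + 1))
          = ∫ ω, Real.exp (-(r * ((T (j + 1) : ℝ) - T j))) *
            (s * Real.exp (X (T (j + 1)) ω - X (T j) ω) - (c + K (j + 1))) ∂Q := by
            rw [integral_const_mul, integral_sub ((M.integrable_exp j hj).const_mul s)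
              (integrable_const _), integral_const_mul, M.integral_exp j hj, mul_sub
                (Real.exp _), mul_left_comm, ← Real.exp_add]
            simp
        _ ≤ _ := by
            refine integral_mono hint (M.integrable_value_payoff hw (by omega) s) fun ω => ?_
            refine mul_le_mul_of_nonneg_left (le_max_of_le_left ?_) (Real.exp_pos _).le
            rw [hw1, one_mul]
            linarith [hc (s * Real.exp (X (T (j + 1)) ω - X (T j) ω))]

/-- Critical prices of compound calls exist by the intermediate value theorem. -/
lemma StockModel.exists_critical_call (M : StockModel X Q r T N)
    (hK : ∀ j ∈ Finset.Icc 1 N, 0 < K j) (hw : ∀ j ∈ Finset.Icc 1 N, w j = 1 ∨ w j = -1)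
    {m j : ℕ} (hj : 1 ≤ j) (hmj : j + m = N) (hcall : ∀ n ∈ Finset.Icc (j + 1) N, w n = 1) :
    ∃ s : ℝ, 0 < s ∧ value X Q r T K w m j s = K j := by
  obtain ⟨h0, c, hc⟩ := M.value_call hK hw m j hmj hcall
  have hKj := hK j (by simp; omega)
  have hle : (0 : ℝ) ≤ |c| + K j := by positivity
  obtain ⟨s, hs, hsK⟩ := intermediate_value_Icc hle
    (M.lipschitzWith_value (K := K) hw m j (by omega)).continuous.continuousOn
    (show K j ∈ _ from ⟨by rw [h0]; exact hKj.le, by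
      linarith [hc (|c| + K j), le_abs_self c]⟩)
  refine ⟨s, lt_of_le_of_ne hs.1 ?_, hsK⟩
  rintro rfl
  rw [h0] at hsK
  exact hKj.ne hsK

theorem StockModel.existsUnique_critical_call (M : StockModel X Q r T N)
    (hK : ∀ j ∈ Finset.Icc 1 N, 0 < K j) (hw : ∀ j ∈ Finset.Icc 1 N, w j = 1 ∨ w j = -1)
    {j : ℕ} (hj : 1 ≤ j) (hjN : j ≤ N) (hcall : ∀ n ∈ Finset.Icc (j + 1) N, w n = 1) :
    ∃! s : ℝ, 0 < s ∧ value X Q r T K w (N - j) j s = K j := by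
  have hex : ∀ n : ℕ, ∃ s : ℝ, n ∈ Finset.Icc j N →
      0 < s ∧ value X Q r T K w (N - n) n s = K n := by
    intro n
    by_cases hn : n ∈ Finset.Icc j N
    · rw [Finset.mem_Icc] at hn
      obtain ⟨s, hs⟩ := M.exists_critical_call (m := N - n) hK hw (hj.trans hn.1) (by omega)
        fun k hk => hcall k (by simp at hk ⊢; omega)
      exact ⟨s, fun _ => hs⟩
    · exact ⟨0, fun h => absurd h hn⟩
  choose S hS using hex
  have hcrit : IsCritical X Q r T K w N j S := fun n hn => hS n hn
  have hSj := hS j (by simp; omega)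
  refine ⟨S j, hSj, fun s hs => ?_⟩
  exact M.value_injOn hw (N - j) j (by omega) (hcrit.mono (Nat.le_succ j)) hs.1 hSj.1
    (hs.2.trans hSj.2.symm)

/-- The price is the conditional expectation of the discounted payoff. -/
theorem condExp_discountedPayoff (M : StockModel X Q r T N) (hX : IsLevy X Q)
    (hw : ∀ j ∈ Finset.Icc 1 N, w j = 1 ∨ w j = -1) {m j : ℕ} (hmj : j + 1 + m ≤ N)
    (hT : T j ≤ T (j + 1))
    (hint : Integrable (fun ω => Real.exp (X (T (j + 1)) ω)) Q) :
    Integrable (fun ω => discountedPayoff r T K w j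
        (value X Q r T K w m (j + 1) (Real.exp (X (T (j + 1)) ω)))) Q ∧
      Q[fun ω => discountedPayoff r T K w j
        (value X Q r T K w m (j + 1) (Real.exp (X (T (j + 1)) ω)))
        | MeasurableSpace.comap (X (T j)) inferInstance]
      =ᵐ[Q] fun ω => value X Q r T K w (m + 1) j (Real.exp (X (T j) ω)) := by
  have hL := M.lipschitzWith_value (K := K) hw m (j + 1) hmj
  have h1 := integrable_payoff (r := r) (T := T) (K := K) hL
    (abs_eq_one_of_sign (hw (j + 1) (by simp; omega))) (hX.measurable _) hint 1
  simp only [one_mul] at h1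
  refine ⟨h1, ?_⟩
  have hind := hX.indep.indepFun_eval_sub (zero_le : 0 ≤ T j) hT hX.zero
  have e : ∀ ω, X (T (j + 1)) ω = X (T j) ω + (X (T (j + 1)) - X (T j)) ω := fun ω => by simp
  have hf : StronglyMeasurable fun p : ℝ × ℝ => discountedPayoff r T K w j
      (value X Q r T K w m (j + 1) (Real.exp (p.1 + p.2))) :=
    (((continuous_discountedPayoff j).comp (hL.continuous.comp
      (Real.continuous_exp.comp (continuous_fst.add continuous_snd))))).stronglyMeasurable
  have h2 := condExp_indep_pair hind (hX.measurable _)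
    ((hX.measurable _).sub (hX.measurable _)) hf (by simpa using h1)
  simp only [← e] at h2
  refine h2.trans (ae_of_all _ fun ω => ?_)
  simp only [value, Real.exp_add, Pi.sub_apply]

end ValueFunction

/-! ### Differentiability of the value and decomposition of the payoff -/

section Unrolling

set_option linter.unusedSectionVars false

variable {Ω : Type*} [MeasurableSpace Ω] {Q : Measure Ω} [IsProbabilityMeasure Q]
  {X : ℝ≥0 → Ω → ℝ} {r : ℝ} {T : ℕ → ℝ≥0} {K w : ℕ → ℝ} {N : ℕ}

/-- The option is exercised exactly beyond the critical price, on the side given by the exercise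
sign. -/
lemma StockModel.discountedPayoff_value (M : StockModel X Q r T N)
    (hw : ∀ j ∈ Finset.Icc 1 N, w j = 1 ∨ w j = -1) {m j : ℕ} (hmj : j + 1 + m = N) {S : ℕ → ℝ}
    (hS : IsCritical X Q r T K w N (j + 1) S) (x : ℝ) :
    discountedPayoff r T K w j (value X Q r T K w m (j + 1) x) =
      if exerciseSign w N (j + 1) * S (j + 1) ≤ exerciseSign w N (j + 1) * x then
        Real.exp (-(r * ((T (j + 1) : ℝ) - T j))) *
          (w (j + 1) * (value X Q r T K w m (j + 1) x - K (j + 1))) else 0 := by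
  have hj : j < N := by omega
  obtain ⟨hSpos, hSval⟩ := hS (j + 1) (by simp; omega)
  rw [show N - (j + 1) = m by omega] at hSval
  have h2 : w (j + 1) * exerciseSign w N (j + 1) = exerciseSign w N (j + 1 + 1) := by
    rw [exerciseSign_succ hj, ← mul_assoc]
    rcases hw (j + 1) (by simp; omega) with h | h <;> rw [h] <;> norm_num
  have hweak : ∀ {x x' : ℝ}, x ≤ x' →
      w (j + 1) * exerciseSign w N (j + 1) * value X Q r T K w m (j + 1) x ≤
      w (j + 1) * exerciseSign w N (j + 1) * value X Q r T K w m (j + 1) x' := by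
    intro x x' hxx
    rw [h2]
    exact M.exerciseSign_mul_value_le hw m (j + 1) (by omega) hxx
  unfold discountedPayoff
  rcases exerciseSign_eq hw (j := j + 1) (by omega) with hv | hv
  · rw [hv] at hweak ⊢
    simp only [mul_one, one_mul] at hweak ⊢
    split_ifs with hc
    · have := hweak hc
      rw [hSval] at this
      rw [max_eq_left (by rw [mul_sub]; linarith)]
    · have := hweak (not_le.1 hc).le
      rw [hSval] at this
      rw [max_eq_right (by rw [mul_sub]; linarith), mul_zero]
  · rw [hv] at hweak ⊢
    simp only [neg_one_mul, neg_le_neg_iff] at hweak ⊢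
    split_ifs with hc
    · have := hweak hc
      rw [hSval] at this
      rw [max_eq_left (by rw [mul_sub]; linarith)]
    · have := hweak (not_le.1 hc).le
      rw [hSval] at this
      rw [max_eq_right (by rw [mul_sub]; linarith), mul_zero]

/-- Differentiation under the expectation. The payoff is Lipschitz, and it is differentiable
except at the critical price, which is attained with probability zero. -/
lemma StockModel.hasDerivAt_value_succ (M : StockModel X Q r T N)
    (hw : ∀ j ∈ Finset.Icc 1 N, w j = 1 ∨ w j = -1) {m j : ℕ} (hmj : j + 1 + m = N) {S : ℕ → ℝ}
    (hS : IsCritical X Q r T K w N (j + 1) S) {s : ℝ} (hs : 0 < s)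
    (hd : ∀ x, 0 < x → DifferentiableAt ℝ (value X Q r T K w m (j + 1)) x) :
    HasDerivAt (value X Q r T K w (m + 1) j)
      (∫ ω, (if exerciseSign w N (j + 1) * S (j + 1) ≤
          exerciseSign w N (j + 1) * (s * Real.exp (X (T (j + 1)) ω - X (T j) ω)) then
        Real.exp (-(r * ((T (j + 1) : ℝ) - T j))) * w (j + 1) *
          (Real.exp (X (T (j + 1)) ω - X (T j) ω) * deriv (value X Q r T K w m (j + 1))
            (s * Real.exp (X (T (j + 1)) ω - X (T j) ω))) else 0) ∂Q) s := by
  have hj : j < N := by omega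
  have hwj : |w (j + 1)| = 1 := abs_eq_one_of_sign (hw (j + 1) (by simp; omega))
  have hF := M.lipschitzWith_value (K := K) hw m (j + 1) (by omega)
  obtain ⟨hSpos, -⟩ := hS (j + 1) (by simp; omega)
  have hv := abs_eq_one_of_sign (exerciseSign_eq hw (j := j + 1) (by omega))
  set v := exerciseSign w N (j + 1) with hvdef
  have hv0 : v ≠ 0 := fun h => by rw [h] at hv; norm_num at hv
  set Z : Ω → ℝ := fun ω => X (T (j + 1)) ω - X (T j) ω with hZ
  have hZm : Measurable Z := M.measurable_sub _ _
  have hI := fun s => M.integrable_value_payoff (K := K) hw (m := m) (j := j) (by omega) s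
  refine (hasDerivAt_integral_of_dominated_loc_of_lip (s := Set.univ)
    (F := fun s ω => discountedPayoff r T K w j
      (value X Q r T K w m (j + 1) (s * Real.exp (Z ω))))
    (bound := fun ω => Real.exp (-(r * ((T (j + 1) : ℝ) - T j))) * Real.exp (Z ω))
    Filter.univ_mem (Eventually.of_forall fun s => (hI s).1) (hI s) ?_ ?_
    ((M.integrable_exp j hj).const_mul _) ?_).2
  · refine Measurable.aestronglyMeasurable (Measurable.ite ?_ ?_ measurable_const)
    · exact measurableSet_le measurable_const (measurable_const.mul (hZm.exp.const_mul s))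
    · exact measurable_const.mul
        (hZm.exp.mul ((measurable_deriv _).comp (hZm.exp.const_mul s)))
  · refine ae_of_all _ fun ω => LipschitzOnWith.of_dist_le_mul fun x _ y _ => ?_
    rw [Real.dist_eq, Real.dist_eq, Real.coe_nnabs, abs_mul, abs_of_pos (Real.exp_pos _),
      abs_of_pos (Real.exp_pos _)]
    refine (abs_discountedPayoff_sub_le hwj _ _).trans ?_
    rw [mul_assoc]
    gcongr
    have := hF.dist_le_mul (x * Real.exp (Z ω)) (y * Real.exp (Z ω))
    rwa [Real.dist_eq, Real.dist_eq, NNReal.coe_one, one_mul, ← sub_mul, abs_mul,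
      abs_of_pos (Real.exp_pos _), mul_comm |x - y|] at this
  · have hne : ∀ᵐ ω ∂Q, Z ω ≠ Real.log (S (j + 1) / s) := by
      rw [ae_iff]; simpa using M.measure_eq j hj (Real.log (S (j + 1) / s))
    filter_upwards [hne] with ω hω
    have hne' : v * S (j + 1) ≠ v * (s * Real.exp (Z ω)) := by
      intro h
      have h1 := mul_left_cancel₀ hv0 h
      apply hω
      rw [h1, mul_div_cancel_left₀ _ hs.ne', Real.log_exp]
    have hcont : ContinuousAt (fun x : ℝ => v * (x * Real.exp (Z ω))) s := by fun_prop
    rcases lt_or_gt_of_ne hne' with hlt | hlt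
    · rw [if_pos hlt.le]
      have heq : (fun x => discountedPayoff r T K w j
          (value X Q r T K w m (j + 1) (x * Real.exp (Z ω)))) =ᶠ[𝓝 s] fun x =>
          Real.exp (-(r * ((T (j + 1) : ℝ) - T j))) *
          (w (j + 1) * (value X Q r T K w m (j + 1) (x * Real.exp (Z ω)) - K (j + 1))) := by
        filter_upwards [hcont.eventually (lt_mem_nhds hlt)] with x hx
        rw [M.discountedPayoff_value hw hmj hS, if_pos hx.le]
      refine HasDerivAt.congr_of_eventuallyEq ?_ heq
      have h1 := (hd (s * Real.exp (Z ω)) (mul_pos hs (Real.exp_pos _))).hasDerivAt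
      have h2 := (((h1.comp s ((hasDerivAt_id s).mul_const (Real.exp (Z ω)))).sub_const
        (K (j + 1))).const_mul (w (j + 1))).const_mul (Real.exp (-(r * ((T (j + 1) : ℝ) - T j))))
      refine h2.congr_deriv ?_
      ring
    · rw [if_neg (not_le.2 hlt)]
      have heq : (fun x => discountedPayoff r T K w j
          (value X Q r T K w m (j + 1) (x * Real.exp (Z ω)))) =ᶠ[𝓝 s] fun _ => 0 := by
        filter_upwards [hcont.eventually (gt_mem_nhds hlt)] with x hx
        rw [M.discountedPayoff_value hw hmj hS,
          if_neg (not_le.2 hx)]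
      exact (hasDerivAt_const s (0 : ℝ)).congr_of_eventuallyEq heq

lemma StockModel.differentiableAt_value (M : StockModel X Q r T N)
    (hw : ∀ j ∈ Finset.Icc 1 N, w j = 1 ∨ w j = -1) (m j : ℕ) (hmj : j + m = N) {S : ℕ → ℝ}
    (hS : IsCritical X Q r T K w N (j + 1) S) {s : ℝ} (hs : 0 < s) :
    DifferentiableAt ℝ (value X Q r T K w m j) s := by
  induction m generalizing j s with
  | zero => exact differentiableAt_id
  | succ m ih =>
    exact (M.hasDerivAt_value_succ hw (by omega) hS hs fun x hx =>
      ih (j + 1) (by omega) (hS.mono (by omega)) hx).differentiableAt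

lemma StockModel.abs_deriv_value_le (M : StockModel X Q r T N)
    (hw : ∀ j ∈ Finset.Icc 1 N, w j = 1 ∨ w j = -1) (m j : ℕ) (hmj : j + m ≤ N) (s : ℝ) :
    |deriv (value X Q r T K w m j) s| ≤ 1 := by
  simpa using norm_deriv_le_of_lipschitz (M.lipschitzWith_value (K := K) hw m j hmj) (x₀ := s)

lemma StockModel.integrable_exp_path (M : StockModel X Q r T N) {n : ℕ} (hn : n ≤ N) :
    Integrable (fun ω => Real.exp (X (T n) ω - X (T 0) ω)) Q := by
  induction n with
  | zero => simp
  | succ n ih =>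
    have hi := (M.indepFun_path (m := n) (by omega)).comp
      (φ := fun u : Fin (n + 1) → ℝ => Real.exp (u (Fin.last n))) (ψ := Real.exp)
      (measurable_pi_apply (Fin.last n)).exp Real.measurable_exp
    have := hi.integrable_mul (ih (by omega)) (M.integrable_exp n (by omega))
    refine this.congr (ae_of_all _ fun ω => ?_)
    simp only [Pi.mul_apply, Function.comp_apply, Fin.val_last]
    rw [← Real.exp_add]; congr 1; ring

/-- The set of log-price paths along which the options at the levels `1, …, m` are exercised. -/
def pathEvent (w S : ℕ → ℝ) (N : ℕ) (s : ℝ) (m : ℕ) : Set (Fin (m + 1) → ℝ) :=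
  {u | ∀ n : Fin (m + 1), 1 ≤ (n : ℕ) →
    exerciseSign w N n * S n ≤ exerciseSign w N n * (s * Real.exp (u n))}

lemma measurableSet_pathEvent (w S : ℕ → ℝ) (N : ℕ) (s : ℝ) (m : ℕ) :
    MeasurableSet (pathEvent w S N s m) := by
  have : pathEvent w S N s m = ⋂ n : Fin (m + 1), ⋂ _ : 1 ≤ (n : ℕ), {u |
      exerciseSign w N n * S n ≤ exerciseSign w N n * (s * Real.exp (u n))} := by
    ext u; simp [pathEvent]
  rw [this]
  refine MeasurableSet.iInter fun n => MeasurableSet.iInter fun _ => ?_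
  exact measurableSet_le measurable_const
    (((measurable_pi_apply n).exp.const_mul s).const_mul _)

lemma mem_exerciseEvent_iff {S : ℕ → ℝ} {s : ℝ} {m : ℕ} {ω : Ω} :
    ω ∈ exerciseEvent X T w S N s m ↔
      (fun n : Fin (m + 1) => X (T n) ω - X (T 0) ω) ∈ pathEvent w S N s m := by
  constructor
  · intro h n hn
    exact h n (Finset.mem_Icc.2 ⟨hn, Nat.lt_succ_iff.1 n.2⟩)
  · intro h n hn
    rw [Finset.mem_Icc] at hn
    exact h ⟨n, by omega⟩ hn.1

lemma mem_exerciseEvent_succ {S : ℕ → ℝ} {s : ℝ} {m : ℕ} {ω : Ω} :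
    ω ∈ exerciseEvent X T w S N s (m + 1) ↔ ω ∈ exerciseEvent X T w S N s m ∧
      exerciseSign w N (m + 1) * S (m + 1) ≤
        exerciseSign w N (m + 1) * stockAt X T s (m + 1) ω := by
  constructor
  · intro h
    exact ⟨fun n hn => h n (by simp at hn ⊢; omega), h (m + 1) (by simp)⟩
  · rintro ⟨h1, h2⟩ n hn
    rw [Finset.mem_Icc] at hn
    rcases hn.2.eq_or_lt with rfl | h
    · exact h2
    · exact h1 n (Finset.mem_Icc.2 ⟨hn.1, by omega⟩)

lemma StockModel.measurableSet_exerciseEvent (M : StockModel X Q r T N) (w S : ℕ → ℝ) (s : ℝ)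
    (m : ℕ) : MeasurableSet (exerciseEvent X T w S N s m) := by
  have : exerciseEvent X T w S N s m = (fun ω (n : Fin (m + 1)) => X (T n) ω - X (T 0) ω) ⁻¹'
      pathEvent w S N s m := by
    ext ω; exact mem_exerciseEvent_iff
  rw [this]
  exact (measurable_pi_lambda _ fun n => M.measurable_sub _ _) (measurableSet_pathEvent w S N s m)

/-- One step of backward induction, weighted with a function `g` of the log-price at `T_m` on the
event that the options at the levels `1, …, m` are exercised. -/
lemma StockModel.integral_step (M : StockModel X Q r T N) {m : ℕ} (hm : m < N) (S : ℕ → ℝ)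
    (s : ℝ) {g : ℝ → ℝ} (hg : Measurable g) {h : ℝ × ℝ → ℝ} (hh : Measurable h)
    (hint : Integrable (fun ω => g (X (T m) ω - X (T 0) ω) *
      h (stockAt X T s m ω, X (T (m + 1)) ω - X (T m) ω)) Q) :
    ∫ ω, (exerciseEvent X T w S N s m).indicator (fun ω => g (X (T m) ω - X (T 0) ω) *
        ∫ ω', h (stockAt X T s m ω, X (T (m + 1)) ω' - X (T m) ω') ∂Q) ω ∂Q =
      ∫ ω, (exerciseEvent X T w S N s m).indicator (fun ω => g (X (T m) ω - X (T 0) ω) *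
        h (stockAt X T s m ω, X (T (m + 1)) ω - X (T m) ω)) ω ∂Q := by
  classical
  set φ : (Fin (m + 1) → ℝ) → ℝ :=
    (pathEvent w S N s m).indicator fun u => g (u (Fin.last m)) with hφ
  have hφm : Measurable φ :=
    (hg.comp (measurable_pi_apply _)).indicator (measurableSet_pathEvent w S N s m)
  have e : ∀ (ω : Ω) (y : Ω → ℝ), (exerciseEvent X T w S N s m).indicator
      (fun ω => g (X (T m) ω - X (T 0) ω) * y ω) ω =
      φ (fun n : Fin (m + 1) => X (T n) ω - X (T 0) ω) * y ω := by
    intro ω y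
    by_cases hω : ω ∈ exerciseEvent X T w S N s m
    · rw [Set.indicator_of_mem hω, hφ, Set.indicator_of_mem (mem_exerciseEvent_iff.1 hω)]
      rfl
    · rw [Set.indicator_of_notMem hω, hφ,
        Set.indicator_of_notMem (fun h => hω (mem_exerciseEvent_iff.2 h)), zero_mul]
  have hf : Measurable fun p : (Fin (m + 1) → ℝ) × ℝ =>
      φ p.1 * h (s * Real.exp (p.1 (Fin.last m)), p.2) :=
    (hφm.comp measurable_fst).mul (hh.comp
      ((((measurable_pi_apply (Fin.last m)).comp measurable_fst).exp.const_mul s).prodMk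
        measurable_snd))
  have hint' := hint.indicator (M.measurableSet_exerciseEvent w S s m)
  simp_rw [e] at hint' ⊢
  have key := integral_indep_pair (M.indepFun_path hm)
    (measurable_pi_lambda _ fun n => M.measurable_sub _ _) (M.measurable_sub _ _) hf
    (by exact hint'.congr (ae_of_all _ fun ω => e ω _))
  simp only [integral_const_mul] at key
  exact key.symm

/-- The accumulated discount factor and sign of the level `m`. -/
def discountSign (r : ℝ) (T : ℕ → ℝ≥0) (w : ℕ → ℝ) (m : ℕ) : ℝ :=
  Real.exp (-(r * ((T m : ℝ) - T 0))) * ∏ n ∈ Finset.Icc 1 m, w n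

lemma discountSign_zero : discountSign r T w 0 = 1 := by simp [discountSign]

lemma discountSign_succ (m : ℕ) : discountSign r T w (m + 1) =
    discountSign r T w m * (Real.exp (-(r * ((T (m + 1) : ℝ) - T m))) * w (m + 1)) := by
  rw [discountSign, discountSign, Finset.prod_Icc_succ_top (by omega)]
  have : Real.exp (-(r * ((T (m + 1) : ℝ) - T 0))) = Real.exp (-(r * ((T m : ℝ) - T 0))) *
      Real.exp (-(r * ((T (m + 1) : ℝ) - T m))) := by
    rw [← Real.exp_add]; congr 1; ring
  rw [this]; ring

lemma stockAt_succ (s : ℝ) (m : ℕ) (ω : Ω) : stockAt X T s (m + 1) ω =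
    stockAt X T s m ω * Real.exp (X (T (m + 1)) ω - X (T m) ω) := by
  rw [stockAt, stockAt, mul_assoc, ← Real.exp_add]; congr 2; ring

lemma StockModel.measurable_stockAt (M : StockModel X Q r T N) (s : ℝ) (m : ℕ) :
    Measurable (stockAt X T s m) := (M.measurable_sub _ _).exp.const_mul s

lemma StockModel.integrable_stockAt (M : StockModel X Q r T N) (s : ℝ) {m : ℕ} (hm : m ≤ N) :
    Integrable (stockAt X T s m) Q := (M.integrable_exp_path hm).const_mul s

lemma exerciseEvent_zero (S : ℕ → ℝ) (s : ℝ) : exerciseEvent X T w S N s 0 = Set.univ := by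
  ext ω; simp [exerciseEvent]

lemma StockModel.integrable_value_stockAt (M : StockModel X Q r T N)
    (hw : ∀ j ∈ Finset.Icc 1 N, w j = 1 ∨ w j = -1) (s : ℝ) {m n j : ℕ} (hn : n ≤ N)
    (hmj : j + m ≤ N) : Integrable (fun ω => value X Q r T K w m j (stockAt X T s n ω)) Q := by
  have hF := M.lipschitzWith_value (K := K) hw m j hmj
  refine ((M.integrable_stockAt s hn).abs.add (integrable_const |value X Q r T K w m j 0|)).mono'
    (hF.continuous.measurable.comp (M.measurable_stockAt s n)).aestronglyMeasurable
    (ae_of_all _ fun ω => ?_)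
  have h1 := hF.dist_le_mul (stockAt X T s n ω) 0
  rw [Real.dist_eq, Real.dist_eq, NNReal.coe_one, one_mul, sub_zero] at h1
  have h2 := abs_sub_abs_le_abs_sub (value X Q r T K w m j (stockAt X T s n ω))
    (value X Q r T K w m j 0)
  rw [Real.norm_eq_abs]
  simp only [Pi.add_apply]
  linarith

/-- Forward unrolling of the recursion for the value: the paths on which the first `m` options are
exercised contribute the value of the remaining option, minus the strikes paid. -/
theorem StockModel.value_unroll (M : StockModel X Q r T N)
    (hw : ∀ j ∈ Finset.Icc 1 N, w j = 1 ∨ w j = -1) {S : ℕ → ℝ}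
    (hS : IsCritical X Q r T K w N 1 S) (s : ℝ) (m : ℕ) (hm : m ≤ N) :
    value X Q r T K w N 0 s = discountSign r T w m *
        (∫ ω, (exerciseEvent X T w S N s m).indicator
          (fun ω => value X Q r T K w (N - m) m (stockAt X T s m ω)) ω ∂Q) -
      ∑ j ∈ Finset.Icc 1 m, discountSign r T w j *
        (K j * Q.real (exerciseEvent X T w S N s j)) := by
  induction m with
  | zero => simp [discountSign_zero, exerciseEvent_zero, stockAt]
  | succ m ih =>
    obtain ⟨k, hk⟩ : ∃ k, N = m + 1 + k := ⟨N - (m + 1), by omega⟩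
    have hS' : IsCritical X Q r T K w N (m + 1) S := hS.mono (by omega)
    have hL := M.lipschitzWith_value (K := K) hw k (m + 1) (by omega)
    have hE := fun m => M.measurableSet_exerciseEvent w S s m
    have hstep := M.integral_step (w := w) (m := m) (by omega) S s (g := fun _ => 1) measurable_const
      (h := fun p => discountedPayoff r T K w m
        (value X Q r T K w k (m + 1) (p.1 * Real.exp p.2)))
      ((continuous_discountedPayoff m).comp (hL.continuous.comp (by fun_prop))).measurable (by
        simp only [one_mul, ← stockAt_succ]
        exact integrable_payoff hL (abs_eq_one_of_sign (hw (m + 1) (by simp; omega)))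
          (M.measurable_sub _ _) (M.integrable_exp_path (by omega)) s)
    simp only [one_mul, ← stockAt_succ] at hstep
    have hval : ∀ x, ∫ ω', discountedPayoff r T K w m (value X Q r T K w k (m + 1)
        (x * Real.exp (X (T (m + 1)) ω' - X (T m) ω'))) ∂Q = value X Q r T K w (N - m) m x := by
      intro x
      rw [show N - m = k + 1 by omega]; rfl
    simp_rw [hval] at hstep
    have hpt : ∀ ω, (exerciseEvent X T w S N s m).indicator (fun ω =>
          discountedPayoff r T K w m (value X Q r T K w k (m + 1) (stockAt X T s (m + 1) ω))) ω =
        (Real.exp (-(r * ((T (m + 1) : ℝ) - T m))) * w (m + 1)) *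
          ((exerciseEvent X T w S N s (m + 1)).indicator (fun ω =>
            value X Q r T K w (N - (m + 1)) (m + 1) (stockAt X T s (m + 1) ω)) ω -
          (exerciseEvent X T w S N s (m + 1)).indicator (fun _ => K (m + 1)) ω) := by
      intro ω
      rw [show N - (m + 1) = k by omega]
      by_cases h1 : ω ∈ exerciseEvent X T w S N s m
      · rw [Set.indicator_of_mem h1, M.discountedPayoff_value hw (by omega) hS']
        by_cases h2 : ω ∈ exerciseEvent X T w S N s (m + 1)
        · rw [if_pos (mem_exerciseEvent_succ.1 h2).2, Set.indicator_of_mem h2,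
            Set.indicator_of_mem h2]
          ring
        · rw [if_neg fun h => h2 (mem_exerciseEvent_succ.2 ⟨h1, h⟩), Set.indicator_of_notMem h2,
            Set.indicator_of_notMem h2]
          simp
      · have h2 : ω ∉ exerciseEvent X T w S N s (m + 1) := fun h =>
          h1 (mem_exerciseEvent_succ.1 h).1
        rw [Set.indicator_of_notMem h1, Set.indicator_of_notMem h2, Set.indicator_of_notMem h2]
        simp
    simp_rw [hpt] at hstep
    rw [integral_const_mul, integral_sub, integral_indicator_const _ (hE (m + 1))] at hstep
    · rw [ih (by omega), hstep, Finset.sum_Icc_succ_top (by omega), discountSign_succ, smul_eq_mul]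
      ring
    · exact (M.integrable_value_stockAt hw s (by omega) (by omega)).indicator (hE _)
    · exact (integrable_const _).indicator (hE _)

/-- Forward unrolling of the recursion for the derivative of the value. -/
theorem StockModel.deriv_value_unroll (M : StockModel X Q r T N)
    (hw : ∀ j ∈ Finset.Icc 1 N, w j = 1 ∨ w j = -1) {S : ℕ → ℝ}
    (hS : IsCritical X Q r T K w N 1 S) {s : ℝ} (hs : 0 < s) (m : ℕ) (hm : m ≤ N) :
    deriv (value X Q r T K w N 0) s = discountSign r T w m *
        (∫ ω, (exerciseEvent X T w S N s m).indicator
          (fun ω => Real.exp (X (T m) ω - X (T 0) ω) *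
            deriv (value X Q r T K w (N - m) m) (stockAt X T s m ω)) ω ∂Q) := by
  induction m with
  | zero => simp [discountSign_zero, exerciseEvent_zero, stockAt]
  | succ m ih =>
    obtain ⟨k, hk⟩ : ∃ k, N = m + 1 + k := ⟨N - (m + 1), by omega⟩
    have hS' : IsCritical X Q r T K w N (m + 1) S := hS.mono (by omega)
    have hE := fun m => M.measurableSet_exerciseEvent w S s m
    have hspos : ∀ m ω, 0 < stockAt X T s m ω := fun m ω => mul_pos hs (Real.exp_pos _)
    set h : ℝ × ℝ → ℝ := fun p => if exerciseSign w N (m + 1) * S (m + 1) ≤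
        exerciseSign w N (m + 1) * (p.1 * Real.exp p.2) then
      Real.exp (-(r * ((T (m + 1) : ℝ) - T m))) * w (m + 1) *
        (Real.exp p.2 * deriv (value X Q r T K w k (m + 1)) (p.1 * Real.exp p.2)) else 0 with hh
    have hm1 : Measurable fun p : ℝ × ℝ => p.1 * Real.exp p.2 := by fun_prop
    have hhm : Measurable h := by
      refine Measurable.ite (measurableSet_le measurable_const (hm1.const_mul _)) ?_
        measurable_const
      exact ((measurable_snd.exp).mul ((measurable_deriv _).comp hm1)).const_mul _
    have hb : ∀ p, |h p| ≤ Real.exp (-(r * ((T (m + 1) : ℝ) - T m))) * Real.exp p.2 := by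
      intro p
      simp only [hh]
      split_ifs
      · rw [abs_mul, abs_mul, abs_mul, abs_of_pos (Real.exp_pos _), abs_of_pos (Real.exp_pos _),
          abs_eq_one_of_sign (hw (m + 1) (by simp; omega)), mul_one]
        have := M.abs_deriv_value_le (K := K) hw k (m + 1) (by omega) (p.1 * Real.exp p.2)
        gcongr
        exact mul_le_of_le_one_right (Real.exp_pos _).le this
      · rw [abs_zero]; positivity
    have hstep := M.integral_step (w := w) (m := m) (by omega) S s Real.measurable_exp hhm (by
      refine ((M.integrable_exp_path (n := m + 1) hm).const_mul
        (Real.exp (-(r * ((T (m + 1) : ℝ) - T m))))).mono'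
        ((M.measurable_sub _ _).exp.mul (hhm.comp ((M.measurable_stockAt s m).prodMk
          (M.measurable_sub _ _)))).aestronglyMeasurable (ae_of_all _ fun ω => ?_)
      rw [norm_mul, Real.norm_of_nonneg (Real.exp_pos _).le, Real.norm_eq_abs]
      refine (mul_le_mul_of_nonneg_left (hb _) (Real.exp_pos _).le).trans_eq ?_
      simp only
      rw [mul_left_comm, ← Real.exp_add]; congr 2; ring)
    have hval : ∀ ω, ∫ ω', h (stockAt X T s m ω, X (T (m + 1)) ω' - X (T m) ω') ∂Q =
        deriv (value X Q r T K w (N - m) m) (stockAt X T s m ω) := by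
      intro ω
      rw [show N - m = k + 1 by omega]
      exact (M.hasDerivAt_value_succ hw (by omega) hS' (hspos m ω) fun x hx =>
        M.differentiableAt_value hw k (m + 1) (by omega) (hS'.mono (by omega)) hx).deriv.symm
    simp_rw [hval] at hstep
    have hpt : ∀ ω, (exerciseEvent X T w S N s m).indicator (fun ω =>
          Real.exp (X (T m) ω - X (T 0) ω) *
            h (stockAt X T s m ω, X (T (m + 1)) ω - X (T m) ω)) ω =
        (Real.exp (-(r * ((T (m + 1) : ℝ) - T m))) * w (m + 1)) *
          (exerciseEvent X T w S N s (m + 1)).indicator (fun ω =>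
            Real.exp (X (T (m + 1)) ω - X (T 0) ω) *
            deriv (value X Q r T K w (N - (m + 1)) (m + 1)) (stockAt X T s (m + 1) ω)) ω := by
      intro ω
      rw [show N - (m + 1) = k by omega]
      by_cases h1 : ω ∈ exerciseEvent X T w S N s m
      · rw [Set.indicator_of_mem h1]
        simp only [hh, ← stockAt_succ]
        by_cases h2 : ω ∈ exerciseEvent X T w S N s (m + 1)
        · rw [if_pos (mem_exerciseEvent_succ.1 h2).2, Set.indicator_of_mem h2,
            show X (T (m + 1)) ω - X (T 0) ω = (X (T m) ω - X (T 0) ω) +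
              (X (T (m + 1)) ω - X (T m) ω) by ring, Real.exp_add]
          ring
        · rw [if_neg fun h => h2 (mem_exerciseEvent_succ.2 ⟨h1, h⟩), Set.indicator_of_notMem h2]
          simp
      · have h2 : ω ∉ exerciseEvent X T w S N s (m + 1) := fun h =>
          h1 (mem_exerciseEvent_succ.1 h).1
        rw [Set.indicator_of_notMem h1, Set.indicator_of_notMem h2]
        simp
    simp_rw [hpt] at hstep
    rw [integral_const_mul] at hstep
    rw [ih (by omega), hstep, discountSign_succ]
    ring

/-- The value as the expectation of the stock received and the strikes paid. -/
theorem StockModel.value_eq (M : StockModel X Q r T N)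
    (hw : ∀ j ∈ Finset.Icc 1 N, w j = 1 ∨ w j = -1) {S : ℕ → ℝ}
    (hS : IsCritical X Q r T K w N 1 S) (s : ℝ) :
    value X Q r T K w N 0 s =
      discountSign r T w N *
        (∫ ω, (exerciseEvent X T w S N s N).indicator (stockAt X T s N) ω ∂Q) -
      ∑ j ∈ Finset.Icc 1 N, discountSign r T w j *
        (K j * Q.real (exerciseEvent X T w S N s j)) := by
  have := M.value_unroll hw hS s N le_rfl
  simpa only [Nat.sub_self, value] using this

theorem StockModel.hasDerivAt_value (M : StockModel X Q r T N)
    (hw : ∀ j ∈ Finset.Icc 1 N, w j = 1 ∨ w j = -1) {S : ℕ → ℝ}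
    (hS : IsCritical X Q r T K w N 1 S) {s : ℝ} (hs : 0 < s) :
    HasDerivAt (value X Q r T K w N 0) (discountSign r T w N *
        (∫ ω, (exerciseEvent X T w S N s N).indicator
          (fun ω => Real.exp (X (T N) ω - X (T 0) ω)) ω ∂Q)) s := by
  have h1 := M.deriv_value_unroll hw hS hs N le_rfl
  have h2 : value X Q r T K w (N - N) N = fun x => x := by
    funext x; simp [value]
  rw [h2] at h1
  simp only [deriv_id'', mul_one] at h1
  rw [← h1]
  exact (M.differentiableAt_value hw N 0 (by omega) hS hs).hasDerivAt

end Unrolling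

/-! ### The contour integrals -/

section Contours

set_option linter.unusedSectionVars false

lemma prod_Icc_one_eq {R : Type*} [CommMonoid R] (f : ℕ → R) (j : ℕ) :
    ∏ n ∈ Finset.Icc 1 j, f n = ∏ n : Fin j, f (n + 1) := by
  induction j with
  | zero => simp
  | succ j ih =>
    rw [Finset.prod_Icc_succ_top (by omega), ih, Fin.prod_univ_castSucc]
    rfl

lemma sub_eq_sum_Iic {j : ℕ} (f : ℕ → ℝ) (n : Fin j) :
    f (n + 1) - f 0 = ∑ k ∈ Finset.Iic n, (f (k + 1) - f k) := by
  rw [← Finset.sum_range_sub f (n + 1), Nat.range_succ_eq_Iic, ← Fin.map_valEmbedding_Iic,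
    Finset.sum_map]
  rfl

/-- Summation by parts, expressing a linear form of a path through its increments. -/
lemma sum_mul_sub_eq {R : Type*} [CommRing R] [Algebra ℝ R] {j : ℕ} (f : ℕ → ℝ) (ξ : Fin j → R) :
    ∑ n : Fin j, ξ n * algebraMap ℝ R (f (n + 1) - f 0) =
      ∑ k : Fin j, (∑ n ∈ Finset.Ici k, ξ n) * algebraMap ℝ R (f (k + 1) - f k) := by
  simp_rw [sub_eq_sum_Iic f, map_sum, Finset.mul_sum, Finset.sum_mul]
  exact Finset.sum_comm' (by simp)

variable {Ω : Type*} [MeasurableSpace Ω] {Q : Measure Ω} [IsProbabilityMeasure Q]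
  {X : ℝ≥0 → Ω → ℝ} {ψ : ℂ → ℂ} {υ lm lp : ℝ} {T : ℕ → ℝ≥0} {N : ℕ}

/-- The joint characteristic function of the log-prices at `T_1, …, T_j`, at complex arguments. -/
lemma IsLevy.integral_cexp_path (hX : IsLevy X Q) (hψ : HasCharExponent X Q ψ)
    (h : IsRLPEExponent ψ υ lm lp) (hυ : 0 < υ) (hlm : lm < 0) (hlp : 0 < lp)
    (hT : ∀ j < N, T j < T (j + 1)) {j : ℕ} (hj : j ≤ N) {ξ : Fin j → ℂ}
    (hξ : ∀ k, (∑ n ∈ Finset.Ici k, ξ n).im ∈ Set.Ioo lm lp) :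
    ∫ ω, Complex.exp (Complex.I * ∑ n : Fin j, ξ n *
      ((X (T (n + 1)) ω - X (T 0) ω : ℝ) : ℂ)) ∂Q = Complex.exp (-bigPsi ψ T j ξ) := by
  have hT' : ∀ k < j, T k < T (k + 1) := fun k hk => hT k (hk.trans_le hj)
  have hind := hX.iIndepFun_sub hT'
  have e : ∀ ω, Complex.exp (Complex.I * ∑ n : Fin j, ξ n *
      ((X (T (n + 1)) ω - X (T 0) ω : ℝ) : ℂ)) = ∏ k : Fin j, Complex.exp (Complex.I *
        (∑ n ∈ Finset.Ici k, ξ n) * ((X (T (k + 1)) ω - X (T k) ω : ℝ) : ℂ)) := by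
    intro ω
    have := sum_mul_sub_eq (fun n => X (T n) ω) ξ
    simp only [Complex.coe_algebraMap] at this
    rw [this, Finset.mul_sum, Complex.exp_sum]
    simp_rw [mul_assoc]
  simp_rw [e]
  have key := hind.integral_fun_prod_comp (𝕜 := ℂ)
    (f := fun (k : Fin j) (x : ℝ) => Complex.exp (Complex.I * (∑ n ∈ Finset.Ici k, ξ n) * (x : ℂ)))
    (fun k => (hX.measurable_sub _ _).aemeasurable)
    (fun k => Continuous.aestronglyMeasurable (by fun_prop))
  rw [key, bigPsi, ← Finset.sum_neg_distrib, Complex.exp_sum]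
  refine Finset.prod_congr rfl fun k _ => ?_
  exact hX.integral_cexp_mul_sub hψ h hυ hlm hlp (hT' k k.2) (hξ k)

lemma IsLevy.integrable_exp_path (hX : IsLevy X Q) (hψ : HasCharExponent X Q ψ)
    (h : IsRLPEExponent ψ υ lm lp) (hυ : 0 < υ) (hlm : lm < 0) (hlp : 0 < lp)
    (hT : ∀ j < N, T j < T (j + 1)) {j : ℕ} (hj : j ≤ N) {c : Fin j → ℝ}
    (hc : ∀ k, ∑ n ∈ Finset.Ici k, c n ∈ Set.Ioo (-lp) (-lm)) :
    Integrable (fun ω => Real.exp (∑ n : Fin j, c n * (X (T (n + 1)) ω - X (T 0) ω))) Q := by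
  have hT' : ∀ k < j, T k < T (k + 1) := fun k hk => hT k (hk.trans_le hj)
  have hind := (hX.iIndepFun_sub hT').comp
    (fun (k : Fin j) x => (∑ n ∈ Finset.Ici k, c n) * x) (fun k => measurable_id.const_mul _)
  have := hind.integrable_exp_mul_sum (t := 1) (s := Finset.univ)
    (fun k => (hX.measurable_sub _ _).const_mul _) (fun k _ => by
      simpa using! hX.integrable_exp_mul_sub hψ h hυ hlm hlp (hT' k k.2) (hc k))
  refine this.congr (ae_of_all _ fun ω => ?_)
  have h2 := sum_mul_sub_eq (fun n => X (T n) ω) c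
  simp only [Algebra.algebraMap_self, RingHom.id_apply] at h2
  simp only [one_mul, Finset.sum_apply, Function.comp_apply, h2]

/-- The map `x ↦ (x_1 + ⋯ + x_j, x_2 + ⋯ + x_j, …, x_j)` preserves volume. -/
lemma measurePreserving_tailSum (j : ℕ) :
    MeasurePreserving (fun (x : Fin j → ℝ) (k : Fin j) => ∑ n ∈ Finset.Ici k, x n) := by
  classical
  set A : Matrix (Fin j) (Fin j) ℝ := Matrix.of fun k n => if k ≤ n then 1 else 0 with hA
  have hdet : A.det = 1 := by
    rw [Matrix.det_of_isUpperTriangular]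
    · simp [hA]
    · intro k n hkn
      simp only [id_eq] at hkn
      simp [hA, hkn]
  have hfun : (fun (x : Fin j → ℝ) (k : Fin j) => ∑ n ∈ Finset.Ici k, x n) =
      Matrix.toLin' A := by
    funext x k
    rw [Matrix.toLin'_apply, Matrix.mulVec, dotProduct, ← Finset.sum_filter_add_sum_filter_not
      Finset.univ (fun n => k ≤ n)]
    simp only [hA, Matrix.of_apply, ite_mul, one_mul, zero_mul]
    rw [Finset.sum_ite_of_true (by simp), Finset.sum_ite_of_false (by simp)]
    simp only [Finset.sum_const_zero, add_zero]
    refine Finset.sum_congr ?_ fun _ _ => rfl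
    ext; simp
  refine ⟨by fun_prop, ?_⟩
  rw [hfun, Real.map_matrix_volume_pi_eq_smul_volume_pi (by rw [hdet]; exact one_ne_zero), hdet]
  simp

lemma IsRLPEExponent.integrable_exp_bigPsi (h : IsRLPEExponent ψ υ lm lp) (hυ : 0 < υ)
    (hT : ∀ j < N, T j < T (j + 1)) {j : ℕ} (hj : j ≤ N) {c : Fin j → ℝ}
    (hc : ∀ k, ∑ n ∈ Finset.Ici k, c n ∈ Set.Icc (-lp) (-lm)) :
    Integrable fun x : Fin j → ℝ => Complex.exp (-bigPsi ψ T j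
      fun n => (x n : ℂ) - Complex.I * ((c n : ℝ) : ℂ)) := by
  have h1 : ∀ k : Fin j, Integrable fun u : ℝ => Complex.exp
      (-((((T (k + 1) : ℝ) - (T k : ℝ) : ℝ) : ℂ) *
        ψ (u + ((-∑ n ∈ Finset.Ici k, c n : ℝ) : ℂ) * Complex.I))) := fun k =>
    h.integrable_exp_line hυ (sub_pos.2 (hT k (k.2.trans_le hj)))
      ⟨by linarith [(hc k).2], by linarith [(hc k).1]⟩
  have h2 := (measurePreserving_tailSum j).integrable_comp_of_integrable (Integrable.fintype_prod h1)
  refine h2.congr (ae_of_all _ fun x => ?_)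
  simp only [Function.comp_apply]
  rw [bigPsi, ← Finset.sum_neg_distrib, Complex.exp_sum]
  refine Finset.prod_congr rfl fun k _ => ?_
  congr 4
  rw [Finset.sum_sub_distrib, ← Finset.mul_sum]
  push_cast
  ring

/-- Along the contours the kernel is bounded, since they avoid the poles. -/
lemma exists_norm_kernel_le {j : ℕ} {c : Fin j → ℝ} (hc : ∀ n, c n ≠ 0) (a : Fin j → ℝ) :
    ∃ B : ℝ, ∀ x : Fin j → ℝ, ‖(∏ n, ((x n : ℂ) - Complex.I * ((c n : ℝ) : ℂ)))⁻¹ *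
      Complex.exp (Complex.I * ∑ n, ((x n : ℂ) - Complex.I * ((c n : ℝ) : ℂ)) *
        ((a n : ℝ) : ℂ))‖ ≤ B := by
  refine ⟨(∏ n, |c n|)⁻¹ * Real.exp (∑ n, c n * a n), fun x => ?_⟩
  rw [norm_mul, norm_inv, norm_prod, Complex.norm_exp]
  have h1 : (Complex.I * ∑ n, ((x n : ℂ) - Complex.I * ((c n : ℝ) : ℂ)) *
        ((a n : ℝ) : ℂ)).re = ∑ n, c n * a n := by
    simp [Complex.im_sum]
  rw [h1]
  gcongr with n
  · exact Finset.prod_pos fun n _ => abs_pos.2 (hc n)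
  · simpa using Complex.abs_im_le_norm ((x n : ℂ) - Complex.I * ((c n : ℝ) : ℂ))

lemma integrable_kernel_mul {j : ℕ} {c : Fin j → ℝ} (hc : ∀ n, c n ≠ 0) (a : Fin j → ℝ)
    {G : (Fin j → ℝ) → ℂ} (hG : Integrable G) :
    Integrable fun x : Fin j → ℝ => ((∏ n, ((x n : ℂ) - Complex.I * ((c n : ℝ) : ℂ)))⁻¹ *
      Complex.exp (Complex.I * ∑ n, ((x n : ℂ) - Complex.I * ((c n : ℝ) : ℂ)) *
        ((a n : ℝ) : ℂ))) * G x := by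
  obtain ⟨B, hB⟩ := exists_norm_kernel_le hc a
  refine hG.bdd_mul (c := B) (Measurable.aestronglyMeasurable ?_) (ae_of_all _ hB)
  fun_prop

/-- Contour representation of the expectation of `e^{∑ ζ_n Y_n}` on the exercise event, where `Y_n`
is the log-price at `T_n`. The strikes need `ζ = 0`, the stock `ζ = (0, …, 0, 1)`. -/
theorem IsLevy.integral_exerciseEvent (hX : IsLevy X Q) (hψ : HasCharExponent X Q ψ)
    (h : IsRLPEExponent ψ υ lm lp) (hυ : 0 < υ) (hlm : lm < 0) (hlp : 0 < lp)
    (hT : ∀ j < N, T j < T (j + 1)) {w : ℕ → ℝ} (hw : ∀ j ∈ Finset.Icc 1 N, w j = 1 ∨ w j = -1)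
    {S om : ℕ → ℝ} {s : ℝ} (hs : 0 < s) {j : ℕ} (hj : j ≤ N)
    (hS : ∀ n ∈ Finset.Icc 1 j, 0 < S n) (hom : ∀ n ∈ Finset.Icc 1 j, 0 < om n)
    {ζ : Fin j → ℝ}
    (hc : ∀ k : Fin j, ∑ n ∈ Finset.Ici k, (exerciseSign w N (n + 1) * om (n + 1) + ζ n) ∈
      Set.Ioo (-lp) (-lm)) :
    Integrable (fun x : Fin j → ℝ => kernelFactor S s j (contourPoint w N om j x) *
        Complex.exp (-bigPsi ψ T j fun n => contourPoint w N om j x n - Complex.I * ζ n)) ∧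
    ((∫ ω, (exerciseEvent X T w S N s j).indicator
        (fun ω => Real.exp (∑ n : Fin j, ζ n * (X (T (n + 1)) ω - X (T 0) ω))) ω ∂Q : ℝ) : ℂ) =
      ((∏ n ∈ Finset.Icc 1 j, exerciseSign w N n : ℝ) : ℂ) / (2 * Real.pi * Complex.I) ^ j *
        ∫ x : Fin j → ℝ, kernelFactor S s j (contourPoint w N om j x) *
        Complex.exp (-bigPsi ψ T j fun n => contourPoint w N om j x n - Complex.I * ζ n) := by
  set v : Fin j → ℝ := fun n => exerciseSign w N (n + 1) with hvdef
  set o : Fin j → ℝ := fun n => om (n + 1) with hodef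
  set a : Fin j → ℝ := fun n => Real.log (s / S (n + 1)) with ha
  set Y : Ω → Fin j → ℝ := fun ω n => X (T (n + 1)) ω - X (T 0) ω with hY
  set W : Ω → ℝ := fun ω => Real.exp (∑ n : Fin j, ζ n * Y ω n) with hW
  have hYm : Measurable Y := measurable_pi_lambda _ fun n => hX.measurable_sub _ _
  have hWm : Measurable W := by fun_prop
  have hv : ∀ n, v n = 1 ∨ v n = -1 := fun n => exerciseSign_eq hw (by omega)
  have hv0 : ∀ n, v n ≠ 0 := fun n => by rcases hv n with h | h <;> rw [h] <;> norm_num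
  have ho : ∀ n, 0 < o n := fun n => hom _ (by simp)
  have hvo : ∀ n, v n * o n ≠ 0 := fun n => mul_ne_zero (hv0 n) (ho n).ne'
  have hpt : ∀ x : Fin j → ℝ, contourPoint w N om j x =
      fun n => (x n : ℂ) - Complex.I * ((v n * o n : ℝ) : ℂ) := fun x => rfl
  have hpt' : ∀ x : Fin j → ℝ, (fun n => contourPoint w N om j x n - Complex.I * ζ n) =
      fun n => (x n : ℂ) - Complex.I * ((v n * o n + ζ n : ℝ) : ℂ) := by
    intro x
    funext n
    rw [hpt]; push_cast; ring
  have hG := h.integrable_exp_bigPsi hυ hT hj fun k => Set.Ioo_subset_Icc_self (hc k)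
  have hchar : ∀ x : Fin j → ℝ, ∫ ω, (W ω : ℂ) * Complex.exp (Complex.I *
      ∑ n, (x n - Complex.I * ((v n * o n : ℝ) : ℂ)) * Y ω n) ∂Q =
      Complex.exp (-bigPsi ψ T j fun n => (x n : ℂ) - Complex.I * ((v n * o n + ζ n : ℝ) : ℂ)) := by
    intro x
    rw [← hX.integral_cexp_path hψ h hυ hlm hlp hT hj]
    · congr 1
      funext ω
      rw [hW, Complex.ofReal_exp, ← Complex.exp_add]
      congr 1
      push_cast
      rw [Finset.mul_sum, Finset.mul_sum, ← Finset.sum_add_distrib]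
      refine Finset.sum_congr rfl fun n _ => ?_
      simp only [hY]
      push_cast
      linear_combination ((ζ n : ℂ) * ((X (T (n + 1)) ω : ℂ) - X (T 0) ω)) * Complex.I_sq
    · intro k
      have h1 := hc k
      have h2 : (∑ n ∈ Finset.Ici k, ((x n : ℂ) - Complex.I * ((v n * o n + ζ n : ℝ) : ℂ))).im =
          -∑ n ∈ Finset.Ici k, (v n * o n + ζ n) := by
        rw [Complex.im_sum, ← Finset.sum_neg_distrib]
        refine Finset.sum_congr rfl fun n _ => ?_
        simp
      rw [h2]
      exact ⟨by linarith [h1.2], by linarith [h1.1]⟩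
  simp_rw [hpt']
  refine ⟨?_, ?_⟩
  · exact integrable_kernel_mul hvo a hG
  have hint : Integrable (fun ω => W ω * Real.exp (∑ n, v n * o n * Y ω n)) Q := by
    refine (hX.integrable_exp_path hψ h hυ hlm hlp hT hj hc).congr (ae_of_all _ fun ω => ?_)
    simp only [hW, ← Real.exp_add, ← Finset.sum_add_distrib]
    congr 1
    refine Finset.sum_congr rfl fun n _ => ?_
    simp only [hY, hvdef, hodef]; ring
  have key := integral_orthant_eq_contour (Q := Q) (W := W) (Y := Y) (v := v) (a := a) (om := o)
    hv ho (fun ω => (Real.exp_pos _).le) hWm hYm hint (by simp_rw [hchar]; exact hG)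
  simp_rw [hchar] at key
  have hset : exerciseEvent X T w S N s j = {ω | ∀ n, 0 ≤ v n * (a n + Y ω n)} := by
    have hiff : ∀ (ω : Ω) (n : Fin j), exerciseSign w N (n + 1) * S (n + 1) ≤
        exerciseSign w N (n + 1) * stockAt X T s (n + 1) ω ↔ 0 ≤ v n * (a n + Y ω n) := by
      intro ω n
      have hSn : 0 < S (n + 1) := hS _ (by simp)
      have e1 : a n + Y ω n = Real.log (stockAt X T s (n + 1) ω) - Real.log (S (n + 1)) := by
        simp only [ha, hY, stockAt]
        rw [Real.log_mul hs.ne' (Real.exp_pos _).ne', Real.log_exp, Real.log_div hs.ne' hSn.ne']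
        ring
      have hst : 0 < stockAt X T s (n + 1) ω := mul_pos hs (Real.exp_pos _)
      have hlog := Real.log_le_log_iff hSn hst
      have hlog' := Real.log_le_log_iff hst hSn
      change v n * _ ≤ v n * _ ↔ _
      rw [e1]
      rcases hv n with h | h <;> rw [h]
      · rw [one_mul, one_mul, one_mul, sub_nonneg, hlog]
      · rw [neg_one_mul, neg_one_mul, neg_one_mul, neg_le_neg_iff, neg_sub, sub_nonneg, hlog']
    ext ω
    constructor
    · intro hω n
      exact (hiff ω n).1 (hω (n + 1) (by simp))
    · intro hω n hn
      rw [Finset.mem_Icc] at hn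
      obtain ⟨i, rfl⟩ : ∃ i, n = i + 1 := ⟨n - 1, by omega⟩
      exact (hiff ω ⟨i, by omega⟩).2 (hω ⟨i, by omega⟩)
  rw [hset, key]
  congr 2
  rw [← Complex.ofReal_prod]
  congr 1
  exact (prod_Icc_one_eq (exerciseSign w N) j).symm

end Contours

/-! ### The Gaussian case -/

section Gauss

set_option linter.unusedSectionVars false

/-- The exponent of Brownian motion with drift is regular of order `2` on every strip. -/
lemma isRLPEExponent_quadratic {ψ : ℂ → ℂ} {σ r : ℝ} (hσ : 0 < σ)
    (hψ : ∀ ξ : ℂ, ψ ξ = Complex.I * ((σ ^ 2 / 2 - r : ℝ) : ℂ) * ξ +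
      ((σ ^ 2 / 2 : ℝ) : ℂ) * ξ ^ 2) (lm lp : ℝ) : IsRLPEExponent ψ 2 lm lp := by
  refine ⟨-(σ ^ 2 / 2 - r), fun ξ => ((σ ^ 2 / 2 : ℝ) : ℂ) * ξ ^ 2, fun ξ _ => ?_, by fun_prop,
    by fun_prop, ⟨σ ^ 2 / 2, 1, by positivity, by norm_num, ?_⟩,
    ⟨σ ^ 2, 1, by norm_num, fun ξ _ => ?_⟩⟩
  · rw [hψ]; push_cast; ring
  · refine Asymptotics.IsBigO.of_bound (σ ^ 2 / 2 * (2 * max |lm| |lp|)) ?_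
    rw [eventually_inf_principal]
    refine Eventually.of_forall fun ξ hξ => ?_
    have h1 : ((σ ^ 2 / 2 : ℝ) : ℂ) * ξ ^ 2 - ((σ ^ 2 / 2 * ‖ξ‖ ^ (2 : ℝ) : ℝ) : ℂ) =
        ((σ ^ 2 / 2 : ℝ) : ℂ) * (ξ * ((2 * ξ.im : ℝ) * Complex.I)) := by
      have h2 : ((‖ξ‖ ^ (2 : ℝ) : ℝ) : ℂ) = ξ * (starRingEnd ℂ) ξ := by
        rw [Complex.mul_conj, Real.rpow_two, Complex.normSq_eq_norm_sq]
      rw [Complex.ofReal_mul, h2, ← Complex.sub_conj]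
      ring
    have h3 : |ξ.im| ≤ max |lm| |lp| := by
      have := hξ
      exact abs_le_max_abs_abs hξ.1 hξ.2
    rw [h1, Real.rpow_one, norm_mul, norm_mul, norm_mul, Complex.norm_I, Complex.norm_real,
      Complex.norm_real, norm_norm, Real.norm_of_nonneg (by positivity), Real.norm_eq_abs, abs_mul,
      abs_two, mul_one]
    have := norm_nonneg ξ
    calc σ ^ 2 / 2 * (‖ξ‖ * (2 * |ξ.im|)) ≤ σ ^ 2 / 2 * (‖ξ‖ * (2 * max |lm| |lp|)) := by gcongr
      _ = _ := by ring
  · have h1 : deriv (fun ξ : ℂ => ((σ ^ 2 / 2 : ℝ) : ℂ) * ξ ^ 2) ξ = ((σ ^ 2 : ℝ) : ℂ) * ξ := by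
      rw [deriv_const_mul _ (by fun_prop), deriv_pow_field]
      push_cast; ring
    rw [h1, norm_mul, Complex.norm_real, Real.norm_of_nonneg (by positivity), Real.rpow_one]
    gcongr
    linarith

lemma sum_Ici_eq_sum_Icc {R : Type*} [AddCommMonoid R] {j : ℕ} (k : Fin j) (f : ℕ → R) :
    ∑ n ∈ Finset.Ici k, f (n + 1) = ∑ n ∈ Finset.Icc ((k : ℕ) + 1) j, f n := by
  have h1 : ∑ n ∈ Finset.Ici k, f (n + 1) = ∑ n ∈ Finset.Ico (k : ℕ) j, f (n + 1) := by
    rw [← Fin.map_valEmbedding_Ici, Finset.sum_map]; rfl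
  rw [h1, Finset.sum_Ico_add' f]
  rfl

/-- `θ` in the last coordinate, `0` elsewhere. -/
def lastCoord (j : ℕ) (θ : ℝ) (n : Fin j) : ℝ := if (n : ℕ) + 1 = j then θ else 0

lemma sum_Ici_lastCoord {j : ℕ} (θ : ℝ) (k : Fin j) :
    ∑ n ∈ Finset.Ici k, lastCoord j θ n = θ := by
  have hk := k.2
  rw [Finset.sum_eq_single_of_mem (⟨j - 1, by omega⟩ : Fin j)]
  · rw [lastCoord, if_pos (by simp only; omega)]
  · rw [Finset.mem_Ici, Fin.le_def]; simp only; omega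
  · intro n _ hn
    rw [lastCoord, if_neg]
    intro h
    exact hn (Fin.ext (by simp only; omega))

variable {Ω : Type*} [MeasurableSpace Ω] {Q : Measure Ω} [IsProbabilityMeasure Q]
  {X : ℝ≥0 → Ω → ℝ} {ψ : ℂ → ℂ} {σ r : ℝ} {T : ℕ → ℝ≥0} {w : ℕ → ℝ} {N : ℕ}

lemma date_pos (hT : ∀ j < N, T j < T (j + 1)) {n : ℕ} (hn : n < N) :
    0 < (T (n + 1) : ℝ) - T 0 := by
  induction n with
  | zero => exact sub_pos.2 (hT 0 hn)
  | succ n ih =>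
    have h1 := ih (by omega)
    have h2 : (T (n + 1) : ℝ) < T (n + 1 + 1) := hT (n + 1) hn
    linarith

/-- A square root of the correlation matrix: row `n` lists the loadings of the normalized
log-price at `T_{n+1}` on the increments. -/
def corrFactor (T : ℕ → ℝ≥0) (w : ℕ → ℝ) (N j : ℕ) : Matrix (Fin j) (Fin j) ℝ :=
  Matrix.of fun n k => if k ≤ n then exerciseSign w N (n + 1) *
    (Real.sqrt ((T (k + 1) : ℝ) - T k) / Real.sqrt ((T (n + 1) : ℝ) - T 0)) else 0

lemma corrMatrix_eq (hT : ∀ j < N, T j < T (j + 1)) {j : ℕ} (hj : j ≤ N) :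
    corrMatrix T w N j = corrFactor T w N j * (corrFactor T w N j).transpose := by
  have hmain : ∀ n l : Fin j, n ≤ l →
      Real.sqrt (((T ((n : ℕ) + 1) : ℝ) - T 0) / ((T ((l : ℕ) + 1) : ℝ) - T 0)) =
      ∑ k : Fin j, (if k ≤ n then Real.sqrt ((T (k + 1) : ℝ) - T k) /
        Real.sqrt ((T (n + 1) : ℝ) - T 0) else 0) * (if k ≤ l then
          Real.sqrt ((T (k + 1) : ℝ) - T k) / Real.sqrt ((T (l + 1) : ℝ) - T 0) else 0) := by
    intro n l hnl
    have hn := date_pos hT (n := n) (n.2.trans_le hj)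
    have hl := date_pos hT (n := l) (l.2.trans_le hj)
    have h1 : ∀ k : Fin j, (if k ≤ n then Real.sqrt ((T (k + 1) : ℝ) - T k) /
        Real.sqrt ((T (n + 1) : ℝ) - T 0) else 0) * (if k ≤ l then
          Real.sqrt ((T (k + 1) : ℝ) - T k) / Real.sqrt ((T (l + 1) : ℝ) - T 0) else 0) =
        if k ≤ n then ((T (k + 1) : ℝ) - T k) / (Real.sqrt ((T (n + 1) : ℝ) - T 0) *
          Real.sqrt ((T (l + 1) : ℝ) - T 0)) else 0 := by
      intro k
      by_cases hk : k ≤ n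
      · rw [if_pos hk, if_pos hk, if_pos (hk.trans hnl), div_mul_div_comm,
          Real.mul_self_sqrt (sub_nonneg.2 (NNReal.coe_le_coe.2 (hT k (k.2.trans_le hj)).le))]
      · rw [if_neg hk, if_neg hk, zero_mul]
    simp_rw [h1]
    rw [← Finset.sum_filter, ← Finset.sum_div, show Finset.univ.filter (fun k => k ≤ n) =
      Finset.Iic n by ext; simp, ← sub_eq_sum_Iic (fun k => (T k : ℝ)) n, Real.sqrt_div hn.le]
    have := Real.mul_self_sqrt hn.le
    have h2 := (Real.sqrt_pos.2 hn).ne'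
    have h3 := (Real.sqrt_pos.2 hl).ne'
    field_simp
    linarith [Real.sq_sqrt hn.le]
  ext n l
  rw [Matrix.mul_apply]
  simp only [corrMatrix, corrFactor, Matrix.of_apply, Matrix.transpose_apply]
  have hf : ∀ k : Fin j, (if k ≤ n then exerciseSign w N (n + 1) *
      (Real.sqrt ((T (k + 1) : ℝ) - T k) / Real.sqrt ((T (n + 1) : ℝ) - T 0)) else 0) *
      (if k ≤ l then exerciseSign w N (l + 1) *
      (Real.sqrt ((T (k + 1) : ℝ) - T k) / Real.sqrt ((T (l + 1) : ℝ) - T 0)) else 0) =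
      exerciseSign w N (n + 1) * exerciseSign w N (l + 1) *
      ((if k ≤ n then Real.sqrt ((T (k + 1) : ℝ) - T k) /
        Real.sqrt ((T (n + 1) : ℝ) - T 0) else 0) * (if k ≤ l then
          Real.sqrt ((T (k + 1) : ℝ) - T k) / Real.sqrt ((T (l + 1) : ℝ) - T 0) else 0)) := by
    intro k
    split_ifs <;> ring
  simp_rw [hf]
  rw [← Finset.mul_sum]
  congr 1
  rcases le_total n l with h | h
  · have h' : (n : ℕ) ≤ l := h
    rw [min_eq_left h', max_eq_right h', hmain n l h]
  · have h' : (l : ℕ) ≤ n := h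
    rw [min_eq_right h', max_eq_left h', hmain l n h]
    exact Finset.sum_congr rfl fun k _ => mul_comm _ _

lemma posSemidef_corrMatrix (hT : ∀ j < N, T j < T (j + 1)) {j : ℕ} (hj : j ≤ N) :
    (corrMatrix T w N j).PosSemidef := by
  rw [corrMatrix_eq hT hj]
  exact Matrix.posSemidef_self_mul_conjTranspose _

lemma dotProduct_corrMatrix_mulVec (hT : ∀ j < N, T j < T (j + 1)) {j : ℕ} (hj : j ≤ N)
    (u : Fin j → ℝ) : u ⬝ᵥ (corrMatrix T w N j).mulVec u = ∑ k : Fin j,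
      ((T (k + 1) : ℝ) - T k) * (∑ n ∈ Finset.Ici k, u n *
        (exerciseSign w N (n + 1) / Real.sqrt ((T (n + 1) : ℝ) - T 0))) ^ 2 := by
  rw [corrMatrix_eq hT hj, ← Matrix.mulVec_mulVec, Matrix.dotProduct_mulVec,
    ← Matrix.mulVec_transpose, dotProduct]
  refine Finset.sum_congr rfl fun k _ => ?_
  have h1 : ((corrFactor T w N j).transpose.mulVec u) k = Real.sqrt ((T (k + 1) : ℝ) - T k) *
      ∑ n ∈ Finset.Ici k, u n *
        (exerciseSign w N (n + 1) / Real.sqrt ((T (n + 1) : ℝ) - T 0)) := by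
    rw [Matrix.mulVec, dotProduct, Finset.mul_sum, show Finset.Ici k =
      Finset.univ.filter (fun n => k ≤ n) by ext; simp, Finset.sum_filter]
    refine Finset.sum_congr rfl fun n _ => ?_
    simp only [corrFactor, Matrix.transpose_apply, Matrix.of_apply]
    split_ifs <;> ring
  rw [h1, mul_mul_mul_comm, Real.mul_self_sqrt (sub_nonneg.2 (NNReal.coe_le_coe.2 (hT k (k.2.trans_le hj)).le)), sq]

/-- Joint characteristic function of the normalized log-prices, under `Q` if `θ = 0` and under
the measure with the discounted stock as density if `θ = 1`. -/
lemma IsLevy.integral_cexp_normalized (hX : IsLevy X Q) (hψ : HasCharExponent X Q ψ)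
    (hσ : 0 < σ) (hquad : ∀ ξ : ℂ, ψ ξ = Complex.I * ((σ ^ 2 / 2 - r : ℝ) : ℂ) * ξ +
      ((σ ^ 2 / 2 : ℝ) : ℂ) * ξ ^ 2) (hT : ∀ j < N, T j < T (j + 1)) {j : ℕ} (hj : j ≤ N)
    {θ : ℝ} (hθ : θ = 0 ∨ θ = 1) (u : Fin j → ℝ) :
    ∫ ω, ((Real.exp (∑ n, lastCoord j θ n * (X (T (n + 1)) ω - X (T 0) ω) -
          θ * r * ((T j : ℝ) - T 0)) : ℝ) : ℂ) *
        Complex.exp (Complex.I * ((∑ n : Fin j, u n * (-(exerciseSign w N (n + 1) /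
          (σ * Real.sqrt ((T (n + 1) : ℝ) - T 0))) * ((X (T (n + 1)) ω - X (T 0) ω) -
            (r + (2 * θ - 1) * (σ ^ 2 / 2)) * ((T (n + 1) : ℝ) - T 0))) : ℝ) : ℂ)) ∂Q =
      Complex.exp (-((u ⬝ᵥ (corrMatrix T w N j).mulVec u / 2 : ℝ) : ℂ)) := by
  set b : Fin j → ℝ := fun n => u n * -(exerciseSign w N (n + 1) /
          (σ * Real.sqrt ((T (n + 1) : ℝ) - T 0))) with hb
  set q : Fin j → ℝ := fun k => ∑ n ∈ Finset.Ici k, b n with hq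
  set m : ℝ := r + (2 * θ - 1) * (σ ^ 2 / 2) with hm
  have hRL := isRLPEExponent_quadratic hσ hquad (-2) 1
  have hsum : ∀ k : Fin j, ∑ n ∈ Finset.Ici k, ((b n : ℂ) - Complex.I * (lastCoord j θ n : ℂ)) =
      (q k : ℂ) - Complex.I * θ := by
    intro k
    rw [Finset.sum_sub_distrib, ← Finset.mul_sum, ← Complex.ofReal_sum, ← Complex.ofReal_sum,
      sum_Ici_lastCoord]
  have hpath := hX.integral_cexp_path hψ hRL (by norm_num) (by norm_num) (by norm_num) hT hj
    (ξ := fun n => (b n : ℂ) - Complex.I * (lastCoord j θ n : ℂ)) (fun k => by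
      rw [hsum k]
      rcases hθ with rfl | rfl <;> norm_num)
  have hpoint : ∀ k : Fin j, ψ ((q k : ℂ) - Complex.I * θ) =
      -(Complex.I * m * q k) + (σ ^ 2 / 2 : ℝ) * (q k) ^ 2 - θ * r := by
    intro k
    rw [hquad, hm]
    rcases hθ with rfl | rfl
    · push_cast; ring
    · push_cast
      linear_combination ((r : ℂ) - σ ^ 2 / 2 + σ ^ 2 / 2) * Complex.I_sq
  have hΔq : ∑ n, b n * ((T (n + 1) : ℝ) - T 0) = ∑ k : Fin j, q k * ((T (k + 1) : ℝ) - T k) := by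
    have := sum_mul_sub_eq (fun n => (T n : ℝ)) b
    simpa using this
  have hΔ : ∑ k : Fin j, ((T (k + 1) : ℝ) - T k) = (T j : ℝ) - T 0 := by
    rw [Fin.sum_univ_eq_sum_range (fun k => (T (k + 1) : ℝ) - T k),
      Finset.sum_range_sub (fun k => (T k : ℝ))]
  have hΔ2 : u ⬝ᵥ (corrMatrix T w N j).mulVec u / 2 =
      ∑ k : Fin j, ((T (k + 1) : ℝ) - T k) * (σ ^ 2 / 2 * q k ^ 2) := by
    rw [dotProduct_corrMatrix_mulVec hT hj, Finset.sum_div]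
    refine Finset.sum_congr rfl fun k _ => ?_
    have : ∑ n ∈ Finset.Ici k, u n *
        (exerciseSign w N (n + 1) / Real.sqrt ((T (n + 1) : ℝ) - T 0)) = -(σ * q k) := by
      rw [hq, Finset.mul_sum, ← Finset.sum_neg_distrib]
      refine Finset.sum_congr rfl fun n _ => ?_
      rw [hb]; field_simp
    rw [this]; ring
  have hbig : bigPsi ψ T j (fun n => (b n : ℂ) - Complex.I * (lastCoord j θ n : ℂ)) =
      -(Complex.I * m * ((∑ n, b n * ((T (n + 1) : ℝ) - T 0) : ℝ) : ℂ)) +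
        ((u ⬝ᵥ (corrMatrix T w N j).mulVec u / 2 : ℝ) : ℂ) -
        ((θ * r * ((T j : ℝ) - T 0) : ℝ) : ℂ) := by
    rw [hΔ2, hΔq, ← hΔ, bigPsi]
    push_cast
    rw [Finset.mul_sum, Finset.mul_sum, ← Finset.sum_neg_distrib, ← Finset.sum_add_distrib,
      ← Finset.sum_sub_distrib]
    refine Finset.sum_congr rfl fun k _ => ?_
    rw [hsum, hpoint]
    push_cast
    ring
  rw [hbig] at hpath
  have e : ∀ ω, ((Real.exp (∑ n, lastCoord j θ n * (X (T (n + 1)) ω - X (T 0) ω) -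
          θ * r * ((T j : ℝ) - T 0)) : ℝ) : ℂ) *
        Complex.exp (Complex.I * ((∑ n : Fin j, u n * (-(exerciseSign w N (n + 1) /
          (σ * Real.sqrt ((T (n + 1) : ℝ) - T 0))) * ((X (T (n + 1)) ω - X (T 0) ω) -
            m * ((T (n + 1) : ℝ) - T 0))) : ℝ) : ℂ)) =
      Complex.exp (-(Complex.I * m * ((∑ n, b n * ((T (n + 1) : ℝ) - T 0) : ℝ) : ℂ)) -
        ((θ * r * ((T j : ℝ) - T 0) : ℝ) : ℂ)) *
      Complex.exp (Complex.I * ∑ n : Fin j, ((b n : ℂ) - Complex.I * (lastCoord j θ n : ℂ)) *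
        ((X (T (n + 1)) ω - X (T 0) ω : ℝ) : ℂ)) := by
    intro ω
    rw [Complex.ofReal_exp, ← Complex.exp_add, ← Complex.exp_add]
    congr 1
    have h1 : ∑ n : Fin j, u n * (-(exerciseSign w N (n + 1) /
          (σ * Real.sqrt ((T (n + 1) : ℝ) - T 0))) * ((X (T (n + 1)) ω - X (T 0) ω) -
            m * ((T (n + 1) : ℝ) - T 0))) =
        ∑ n : Fin j, b n * (X (T (n + 1)) ω - X (T 0) ω) -
          m * ∑ n, b n * ((T (n + 1) : ℝ) - T 0) := by
      rw [Finset.mul_sum, ← Finset.sum_sub_distrib]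
      refine Finset.sum_congr rfl fun n _ => ?_
      rw [hb]; ring
    have h2 : ∑ n : Fin j, ((b n : ℂ) - Complex.I * (lastCoord j θ n : ℂ)) *
        ((X (T (n + 1)) ω - X (T 0) ω : ℝ) : ℂ) =
        ((∑ n : Fin j, b n * (X (T (n + 1)) ω - X (T 0) ω) : ℝ) : ℂ) -
          Complex.I * ((∑ n, lastCoord j θ n * (X (T (n + 1)) ω - X (T 0) ω) : ℝ) : ℂ) := by
      push_cast
      rw [Finset.mul_sum, ← Finset.sum_sub_distrib]
      refine Finset.sum_congr rfl fun n _ => ?_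
      ring
    rw [h1, h2, Complex.ofReal_sub, Complex.ofReal_sub, Complex.ofReal_mul m]
    linear_combination ((∑ n, lastCoord j θ n * (X (T (n + 1)) ω - X (T 0) ω) : ℝ) : ℂ) *
      Complex.I_sq
  simp_rw [e]
  rw [integral_const_mul, hpath, ← Complex.exp_add]
  congr 1
  ring

/-- The exercise probabilities in the Gaussian case, under `Q` if `θ = 0` and under the measure
with the discounted stock as density if `θ = 1`. -/
theorem IsLevy.integral_exerciseEvent_gauss (hX : IsLevy X Q) (hψ : HasCharExponent X Q ψ)
    (hσ : 0 < σ) (hquad : ∀ ξ : ℂ, ψ ξ = Complex.I * ((σ ^ 2 / 2 - r : ℝ) : ℂ) * ξ +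
      ((σ ^ 2 / 2 : ℝ) : ℂ) * ξ ^ 2) (hT : ∀ j < N, T j < T (j + 1))
    (hw : ∀ j ∈ Finset.Icc 1 N, w j = 1 ∨ w j = -1) {S : ℕ → ℝ} {s : ℝ} (hs : 0 < s)
    {j : ℕ} (hj : j ≤ N) (hS : ∀ n ∈ Finset.Icc 1 j, 0 < S n) {θ : ℝ} (hθ : θ = 0 ∨ θ = 1) :
    ∫ ω, (exerciseEvent X T w S N s j).indicator
        (fun ω => Real.exp (∑ n, lastCoord j θ n * (X (T (n + 1)) ω - X (T 0) ω))) ω ∂Q =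
      Real.exp (θ * r * ((T j : ℝ) - T 0)) * gaussTerm r σ T w N S s (2 * θ - 1) j := by
  set f : Ω → ℝ := fun ω => Real.exp (∑ n, lastCoord j θ n * (X (T (n + 1)) ω - X (T 0) ω) -
          θ * r * ((T j : ℝ) - T 0)) with hf
  set m : ℝ := r + (2 * θ - 1) * (σ ^ 2 / 2) with hm
  have hsub : ∀ n : ℕ, Measurable fun ω => X (T (n + 1)) ω - X (T 0) ω :=
    fun n => hX.measurable_sub _ _
  have hfm : Measurable f :=
    ((Finset.measurable_fun_sum Finset.univ fun (n : Fin j) _ =>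
      (hsub n).const_mul (lastCoord j θ n)).sub_const _).exp
  have hf0 : ∀ ω, 0 ≤ f ω := fun ω => (Real.exp_pos _).le
  have hfint : Integrable f Q := by
    have hRL := isRLPEExponent_quadratic hσ hquad (-2) 1
    have := hX.integrable_exp_path hψ hRL (by norm_num) (by norm_num) (by norm_num) hT hj
      (c := lastCoord j θ) (fun k => by
        rw [sum_Ici_lastCoord]; rcases hθ with rfl | rfl <;> norm_num)
    simp only [hf, Real.exp_sub]
    exact this.div_const _
  let μ : Measure Ω := Q.withDensity fun ω => ENNReal.ofReal (f ω)
  have : IsFiniteMeasure μ := isFiniteMeasure_withDensity_ofReal hfint.2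
  let Z : Ω → EuclideanSpace ℝ (Fin j) := fun ω => WithLp.toLp 2 fun n : Fin j =>
    -(exerciseSign w N (n + 1) / (σ * Real.sqrt ((T (n + 1) : ℝ) - T 0))) *
      ((X (T (n + 1)) ω - X (T 0) ω) - m * ((T (n + 1) : ℝ) - T 0))
  have hZ : Measurable Z := (PiLp.continuous_toLp 2 _).measurable.comp
    (measurable_pi_lambda _ fun n => ((hsub n).sub_const _).const_mul _)
  have hlaw : μ.map Z = multivariateGaussian 0 (corrMatrix T w N j) := by
    apply Measure.ext_of_charFun
    funext u
    rw [charFun_multivariateGaussian (posSemidef_corrMatrix hT hj), charFun_apply,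
      integral_map hZ.aemeasurable (Continuous.aestronglyMeasurable (by fun_prop)),
      integral_withDensity_eq_integral_toReal_smul hfm.ennreal_ofReal
      (ae_of_all _ fun _ => ENNReal.ofReal_lt_top)]
    refine Eq.trans (integral_congr_ae (ae_of_all _ fun ω => ?_))
      ((hX.integral_cexp_normalized (w := w) hψ hσ hquad hT hj hθ u.ofLp).trans ?_)
    · simp only
      rw [ENNReal.toReal_ofReal (hf0 ω), Complex.real_smul]
      congr 2
      simp only [Z, PiLp.inner_apply, RCLike.inner_apply, conj_trivial]
      rw [mul_comm]
    · simp
  have hset : exerciseEvent X T w S N s j = Z ⁻¹' {y : EuclideanSpace ℝ (Fin j) | ∀ n, y n ≤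
      exerciseSign w N (n + 1) * dGauss r σ T S s (2 * θ - 1) (n + 1)} := by
    have hiff : ∀ (ω : Ω) (n : Fin j), exerciseSign w N (n + 1) * S (n + 1) ≤
        exerciseSign w N (n + 1) * stockAt X T s (n + 1) ω ↔ Z ω n ≤
          exerciseSign w N (n + 1) * dGauss r σ T S s (2 * θ - 1) (n + 1) := by
      intro ω n
      have hSn : 0 < S (n + 1) := hS _ (by simp)
      have hst : 0 < stockAt X T s (n + 1) ω := mul_pos hs (Real.exp_pos _)
      have ht := Real.sqrt_pos.2 (date_pos hT (n := n) (n.2.trans_le hj))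
      have hσt : 0 < σ * Real.sqrt ((T (n + 1) : ℝ) - T 0) := mul_pos hσ ht
      have e1 : exerciseSign w N (n + 1) * dGauss r σ T S s (2 * θ - 1) (n + 1) - Z ω n =
          exerciseSign w N (n + 1) * (Real.log (stockAt X T s (n + 1) ω) - Real.log (S (n + 1))) /
            (σ * Real.sqrt ((T (n + 1) : ℝ) - T 0)) := by
        simp only [Z, dGauss, stockAt, hm]
        rw [Real.log_mul hs.ne' (Real.exp_pos _).ne', Real.log_exp, Real.log_div hs.ne' hSn.ne']
        ring
      rw [← sub_nonneg (a := exerciseSign w N (n + 1) * dGauss r σ T S s (2 * θ - 1) (n + 1)), e1,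
        show ∀ x : ℝ, 0 ≤ x / (σ * Real.sqrt ((T (n + 1) : ℝ) - T 0)) ↔ 0 ≤ x from
          fun x => by rw [le_div_iff₀ hσt, zero_mul]]
      have hlog := Real.log_le_log_iff hSn hst
      have hlog' := Real.log_le_log_iff hst hSn
      rcases exerciseSign_eq hw (j := n + 1) (by omega) with h | h <;> rw [h]
      · rw [one_mul, one_mul, one_mul, sub_nonneg, hlog]
      · rw [neg_one_mul, neg_one_mul, neg_one_mul, neg_le_neg_iff, neg_sub, sub_nonneg, hlog']
    ext ω
    constructor
    · intro hω n
      exact (hiff ω n).1 (hω (n + 1) (by simp))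
    · intro hω n hn
      rw [Finset.mem_Icc] at hn
      obtain ⟨i, rfl⟩ : ∃ i, n = i + 1 := ⟨n - 1, by omega⟩
      exact (hiff ω ⟨i, by omega⟩).2 (hω ⟨i, by omega⟩)
  have hBm : MeasurableSet {y : EuclideanSpace ℝ (Fin j) | ∀ n, y n ≤
      exerciseSign w N (n + 1) * dGauss r σ T S s (2 * θ - 1) (n + 1)} := by
    rw [show {y : EuclideanSpace ℝ (Fin j) | ∀ n, y n ≤
      exerciseSign w N (n + 1) * dGauss r σ T S s (2 * θ - 1) (n + 1)} = ⋂ n : Fin j, {y | y n ≤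
      exerciseSign w N (n + 1) * dGauss r σ T S s (2 * θ - 1) (n + 1)} by ext; simp]
    exact MeasurableSet.iInter fun n => measurableSet_le (by fun_prop) measurable_const
  have hEm : MeasurableSet (exerciseEvent X T w S N s j) := by rw [hset]; exact hZ hBm
  have hg : gaussTerm r σ T w N S s (2 * θ - 1) j =
      ∫ ω, (exerciseEvent X T w S N s j).indicator f ω ∂Q := by
    rw [gaussTerm, normalCDF, ← hlaw, map_measureReal_apply hZ hBm, ← hset,
      integral_indicator hEm, Measure.real, withDensity_apply _ hEm,
      integral_eq_lintegral_of_nonneg_ae (ae_of_all _ hf0) hfm.aestronglyMeasurable]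
  rw [hg, ← integral_const_mul]
  refine integral_congr_ae (ae_of_all _ fun ω => ?_)
  simp only
  by_cases hω : ω ∈ exerciseEvent X T w S N s j
  · rw [Set.indicator_of_mem hω, Set.indicator_of_mem hω, hf, ← Real.exp_add]
    congr 1; ring
  · rw [Set.indicator_of_notMem hω, Set.indicator_of_notMem hω, mul_zero]

end Gauss

/-! ### The valuation formula -/

section Valuation

set_option linter.unusedSectionVars false

variable {Ω : Type*} [MeasurableSpace Ω] {Q : Measure Ω} [IsProbabilityMeasure Q]
  {X : ℝ≥0 → Ω → ℝ} {ψ : ℂ → ℂ} {υ lm lp r σ : ℝ} {T : ℕ → ℝ≥0} {K w : ℕ → ℝ} {N : ℕ}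

lemma sum_lastCoord_mul {j : ℕ} (hj : 1 ≤ j) (θ : ℝ) (f : ℕ → ℝ) :
    ∑ n : Fin j, lastCoord j θ n * f (n + 1) = θ * f j := by
  rw [Finset.sum_eq_single (⟨j - 1, by omega⟩ : Fin j)]
  · rw [lastCoord, if_pos (by simp only; omega)]
    simp only [Nat.sub_add_cancel hj]
  · intro n _ hn
    rw [lastCoord, if_neg, zero_mul]
    intro h
    exact hn (Fin.ext (by simp only; omega))
  · simp

lemma lastCoord_zero (j : ℕ) : lastCoord j 0 = 0 := by
  funext n; simp [lastCoord]

lemma shiftLast_eq {j : ℕ} (ξ : Fin j → ℂ) :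
    shiftLast j ξ = fun n => ξ n - Complex.I * ((lastCoord j 1 n : ℝ) : ℂ) := by
  funext n
  rw [shiftLast, lastCoord]
  split_ifs <;> simp

lemma AdmissibleShift.sum_mem {om : ℕ → ℝ} (ho : AdmissibleShift w N lm lp om) {j : ℕ}
    (hj : j ≤ N) (k : Fin j) {θ : ℝ} (hθ : θ = 0 ∨ θ = 1) :
    ∑ n ∈ Finset.Ici k, (exerciseSign w N (n + 1) * om (n + 1) + lastCoord j θ n) ∈
      Set.Ioo (-lp) (-lm) := by
  have h1 := ho.2 (k + 1) j (by omega) k.2 hj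
  rw [Finset.sum_add_distrib, sum_Ici_lastCoord,
    sum_Ici_eq_sum_Icc k (fun n => exerciseSign w N n * om n)]
  rcases hθ with rfl | rfl
  · exact ⟨by linarith [h1.1], by linarith [h1.2]⟩
  · exact ⟨by linarith [h1.1], by linarith [h1.2]⟩

lemma termSign_eq (j : ℕ) : termSign w N j =
    (∏ n ∈ Finset.Icc 1 j, w n) * ∏ n ∈ Finset.Icc 1 j, exerciseSign w N n :=
  Finset.prod_mul_distrib

/-- The stock received, as a contour integral. -/
lemma IsLevy.stockTerm_eq (hX : IsLevy X Q) (hψ : HasCharExponent X Q ψ)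
    (h : IsRLPEExponent ψ υ lm lp) (hυ : 0 < υ) (hlm : lm < 0) (hlp : 0 < lp) (hN : 1 ≤ N)
    (hT : ∀ j < N, T j < T (j + 1)) (hw : ∀ j ∈ Finset.Icc 1 N, w j = 1 ∨ w j = -1)
    {S om : ℕ → ℝ} {s : ℝ} (hs : 0 < s) (hS : ∀ n ∈ Finset.Icc 1 N, 0 < S n)
    (ho : AdmissibleShift w N lm lp om) :
    Integrable (stockIntegrand ψ T w N S om s) ∧
      stockTerm ψ r T w N S om s = ((s * (discountSign r T w N *
        ∫ ω, (exerciseEvent X T w S N s N).indicator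
          (fun ω => Real.exp (X (T N) ω - X (T 0) ω)) ω ∂Q) : ℝ) : ℂ) := by
  obtain ⟨h1, h2⟩ := hX.integral_exerciseEvent hψ h hυ hlm hlp hT hw hs le_rfl hS ho.1
    (ζ := lastCoord N 1) (fun k => ho.sum_mem le_rfl k (Or.inr rfl))
  have e1 : stockIntegrand ψ T w N S om s = fun x : Fin N → ℝ =>
      kernelFactor S s N (contourPoint w N om N x) * Complex.exp (-bigPsi ψ T N fun n =>
        contourPoint w N om N x n - Complex.I * ((lastCoord N 1 n : ℝ) : ℂ)) := by
    funext x
    rw [stockIntegrand, shiftLast_eq]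
  have e2 : ∀ ω, ∑ n : Fin N, lastCoord N 1 n * (X (T (n + 1)) ω - X (T 0) ω) =
      X (T N) ω - X (T 0) ω := fun ω => by
    rw [sum_lastCoord_mul hN 1 (fun n => X (T n) ω - X (T 0) ω), one_mul]
  simp_rw [e2] at h2
  refine ⟨by rw [e1]; exact h1, ?_⟩
  rw [stockTerm, e1, Complex.ofReal_mul s (_ * _), Complex.ofReal_mul (discountSign r T w N), h2,
    termSign_eq, discountSign]
  push_cast
  ring

/-- The strikes paid at `T_j`, as a contour integral. -/
lemma IsLevy.strikeTerm_eq (hX : IsLevy X Q) (hψ : HasCharExponent X Q ψ)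
    (h : IsRLPEExponent ψ υ lm lp) (hυ : 0 < υ) (hlm : lm < 0) (hlp : 0 < lp)
    (hT : ∀ j < N, T j < T (j + 1)) (hw : ∀ j ∈ Finset.Icc 1 N, w j = 1 ∨ w j = -1)
    {S om : ℕ → ℝ} {s : ℝ} (hs : 0 < s) (hS : ∀ n ∈ Finset.Icc 1 N, 0 < S n)
    (ho : AdmissibleShift w N lm lp om) {j : ℕ} (hj : j ≤ N)
    (hE : MeasurableSet (exerciseEvent X T w S N s j)) :
    Integrable (strikeIntegrand ψ T w N S om s j) ∧
      strikeTerm ψ r T K w N S om s j = ((discountSign r T w j *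
        (K j * Q.real (exerciseEvent X T w S N s j)) : ℝ) : ℂ) := by
  have hsub : Finset.Icc 1 j ⊆ Finset.Icc 1 N := Finset.Icc_subset_Icc_right hj
  obtain ⟨h1, h2⟩ := hX.integral_exerciseEvent hψ h hυ hlm hlp hT hw hs hj
    (fun n hn => hS n (hsub hn)) (fun n hn => ho.1 n (hsub hn))
    (ζ := lastCoord j 0) (fun k => ho.sum_mem hj k (Or.inl rfl))
  simp only [lastCoord_zero, Pi.zero_apply, Complex.ofReal_zero, mul_zero, sub_zero, zero_mul,
    Finset.sum_const_zero, Real.exp_zero] at h1 h2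
  rw [integral_indicator_const _ hE, smul_eq_mul, mul_one] at h2
  refine ⟨h1, ?_⟩
  rw [strikeTerm, Complex.ofReal_mul (discountSign r T w j),
    Complex.ofReal_mul (K j) (Q.real _), h2, termSign_eq, discountSign]
  simp only [strikeIntegrand]
  push_cast
  ring

/-- Pricing and sensitivity of the compound option by contour integrals. -/
theorem IsLevy.contourFormula_eq (hX : IsLevy X Q) (hψ : HasCharExponent X Q ψ)
    (h : IsRLPEExponent ψ υ lm lp) (hυ : 0 < υ) (hlm : lm < 0) (hlp : 0 < lp)
    (M : StockModel X Q r T N) (hN : 1 ≤ N) (hT : ∀ j < N, T j < T (j + 1))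
    (hw : ∀ j ∈ Finset.Icc 1 N, w j = 1 ∨ w j = -1) {S om : ℕ → ℝ} {s : ℝ} (hs : 0 < s)
    (hS : IsCritical X Q r T K w N 1 S) (ho : AdmissibleShift w N lm lp om) :
    ContoursConverge ψ T w N S om s ∧
      ((value X Q r T K w N 0 s : ℝ) : ℂ) = contourFormula ψ r T K w N S om s ∧
      ∃ δ : ℝ, HasDerivAt (value X Q r T K w N 0) δ s ∧
        (δ : ℂ) = stockTerm ψ r T w N S om s / (s : ℂ) := by
  have hSpos : ∀ n ∈ Finset.Icc 1 N, 0 < S n := fun n hn => (hS n hn).1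
  have hstock := hX.stockTerm_eq (r := r) hψ h hυ hlm hlp hN hT hw hs hSpos ho
  have hstrike := fun j (hj : j ∈ Finset.Icc 1 N) => hX.strikeTerm_eq (r := r) (K := K) hψ h hυ hlm
    hlp hT hw hs hSpos ho (Finset.mem_Icc.1 hj).2 (M.measurableSet_exerciseEvent w S s j)
  refine ⟨⟨hstock.1, fun j hj => (hstrike j hj).1⟩, ?_, _, M.hasDerivAt_value hw hS hs, ?_⟩
  · rw [contourFormula, hstock.2, Finset.sum_congr rfl fun j hj => (hstrike j hj).2,
      M.value_eq hw hS s, ← Complex.ofReal_sum, ← Complex.ofReal_sub, Complex.ofReal_inj]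
    congr 1
    have : (exerciseEvent X T w S N s N).indicator (stockAt X T s N) = fun ω =>
        s * (exerciseEvent X T w S N s N).indicator
          (fun ω => Real.exp (X (T N) ω - X (T 0) ω)) ω := by
      funext ω
      by_cases hω : ω ∈ exerciseEvent X T w S N s N
      · rw [Set.indicator_of_mem hω, Set.indicator_of_mem hω, stockAt]
      · rw [Set.indicator_of_notMem hω, Set.indicator_of_notMem hω, mul_zero]
    rw [this, integral_const_mul]
    ring
  · rw [hstock.2, Complex.ofReal_mul s, mul_div_cancel_left₀]
    exact Complex.ofReal_ne_zero.2 hs.ne'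

/-- In the Gaussian case the exercise probabilities are multivariate normal probabilities. -/
theorem IsLevy.value_eq_gaussFormula (hX : IsLevy X Q) (hψ : HasCharExponent X Q ψ)
    (M : StockModel X Q r T N) (hσ : 0 < σ)
    (hquad : ∀ ξ : ℂ, ψ ξ = Complex.I * ((σ ^ 2 / 2 - r : ℝ) : ℂ) * ξ +
      ((σ ^ 2 / 2 : ℝ) : ℂ) * ξ ^ 2) (hN : 1 ≤ N) (hT : ∀ j < N, T j < T (j + 1))
    (hw : ∀ j ∈ Finset.Icc 1 N, w j = 1 ∨ w j = -1) {S : ℕ → ℝ} {s : ℝ} (hs : 0 < s)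
    (hS : IsCritical X Q r T K w N 1 S) :
    value X Q r T K w N 0 s = gaussFormula r σ T K w N S s := by
  have hSpos : ∀ n ∈ Finset.Icc 1 N, 0 < S n := fun n hn => (hS n hn).1
  have h1 : ∫ ω, (exerciseEvent X T w S N s N).indicator (stockAt X T s N) ω ∂Q =
      s * (Real.exp (r * ((T N : ℝ) - T 0)) * gaussTerm r σ T w N S s 1 N) := by
    have := hX.integral_exerciseEvent_gauss hψ hσ hquad hT hw hs le_rfl hSpos (Or.inr rfl)
    norm_num at this
    rw [← this, ← integral_const_mul]
    refine integral_congr_ae (ae_of_all _ fun ω => ?_)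
    simp only
    by_cases hω : ω ∈ exerciseEvent X T w S N s N
    · rw [Set.indicator_of_mem hω, Set.indicator_of_mem hω, stockAt,
        sum_lastCoord_mul hN 1 (fun n => X (T n) ω - X (T 0) ω), one_mul]
    · rw [Set.indicator_of_notMem hω, Set.indicator_of_notMem hω, mul_zero]
  have h2 : ∀ j ∈ Finset.Icc 1 N, Q.real (exerciseEvent X T w S N s j) =
      gaussTerm r σ T w N S s (-1) j := by
    intro j hj
    have hjN := (Finset.mem_Icc.1 hj).2
    have := hX.integral_exerciseEvent_gauss hψ hσ hquad hT hw hs hjN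
      (fun n hn => hSpos n (Finset.Icc_subset_Icc_right hjN hn)) (Or.inl rfl)
    simp only [lastCoord_zero, Pi.zero_apply, zero_mul, Finset.sum_const_zero, Real.exp_zero,
      one_mul, mul_zero, zero_sub] at this
    rwa [integral_indicator_const _ (M.measurableSet_exerciseEvent w S s j), smul_eq_mul,
      mul_one] at this
  rw [M.value_eq hw hS s, h1, gaussFormula]
  congr 1
  · have : Real.exp (-(r * ((T N : ℝ) - T 0))) * Real.exp (r * ((T N : ℝ) - T 0)) = 1 := by
      rw [← Real.exp_add]; simp
    rw [discountSign]
    linear_combination (s * (∏ n ∈ Finset.Icc 1 N, w n) * gaussTerm r σ T w N S s 1 N) * this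
  · refine Finset.sum_congr rfl fun j hj => ?_
    rw [h2 j hj, discountSign]
    ring

lemma abs_sum_exerciseSign_mul_le (hw : ∀ j ∈ Finset.Icc 1 N, w j = 1 ∨ w j = -1) {om : ℕ → ℝ}
    (ho : ∀ n ∈ Finset.Icc 1 N, 0 < om n) {k j : ℕ} (hk : 1 ≤ k) (hj : j ≤ N) :
    |∑ n ∈ Finset.Icc k j, exerciseSign w N n * om n| ≤ ∑ n ∈ Finset.Icc 1 N, om n := by
  have hsub : Finset.Icc k j ⊆ Finset.Icc 1 N := Finset.Icc_subset_Icc hk hj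
  refine (Finset.abs_sum_le_sum_abs _ _).trans (le_trans (Finset.sum_le_sum fun n hn => ?_)
    (Finset.sum_le_sum_of_subset_of_nonneg hsub fun n hn _ => (ho n hn).le))
  rw [abs_mul, abs_eq_one_of_sign (exerciseSign_eq hw (hk.trans (Finset.mem_Icc.1 hn).1)), one_mul,
    abs_of_pos (ho n (hsub hn))]

lemma exists_admissibleShift (hw : ∀ j ∈ Finset.Icc 1 N, w j = 1 ∨ w j = -1) (hlm : lm < -1)
    (hlp : 0 < lp) : ∃ om : ℕ → ℝ, AdmissibleShift w N lm lp om := by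
  have hm : 0 < min lp (-lm - 1) := lt_min hlp (by linarith)
  have hc : 0 < min lp (-lm - 1) / (N + 1) := by positivity
  refine ⟨fun _ => min lp (-lm - 1) / (N + 1), fun _ _ => hc, fun k j hk _ hj => ?_⟩
  have h1 := abs_sum_exerciseSign_mul_le hw (om := fun _ => min lp (-lm - 1) / (N + 1))
    (fun _ _ => hc) hk hj
  have h2 : ∑ n ∈ Finset.Icc 1 N, min lp (-lm - 1) / ((N : ℝ) + 1) < min lp (-lm - 1) := by
    rw [Finset.sum_const, Nat.card_Icc, Nat.add_sub_cancel, nsmul_eq_mul]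
    have : min lp (-lm - 1) / ((N : ℝ) + 1) * (N + 1) = min lp (-lm - 1) := by field_simp
    linarith
  have h3 := abs_lt.1 (h1.trans_lt h2)
  exact ⟨by linarith [min_le_left lp (-lm - 1)], by linarith [min_le_right lp (-lm - 1)]⟩

end Valuation

end Compound

end

theorem mainTheorem3 {Ω : Type*} [MeasurableSpace Ω] (Q : Measure Ω) [IsProbabilityMeasure Q]
    (X : ℝ≥0 → Ω → ℝ) (ψ : ℂ → ℂ) (υ lm lp r : ℝ)
    (hυ : υ ∈ Set.Ioc (0 : ℝ) 2) (hlm : lm < -1) (hlp : 0 < lp) (hr : 0 ≤ r)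
    (hX : Compound.IsLevy X Q) (hψ : Compound.HasCharExponent X Q ψ)
    (hRLPE : Compound.IsRLPEExponent ψ υ lm lp)
    (hEMM : (r : ℂ) + ψ (-Complex.I) = 0)
    (N : ℕ) (hN : 1 ≤ N) (T : ℕ → ℝ≥0) (hT : ∀ j < N, T j < T (j + 1))
    (K w : ℕ → ℝ) (hK : ∀ j ∈ Finset.Icc 1 N, 0 < K j)
    (hw : ∀ j ∈ Finset.Icc 1 N, w j = 1 ∨ w j = -1) :
    -- the prices are the discounted conditional expectations of the exercise payoffs
    (∀ j < N,
      (∀ s : ℝ, 0 < s → Integrable (fun ω => Compound.discountedPayoff r T K w j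
        (Compound.value X Q r T K w (N - (j + 1)) (j + 1)
          (s * Real.exp (X (T (j + 1)) ω - X (T j) ω)))) Q) ∧
      Integrable (fun ω => Compound.discountedPayoff r T K w j
        (Compound.value X Q r T K w (N - (j + 1)) (j + 1) (Real.exp (X (T (j + 1)) ω)))) Q ∧
      Q[fun ω => Compound.discountedPayoff r T K w j
        (Compound.value X Q r T K w (N - (j + 1)) (j + 1) (Real.exp (X (T (j + 1)) ω)))
        | MeasurableSpace.comap (X (T j)) inferInstance]
      =ᵐ[Q] fun ω => Compound.value X Q r T K w (N - j) j (Real.exp (X (T j) ω))) ∧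
    -- critical prices of compound calls exist and are unique
    (∀ j ∈ Finset.Ico 1 N, (∀ n ∈ Finset.Icc (j + 1) N, w n = 1) →
      ∃! s : ℝ, 0 < s ∧ Compound.value X Q r T K w (N - j) j s = K j) ∧
    -- admissible contours exist
    (∃ ω : ℕ → ℝ, Compound.AdmissibleShift w N lm lp ω) ∧
    -- claims about given critical prices
    (∀ Sstar : ℕ → ℝ,
      (∀ j ∈ Finset.Ico 1 N,
        0 < Sstar j ∧ Compound.value X Q r T K w (N - j) j (Sstar j) = K j) →
      Sstar N = K N →
      -- uniqueness
      (∀ j ∈ Finset.Ico 1 N, ∀ s : ℝ, 0 < s →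
        Compound.value X Q r T K w (N - j) j s = K j → s = Sstar j) ∧
      ∀ s : ℝ, 0 < s →
        -- decomposition of the payoff
        (Integrable (Compound.stockAt X T s N) Q ∧
        Compound.value X Q r T K w N 0 s =
          ∫ ω, (Real.exp (-(r * ((T N : ℝ) - (T 0 : ℝ)))) * (∏ n ∈ Finset.Icc 1 N, w n) *
              (Compound.exerciseEvent X T w Sstar N s N).indicator
                (Compound.stockAt X T s N) ω -
            ∑ j ∈ Finset.Icc 1 N,
              Real.exp (-(r * ((T j : ℝ) - (T 0 : ℝ)))) * (∏ n ∈ Finset.Icc 1 j, w n) *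
              (Compound.exerciseEvent X T w Sstar N s j).indicator (fun _ => K j) ω) ∂Q) ∧
        -- valuation formula and sensitivity to the stock price
        (∀ ω : ℕ → ℝ, Compound.AdmissibleShift w N lm lp ω →
          Compound.ContoursConverge ψ T w N Sstar ω s ∧
          ((Compound.value X Q r T K w N 0 s : ℝ) : ℂ) =
            Compound.contourFormula ψ r T K w N Sstar ω s ∧
          ∃ δ : ℝ, HasDerivAt (Compound.value X Q r T K w N 0) δ s ∧
            (δ : ℂ) = Compound.stockTerm ψ r T w N Sstar ω s / (s : ℂ)) ∧
        -- Gaussian case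
        (∀ σ : ℝ, 0 < σ →
          (∀ ξ : ℂ, ψ ξ = Complex.I * ((σ ^ 2 / 2 - r : ℝ) : ℂ) * ξ +
            ((σ ^ 2 / 2 : ℝ) : ℂ) * ξ ^ 2) →
          (∀ ω : ℕ → ℝ, (∀ n ∈ Finset.Icc 1 N, 0 < ω n) →
            Compound.ContoursConverge ψ T w N Sstar ω s ∧
            Compound.contourFormula ψ r T K w N Sstar ω s =
              ((Compound.gaussFormula r σ T K w N Sstar s : ℝ) : ℂ)) ∧
          Compound.value X Q r T K w N 0 s = Compound.gaussFormula r σ T K w N Sstar s)) := by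
  have hυ0 := hυ.1
  have hlm0 : lm < 0 := by linarith
  have M := hX.stockModel hψ hRLPE hυ0 hlm hlp hEMM hT
  refine ⟨fun j hj => ?_, fun j hj hcall => ?_, Compound.exists_admissibleShift hw hlm hlp,
    fun Sstar hSstar hSN => ?_⟩
  · have hTpos : (0 : ℝ≥0) < T (j + 1) := (zero_le).trans_lt (hT j hj)
    have hint : Integrable (fun ω => Real.exp (X (T (j + 1)) ω)) Q := by
      refine (hX.integrable_exp_mul_sub hψ hRLPE hυ0 hlm0 hlp hTpos (θ := 1)
        ⟨by linarith, by linarith⟩).congr ?_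
      filter_upwards [hX.zero] with ω h0
      rw [h0, one_mul, sub_zero]
    have h1 := Compound.condExp_discountedPayoff (K := K) (m := N - (j + 1)) M hX hw (by omega)
      (hT j hj).le hint
    refine ⟨fun s _ => M.integrable_value_payoff hw (by omega) s, h1.1, ?_⟩
    rw [show N - j = N - (j + 1) + 1 by omega]
    exact h1.2
  · rw [Finset.mem_Ico] at hj
    exact M.existsUnique_critical_call hK hw hj.1 hj.2.le hcall
  · have hcrit : Compound.IsCritical X Q r T K w N 1 Sstar := by
      intro n hn
      rw [Finset.mem_Icc] at hn
      rcases hn.2.eq_or_lt with rfl | hlt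
      · rw [hSN]
        exact ⟨hK n (Finset.mem_Icc.2 hn), by rw [Nat.sub_self]; rfl⟩
      · exact hSstar n (Finset.mem_Ico.2 ⟨hn.1, hlt⟩)
    refine ⟨fun j hj s hs hval => ?_, fun s hs => ⟨⟨M.integrable_stockAt s le_rfl, ?_⟩, ?_, ?_⟩⟩
    · have hSj := hSstar j hj
      rw [Finset.mem_Ico] at hj
      exact M.value_injOn hw (N - j) j (by omega) (hcrit.mono (by omega)) hs hSj.1
        (hval.trans hSj.2.symm)
    · have hE := fun j => M.measurableSet_exerciseEvent w Sstar s j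
      rw [M.value_eq hw hcrit s, integral_sub, integral_const_mul, integral_finsetSum]
      · congr 1
        refine Finset.sum_congr rfl fun j _ => ?_
        rw [integral_const_mul, integral_indicator_const _ (hE j), smul_eq_mul,
          Compound.discountSign, mul_comm (K j)]
      · exact fun j _ => ((integrable_const _).indicator (hE j)).const_mul _
      · exact ((M.integrable_stockAt s le_rfl).indicator (hE N)).const_mul _
      · exact integrable_finsetSum _ fun j _ =>
          ((integrable_const _).indicator (hE j)).const_mul _
    · intro ω hω
      exact hX.contourFormula_eq hψ hRLPE hυ0 hlm0 hlp M hN hT hw hs hcrit hω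
    · intro σ hσ hquad
      have hval := hX.value_eq_gaussFormula hψ M hσ hquad hN hT hw hs hcrit
      refine ⟨fun ω hω => ?_, hval⟩
      -- The exponent is regular on every strip, so any positive shift is admissible for one.
      have hB : 0 ≤ ∑ n ∈ Finset.Icc 1 N, ω n := Finset.sum_nonneg fun n hn => (hω n hn).le
      have hadm : Compound.AdmissibleShift w N (-(∑ n ∈ Finset.Icc 1 N, ω n) - 2)
          (∑ n ∈ Finset.Icc 1 N, ω n + 1) ω := by
        refine ⟨hω, fun k j hk _ hj => ?_⟩
        have := abs_le.1 (Compound.abs_sum_exerciseSign_mul_le hw hω hk hj)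
        exact ⟨by linarith [this.1], by linarith [this.2]⟩
      have h1 := hX.contourFormula_eq hψ (Compound.isRLPEExponent_quadratic hσ hquad _ _)
        two_pos (by linarith) (by linarith) M hN hT hw hs hcrit hadm
      exact ⟨h1.1, by rw [← h1.2.1, hval]⟩
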